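/- Setting. Let $n\ge 2$, let $\Omega\subset\mathbb R^n$ be a bounded polyhedral domain, let $\alpha:\Omega\to\mathbb R^{n\times n}$ be measurable and symmetric positive definite at every point, with $\alpha$ and $c=\alpha^{-1}$ bounded, and fix $k\ge 0$ and a shape regularity constant $\gamma$. Let $\mathcal T_h$ be a conforming simplicial mesh of $\Omega$ that is shape regular with constant $\gamma$ (each $K\in\mathcal T_h$ contains a ball of radius $\rho>0$ with $h_K\le\gamma\rho$), with $h_K=\operatorname{diam}K$ and $h=\max_K h_K$. Let $\tau\ge 0$ be a penalty function, possibly double-valued on interior faces, each of whose branches is constant on each face, and which is positive on at least one face of every $K$ (in its branch from $K$). Let $$W_h=\{w: w|_K\in P_k(K)\ \forall K\},\qquad V_h=\{v: v|_K\in P_k(K)^n\ \forall K\},$$ $$M_h=\{\mu:\ \mu|_F\in P_k(F)\text{ for every mesh face }F,\ \mu|_F=0\text{ if }F\subseteq\partial\Omega\}.$$ Write $(v,w)=\sum_K\int_K vw\,dx$ and $\langle v,w\rangle=\sum_K\int_{\partial K}vw\,ds$ (using the branches from $K$), with $n$ in boundary terms denoting the outward unit normal of $K$. HDG eigenvalues.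 $\lambda_h\in\mathbb R$ is an HDG eigenvalue if there is a nontrivial $(q_h,u_h,\eta_h)\in V_h\times W_h\times M_h$ such that, with $\hat q_h=q_h+\tau(u_h-\eta_h)n$, $$(c\,q_h,r)-(u_h,\operatorname{div}r)+\langle\eta_h,r\cdot n\rangle=0,\qquad -(q_h,\nabla w)+\langle\hat q_h\cdot n,w\rangle=\lambda_h(u_h,w),\qquad \langle\mu,\hat q_h\cdot n\rangle=0$$ for all $r\in V_h$, $w\in W_h$, $\mu\in M_h$. Local solution operators. For $\mu\in M_h$, the functions $\mathcal Q\mu\in V_h$ and $\mathcal U\mu\in W_h$ are defined on each $K$ by $$(c\,\mathcal Q\mu,r)_K-(\mathcal U\mu,\operatorname{div}r)_K=-\langle\mu,r\cdot n\rangle_{\partial K},\qquad (w,\operatorname{div}\mathcal Q\mu)_K+\langle\tau(\mathcal U\mu-\mu),w\rangle_{\partial K}=0$$ for all $r\in P_k(K)^n$, $w\in P_k(K)$. For $f\in L^2$, the functions $\mathcal Q^Wf\in V_h$ and $\mathcal U^Wf\in W_h$ are defined by the same system with $\mu=0$ and with the right-hand side of the second equation replaced by $(f,w)_K$. Put $$a_h(\eta,\mu)=(c\,\mathcal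 Q\eta,\mathcal Q\mu)+\langle\tau(\mathcal U\eta-\eta),\mathcal U\mu-\mu\rangle .$$ The linear condensed eigenproblem is to find $\tilde\lambda_h>0$ and $0\ne\tilde\eta_h\in M_h$ with $$a_h(\tilde\eta_h,\mu)=\tilde\lambda_h\,(\mathcal U\tilde\eta_h,\mathcal U\mu)\qquad\text{for all }\mu\in M_h.$$ Constants. Let $\tau_K^{\max}$ be the maximum of $\tau$ on $\partial K$, attained on a face $F_{\max}$, and $\tau_K^*$ its maximum on $\partial K\setminus F_{\max}$. Put $d^K_{h\tau}=1+(\tau_K^{\max}h_K)^{-1/2}$ and $c^K_{h\tau}=1+(\tau_K^*h_K)^{1/2}$. For $C_*>0$, call $(\mathcal T_h,\tau)$ admissible for $C_*$ if it is as above and $(d^K_{h\tau})^2h_K\le C_*$ and $c^K_{h\tau}\le C_*$ for all $K$. Call $C_0>0$ a local constant for $C_*$ if $$\|\mathcal U^Wf\|_{L^2(K)}\le C_0\,(d^K_{h\tau})^2h_K^2\,\|f\|_{L^2(K)}$$ for all admissible $(\mathcal T_h,\tau)$, all $K\in\mathcal T_h$ and all $f\in L^2(K)$. Theorem. There is a $C_0>0$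 that is a local constant for every $C_*>0$. Moreover, let $C_*>0$, let $C_0>0$ be any local constant for $C_*$, and let $0<C_3<(C_0C_*)^{-1}$. Then there is a constant $C>0$ such that for every $\Lambda>0$ there is an $h_0>0$ with the following property. For all $(\mathcal T_h,\tau)$ admissible for $C_*$ with $h\le h_0$, and for every HDG eigenvalue $\lambda_h$ with $\lambda_h<C_3/h$ and $\lambda_h\le\Lambda$, there is an eigenvalue $\tilde\lambda_h$ of the linear condensed eigenproblem with $$\frac{|\lambda_h-\tilde\lambda_h|}{\lambda_h}\le C\,\lambda_h\,\tilde\lambda_h\,h .$$ Thus $C$ is independent of the mesh, of $\tau$ and of $\lambda_h$, while $h_0$ depends on $\lambda_h$, only through an upper bound $\Lambda$ for it. -/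

import Mathlib

open MeasureTheory
open scoped Matrix

noncomputable section

namespace HDG

/-- Euclidean `n`-space. -/
abbrev E (n : ℕ) := EuclideanSpace ℝ (Fin n)

variable {n : ℕ}

/-! ### Domain and coefficient -/

/-- A (bounded, connected, open) polyhedral domain: its boundary is a finite union of convex
polytopes.  Domains with cracks are allowed. -/
structure IsPolyhedralDomain (Ω : Set (E n)) : Prop where
  isOpen : IsOpen Ω
  isConnected : IsConnected Ω
  isBounded : Bornology.IsBounded Ω
  boundary : ∃ 𝒮 : Finset (Finset (E n)), frontier Ω = ⋃ S ∈ 𝒮, convexHull ℝ (S : Set (E n))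

/-- The matrix coefficient `α`: measurable, symmetric positive definite at every point of `Ω`, and
bounded on `Ω` together with its inverse `c = α⁻¹`. -/
structure IsCoefficient (Ω : Set (E n)) (α : E n → Matrix (Fin n) (Fin n) ℝ) : Prop where
  measurable : ∀ a b, AEMeasurable (fun x => α x a b) (volume.restrict Ω)
  posDef : ∀ x ∈ Ω, (α x).PosDef
  bounded : ∃ β : ℝ, ∀ x ∈ Ω, ∀ a b, |α x a b| ≤ β ∧ |(α x)⁻¹ a b| ≤ β

/-! ### Simplices, faces, normals -/

/-- The closed `n`-simplex `K` with the given vertices. -/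
def cell (K : Affine.Simplex ℝ (E n) n) : Set (E n) := convexHull ℝ (Set.range K.points)

/-- The closed face of `K` opposite to its `i`-th vertex. -/
def face (K : Affine.Simplex ℝ (E n) n) (i : Fin (n + 1)) : Set (E n) :=
  convexHull ℝ (K.points '' {i}ᶜ)

/-- `h_K = diam K`. -/
def diamK (K : Affine.Simplex ℝ (E n) n) : ℝ := Metric.diam (cell K)

/-- The unit normal on the `i`-th face of `K` pointing out of `K`: it points from the `i`-th vertex
to the foot of its altitude. -/
def normal [NeZero n] (K : Affine.Simplex ℝ (E n) n) (i : Fin (n + 1)) : Fin n → ℝ :=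
  fun a => (K.height i)⁻¹ * (K.altitudeFoot i a - K.points i a)

/-- `∫_K g dx`. -/
def intK (K : Affine.Simplex ℝ (E n) n) (g : E n → ℝ) : ℝ := ∫ x in cell K, g x

/-- `∫_F g ds` over the `i`-th face `F` of `K`, for the `(n-1)`-dimensional surface measure
(Hausdorff measure normalized to agree with Lebesgue measure). -/
def intF (K : Affine.Simplex ℝ (E n) n) (i : Fin (n + 1)) (g : E n → ℝ) : ℝ :=
  ∫ x in face K i, g x ∂(Measure.euclideanHausdorffMeasure (n - 1))

/-! ### Polynomials -/

/-- Polynomials in `n` variables of degree at most `k`. -/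
abbrev Poly (n k : ℕ) := MvPolynomial.restrictTotalDegree (Fin n) ℝ k

/-- The value of a polynomial at a point. -/
def val (p : MvPolynomial (Fin n) ℝ) (x : E n) : ℝ := MvPolynomial.eval (fun a => x a) p

/-- The value of a vector of polynomials of degree at most `k` at a point. -/
def vecVal {k : ℕ} (r : Fin n → Poly n k) (x : E n) : Fin n → ℝ := fun a => val (r a).1 x

/-- The gradient of a polynomial at a point. -/
def gradVal (p : MvPolynomial (Fin n) ℝ) (x : E n) : Fin n → ℝ :=
  fun a => val (MvPolynomial.pderiv a p) x

/-- The divergence of a vector of polynomials at a point. -/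
def divVal {k : ℕ} (r : Fin n → Poly n k) (x : E n) : ℝ :=
  ∑ a, val (MvPolynomial.pderiv a (r a).1) x

/-! ### Meshes and penalty functions -/

/-- A conforming simplicial mesh of `Ω`: finitely many closed `n`-simplices with disjoint interiors
contained in `Ω`, covering the closure of `Ω`, any two of which meet exactly in the (possibly empty)
face spanned by their common vertices, and such that every mesh face either lies on the boundary of
`Ω` or has its relative interior inside `Ω`. -/
structure Mesh (Ω : Set (E n)) where
  N : ℕ
  elem : Fin N → Affine.Simplex ℝ (E n) n
  interior_subset : ∀ j, interior (cell (elem j)) ⊆ Ω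
  cover : ⋃ j, cell (elem j) = closure Ω
  disjoint : ∀ j j', j ≠ j' → Disjoint (interior (cell (elem j))) (interior (cell (elem j')))
  conforming : ∀ j j', j ≠ j' → cell (elem j) ∩ cell (elem j') =
    convexHull ℝ (Set.range (elem j).points ∩ Set.range (elem j').points)
  faces : ∀ j i, face (elem j) i ⊆ frontier Ω ∨ intrinsicInterior ℝ (face (elem j) i) ⊆ Ω

namespace Mesh

variable {Ω : Set (E n)}

/-- The mesh size `h = max_K h_K`. -/
def h (T : Mesh Ω) : ℝ := ⨆ j, diamK (T.elem j)

/-- Shape regularity with constant `γ`: each element `K` contains a ball of radius `ρ` with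
`h_K ≤ γ ρ`. -/
def ShapeRegular (T : Mesh Ω) (γ : ℝ) : Prop :=
  ∀ j, ∃ x : E n, ∃ ρ : ℝ, 0 < ρ ∧ Metric.closedBall x ρ ⊆ cell (T.elem j) ∧
    diamK (T.elem j) ≤ γ * ρ

/-- The mesh faces (as subsets of space; an interior face shared by two elements is one face). -/
def Face (T : Mesh Ω) : Type := {F : Set (E n) // ∃ j i, face (T.elem j) i = F}

/-- The `i`-th face of the `j`-th element as a mesh face. -/
def faceOf (T : Mesh Ω) (j : Fin T.N) (i : Fin (n + 1)) : T.Face := ⟨face (T.elem j) i, j, i, rfl⟩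

end Mesh

variable {Ω : Set (E n)}

/-- A penalty function `τ`: nonnegative, double valued on interior faces, each branch constant on
each face, and positive on at least one face of every element. `τ.val j i` is the branch from the
`j`-th element on its `i`-th face. -/
structure Penalty (T : Mesh Ω) where
  val : Fin T.N → Fin (n + 1) → ℝ
  nonneg : ∀ j i, 0 ≤ val j i
  exists_pos : ∀ j, ∃ i, 0 < val j i

/-- `F_max`: a face of an element at which `τ` is maximal. -/
def faceMax (t : Fin (n + 1) → ℝ) : Fin (n + 1) := Classical.choose (Finite.exists_max t)

/-- `τ_K^max`, the maximum of `τ` on the boundary of `K`. -/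
def tauMax (t : Fin (n + 1) → ℝ) : ℝ := t (faceMax t)

/-- `τ_K^*`, the maximum of `τ` on the boundary of `K` without `F_max`. -/
def tauStar (t : Fin (n + 1) → ℝ) : ℝ := ⨆ i : {i // i ≠ faceMax t}, t i

/-- `d_{hτ}^K = 1 + (τ_K^max h_K)^{-1/2}`. -/
def dConst (K : Affine.Simplex ℝ (E n) n) (t : Fin (n + 1) → ℝ) : ℝ :=
  1 + (tauMax t * diamK K) ^ (-(1 / 2) : ℝ)

/-- `c_{hτ}^K = 1 + (τ_K^* h_K)^{1/2}`. -/
def cConst (K : Affine.Simplex ℝ (E n) n) (t : Fin (n + 1) → ℝ) : ℝ :=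
  1 + (tauStar t * diamK K) ^ (1 / 2 : ℝ)

/-- The mesh-independent bounds `(d_{hτ}^K)² h_K ≤ C_*` and `c_{hτ}^K ≤ C_*`. -/
def PenaltyBound (T : Mesh Ω) (τ : Penalty T) (Cstar : ℝ) : Prop :=
  ∀ j, dConst (T.elem j) (τ.val j) ^ 2 * diamK (T.elem j) ≤ Cstar ∧
    cConst (T.elem j) (τ.val j) ≤ Cstar

/-! ### Discrete spaces -/

/-- `W_h`: piecewise polynomials of degree at most `k` (one polynomial for each element). -/
abbrev Wh (T : Mesh Ω) (k : ℕ) := Fin T.N → Poly n k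

/-- `V_h`: piecewise polynomial vector fields of degree at most `k`. -/
abbrev Vh (T : Mesh Ω) (k : ℕ) := Fin T.N → Fin n → Poly n k

/-- `M_h`: a function for each mesh face `F` (extended by zero off `F`), which on `F` is a polynomial
of degree at most `k`, and is zero if `F` lies on the boundary of `Ω`. -/
def Mh (T : Mesh Ω) (k : ℕ) : Submodule ℝ (T.Face → E n → ℝ) where
  carrier := {μ | ∀ F : T.Face, (∃ p : Poly n k, μ F = F.1.indicator (val p.1)) ∧
    (F.1 ⊆ frontier Ω → μ F = 0)}
  zero_mem' := fun F => ⟨⟨0, by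
    ext x
    by_cases hx : x ∈ F.1 <;> simp [hx, val]⟩, fun _ => rfl⟩
  add_mem' := by
    intro μ ν hμ hν F
    obtain ⟨⟨p, hp⟩, hp0⟩ := hμ F
    obtain ⟨⟨q, hq⟩, hq0⟩ := hν F
    refine ⟨⟨p + q, ?_⟩, fun hF => ?_⟩
    · ext x
      by_cases hx : x ∈ F.1 <;> simp [hp, hq, hx, val]
    · simp [hp0 hF, hq0 hF]
  smul_mem' := by
    intro a μ hμ F
    obtain ⟨⟨p, hp⟩, hp0⟩ := hμ F
    refine ⟨⟨a • p, ?_⟩, fun hF => ?_⟩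
    · ext x
      by_cases hx : x ∈ F.1 <;> simp [hp, hx, val]
    · simp [hp0 hF]

/-- The values of `μ ∈ M_h` on the faces of the `j`-th element. -/
def tr {T : Mesh Ω} {k : ℕ} (μ : Mh T k) (j : Fin T.N) (i : Fin (n + 1)) : E n → ℝ :=
  μ.1 (T.faceOf j i)

/-! ### Local solution operators -/

section Operators

variable [NeZero n]

/-- `(c q, r)_K` with `c = α⁻¹`. -/
def cForm {k : ℕ} (α : E n → Matrix (Fin n) (Fin n) ℝ) (K : Affine.Simplex ℝ (E n) n)
    (q r : Fin n → Poly n k) : ℝ :=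
  intK K fun x => ((α x)⁻¹ *ᵥ vecVal q x) ⬝ᵥ vecVal r x

/-- `(q, u) ∈ P_k(K)ⁿ × P_k(K)` solves the local problem on `K` with penalty values `t`, boundary
data `g` (one function for each face) and source `f`:
`(c q, r)_K - (u, div r)_K = -⟨g, r·n⟩_∂K` for all `r ∈ P_k(K)ⁿ` and
`(w, div q)_K + ⟨t (u - g), w⟩_∂K = (f, w)_K` for all `w ∈ P_k(K)`. -/
def IsLocalSolution {k : ℕ} (α : E n → Matrix (Fin n) (Fin n) ℝ) (K : Affine.Simplex ℝ (E n) n)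
    (t : Fin (n + 1) → ℝ) (g : Fin (n + 1) → E n → ℝ) (f : E n → ℝ)
    (s : (Fin n → Poly n k) × Poly n k) : Prop :=
  (∀ r : Fin n → Poly n k,
    cForm α K s.1 r - intK K (fun x => val s.2.1 x * divVal r x) =
      -∑ i, intF K i (fun x => g i x * (vecVal r x ⬝ᵥ normal K i))) ∧
  (∀ w : Poly n k,
    intK K (fun x => val w.1 x * divVal s.1 x) +
      ∑ i, intF K i (fun x => t i * (val s.2.1 x - g i x) * val w.1 x) =
      intK K (fun x => f x * val w.1 x))

open Classical in
/-- The solution of the local problem (which is uniquely solvable for the data used below). -/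
def localSolution (k : ℕ) (α : E n → Matrix (Fin n) (Fin n) ℝ) (K : Affine.Simplex ℝ (E n) n)
    (t : Fin (n + 1) → ℝ) (g : Fin (n + 1) → E n → ℝ) (f : E n → ℝ) :
    (Fin n → Poly n k) × Poly n k :=
  if hex : ∃ s : (Fin n → Poly n k) × Poly n k, IsLocalSolution α K t g f s then hex.choose else 0

/-- The local solution operator `𝒬 : M_h → V_h`. -/
def opQ (T : Mesh Ω) (τ : Penalty T) (α : E n → Matrix (Fin n) (Fin n) ℝ) {k : ℕ} (μ : Mh T k) :
    Vh T k :=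
  fun j => (localSolution k α (T.elem j) (τ.val j) (tr μ j) 0).1

/-- The local solution operator `𝒰 : M_h → W_h`. -/
def opU (T : Mesh Ω) (τ : Penalty T) (α : E n → Matrix (Fin n) (Fin n) ℝ) {k : ℕ} (μ : Mh T k) :
    Wh T k :=
  fun j => (localSolution k α (T.elem j) (τ.val j) (tr μ j) 0).2

/-- The local solution operator `𝒰^W : L² → W_h`. -/
def opUW (T : Mesh Ω) (τ : Penalty T) (α : E n → Matrix (Fin n) (Fin n) ℝ) (k : ℕ) (f : E n → ℝ) :
    Wh T k :=
  fun j => (localSolution k α (T.elem j) (τ.val j) 0 f).2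

/-- The `L²(K)` norm. -/
def normK (K : Affine.Simplex ℝ (E n) n) (g : E n → ℝ) : ℝ := Real.sqrt (intK K fun x => g x ^ 2)

/-- `C₀` is a valid constant in the local bound
`‖𝒰^W f‖_{L²(K)} ≤ C₀ (d_{hτ}^K)² h_K² ‖f‖_{L²(K)}` for all `f ∈ L²(K)`, uniformly in the elements
`K` of all shape regular meshes of `Ω` (with constant `γ`) and in all penalty functions satisfying
the mesh-independent bounds with constant `C_*`. -/
def IsLocalConstant (Ω : Set (E n)) (α : E n → Matrix (Fin n) (Fin n) ℝ) (k : ℕ)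
    (γ Cstar C₀ : ℝ) : Prop :=
  ∀ (T : Mesh Ω) (τ : Penalty T), T.ShapeRegular γ → PenaltyBound T τ Cstar →
    ∀ (j : Fin T.N) (f : E n → ℝ), MemLp f 2 (volume.restrict (cell (T.elem j))) →
      normK (T.elem j) (val (opUW T τ α k f j).1) ≤
        C₀ * dConst (T.elem j) (τ.val j) ^ 2 * diamK (T.elem j) ^ 2 * normK (T.elem j) f

/-! ### The two eigenproblems -/

/-- The branch from the `j`-th element, on its `i`-th face, of the numerical flux
`q̂ = q + τ (u - η) n`. -/
def qhat {T : Mesh Ω} (τ : Penalty T) {k : ℕ} (q : Vh T k) (u : Wh T k) (η : Mh T k)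
    (j : Fin T.N) (i : Fin (n + 1)) (x : E n) : Fin n → ℝ :=
  vecVal (q j) x + (τ.val j i * (val (u j).1 x - tr η j i x)) • normal (T.elem j) i

/-- `lam` is an eigenvalue of the HDG eigenproblem: there is a nontrivial
`(q, u, η) ∈ V_h × W_h × M_h` with
`(c q, r) - (u, div r) + ⟨η, r·n⟩ = 0` for all `r ∈ V_h`,
`-(q, grad w) + ⟨q̂·n, w⟩ = lam (u, w)` for all `w ∈ W_h` and
`⟨μ, q̂·n⟩ = 0` for all `μ ∈ M_h`. -/
def IsHDGEigenvalue (T : Mesh Ω) (τ : Penalty T) (α : E n → Matrix (Fin n) (Fin n) ℝ) (k : ℕ)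
    (lam : ℝ) : Prop :=
  ∃ (q : Vh T k) (u : Wh T k) (η : Mh T k), ¬ (q = 0 ∧ u = 0 ∧ η = 0) ∧
    (∀ r : Vh T k,
      ∑ j, cForm α (T.elem j) (q j) (r j)
        - ∑ j, intK (T.elem j) (fun x => val (u j).1 x * divVal (r j) x)
        + ∑ j, ∑ i, intF (T.elem j) i
            (fun x => tr η j i x * (vecVal (r j) x ⬝ᵥ normal (T.elem j) i)) = 0) ∧
    (∀ w : Wh T k,
      -∑ j, intK (T.elem j) (fun x => vecVal (q j) x ⬝ᵥ gradVal (w j).1 x)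
        + ∑ j, ∑ i, intF (T.elem j) i
            (fun x => (qhat τ q u η j i x ⬝ᵥ normal (T.elem j) i) * val (w j).1 x)
        = lam * ∑ j, intK (T.elem j) (fun x => val (u j).1 x * val (w j).1 x)) ∧
    (∀ μ : Mh T k,
      ∑ j, ∑ i, intF (T.elem j) i
        (fun x => tr μ j i x * (qhat τ q u η j i x ⬝ᵥ normal (T.elem j) i)) = 0)

/-- `a_h(η, μ) = (c 𝒬η, 𝒬μ) + ⟨τ (𝒰η - η), 𝒰μ - μ⟩`. -/
def ah (T : Mesh Ω) (τ : Penalty T) (α : E n → Matrix (Fin n) (Fin n) ℝ) {k : ℕ} (η μ : Mh T k) :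
    ℝ :=
  ∑ j, cForm α (T.elem j) (opQ T τ α η j) (opQ T τ α μ j)
    + ∑ j, ∑ i, intF (T.elem j) i (fun x => τ.val j i *
        (val (opU T τ α η j).1 x - tr η j i x) * (val (opU T τ α μ j).1 x - tr μ j i x))

/-- `lamt > 0` is an eigenvalue of the linear condensed eigenproblem: there is a nontrivial
`η ∈ M_h` with `a_h(η, μ) = lamt (𝒰η, 𝒰μ)` for all `μ ∈ M_h`. -/
def IsCondensedEigenvalue (T : Mesh Ω) (τ : Penalty T) (α : E n → Matrix (Fin n) (Fin n) ℝ) (k : ℕ)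
    (lamt : ℝ) : Prop :=
  0 < lamt ∧ ∃ η : Mh T k, η ≠ 0 ∧ ∀ μ : Mh T k,
    ah T τ α η μ =
      lamt * ∑ j, intK (T.elem j) (fun x => val (opU T τ α η j).1 x * val (opU T τ α μ j).1 x)

end Operators

end HDG

end

/-! Let `(q, u, η)` be an HDG eigentriple. Tested element by element, its first two equations say
that `(q, u)` solves the local problems with trace `η` and source `λ u`. Hence `u - 𝒰η = 𝒰^W(λ u)`,
and the local bound gives `‖u - 𝒰η‖ ≤ C₀ C_* h λ ‖u‖`. Reciprocity of local solutions together with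
the transmission condition gives `a_h(η, μ) = λ (u, 𝒰μ)` (`ah_eq_of_eigenpair`). So `η` is an
approximate eigenvector of the condensed problem, with residual `λ (u - 𝒰η, 𝒰μ)`.

Put `κ = 1 - C₀ C_* C₃ > 0`. Since `λ h < C₃`, the distance bound yields `κ ‖u‖ ≤ ‖𝒰η‖`. With a
discrete Poincaré inequality `‖𝒰μ‖² ≤ C_P a_h(μ, μ)` the residual is at most `C λ² h` in the norm
dual to that of `a_h`, where `C = C₀ C_* C_P / κ`. The spectral theorem in the inner product `a_h`
(`exists_generalized_eigenvector`) provides an eigenvalue `t` of the mass form relative to `a_h`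
with `|1 - λ t| ≤ C λ² h`. For small `h` the right side is at most `1/2`, so `t > 0`, and `1/t` is
the condensed eigenvalue: `|λ - 1/t| / λ = |1 - λ t| (1/t) / λ`. The exact eigenproblem plays no
role.

Two estimates, uniform in the mesh and in `τ`, carry the argument. The local one is
`exists_energy_bound`: edge derivatives of `u` and all jumps `u - μ` are bounded by the local
energy, although `τ` may vanish on all faces of an element but one. The jump on the face of maximal
penalty is read off the energy, and test fields along the edges from the opposite vertex transfer
control to the other faces. It also yields the local constant (`exists_source_bound`). The global
one is `exists_poincare`, proved by a Rellich identity with the field `x - x₀` and therefore without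
a dual problem or elliptic regularity: the boundary terms containing `μ²` cancel between neighbours,
and all other terms are bounded by the energy or absorbed. -/

noncomputable section

namespace HDG

section

variable {n : ℕ}

/-! ### Barycentric coordinates, cells and faces. -/

section Barycentric

/-- The vertices of an `n`-simplex in `n`-space as an affine basis. -/
def toBasis (K : Affine.Simplex ℝ (E n) n) : AffineBasis (Fin (n + 1)) ℝ (E n) :=
  ⟨K.points, K.independent, by
    rw [K.independent.affineSpan_eq_top_iff_card_eq_finrank_add_one]; simp⟩

/-- The barycentric coordinates of a simplex. -/
abbrev bary (K : Affine.Simplex ℝ (E n) n) (i : Fin (n + 1)) : E n →ᵃ[ℝ] ℝ := (toBasis K).coord i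

lemma bary_self (K : Affine.Simplex ℝ (E n) n) (i : Fin (n + 1)) : bary K i (K.points i) = 1 :=
  (toBasis K).coord_apply_eq i

lemma bary_ne (K : Affine.Simplex ℝ (E n) n) {i j : Fin (n + 1)} (h : i ≠ j) :
    bary K i (K.points j) = 0 := (toBasis K).coord_apply_ne h

lemma bary_points (K : Affine.Simplex ℝ (E n) n) (i j : Fin (n + 1)) :
    bary K i (K.points j) = if i = j then 1 else 0 := (toBasis K).coord_apply i j

lemma sum_bary (K : Affine.Simplex ℝ (E n) n) (x : E n) : ∑ i, bary K i x = 1 :=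
  (toBasis K).sum_coord_apply_eq_one x

lemma sum_bary_smul (K : Affine.Simplex ℝ (E n) n) (x : E n) :
    ∑ i, bary K i x • K.points i = x := (toBasis K).linear_combination_coord_eq_self x

lemma continuous_bary (K : Affine.Simplex ℝ (E n) n) (i : Fin (n + 1)) : Continuous (bary K i) :=
  (bary K i).continuous_of_finiteDimensional

lemma bary_add (K : Affine.Simplex ℝ (E n) n) (i : Fin (n + 1)) (x v : E n) :
    bary K i (x + v) = bary K i x + (bary K i).linear v := by
  have := (bary K i).map_vadd x v
  rw [vadd_eq_add, vadd_eq_add] at this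
  rw [add_comm x, this, add_comm]

lemma bary_linear_sub (K : Affine.Simplex ℝ (E n) n) (i : Fin (n + 1)) (x y : E n) :
    (bary K i).linear (x - y) = bary K i x - bary K i y := by
  simpa using (bary K i).linearMap_vsub x y

lemma sum_bary_linear (K : Affine.Simplex ℝ (E n) n) (v : E n) :
    ∑ i, (bary K i).linear v = 0 := by
  have h := sum_bary K (0 + v)
  simp only [bary_add, Finset.sum_add_distrib, sum_bary] at h
  linarith

lemma sum_bary_linear_smul (K : Affine.Simplex ℝ (E n) n) (v : E n) :
    ∑ i, (bary K i).linear v • K.points i = v := by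
  have h := sum_bary_smul K (0 + v)
  simp only [bary_add, add_smul, Finset.sum_add_distrib, sum_bary_smul] at h
  simpa using h

/-- Expansion of a vector along the edges at the vertex `i`. -/
lemma sum_bary_linear_smul_sub (K : Affine.Simplex ℝ (E n) n) (v p : E n) :
    ∑ i, (bary K i).linear v • (K.points i - p) = v := by
  simp only [smul_sub, Finset.sum_sub_distrib, sum_bary_linear_smul, ← Finset.sum_smul,
    sum_bary_linear, zero_smul, sub_zero]

lemma sum_bary_smul_sub (K : Affine.Simplex ℝ (E n) n) (x p : E n) :
    ∑ i, bary K i x • (K.points i - p) = x - p := by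
  simp only [smul_sub, Finset.sum_sub_distrib, sum_bary_smul, ← Finset.sum_smul,
    sum_bary, one_smul]

lemma cell_eq (K : Affine.Simplex ℝ (E n) n) : cell K = {x | ∀ i, 0 ≤ bary K i x} :=
  (toBasis K).convexHull_eq_nonneg_coord

lemma interior_cell (K : Affine.Simplex ℝ (E n) n) :
    interior (cell K) = {x | ∀ i, 0 < bary K i x} := (toBasis K).interior_convexHull

lemma convex_cell (K : Affine.Simplex ℝ (E n) n) : Convex ℝ (cell K) := convex_convexHull ℝ _

lemma isCompact_cell (K : Affine.Simplex ℝ (E n) n) : IsCompact (cell K) :=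
  (Set.finite_range _).isCompact_convexHull ℝ

lemma points_mem_cell (K : Affine.Simplex ℝ (E n) n) (i : Fin (n + 1)) : K.points i ∈ cell K :=
  subset_convexHull ℝ _ ⟨i, rfl⟩

lemma bary_nonneg {K : Affine.Simplex ℝ (E n) n} {x : E n} (hx : x ∈ cell K) (i : Fin (n + 1)) :
    0 ≤ bary K i x := by
  rw [cell_eq] at hx; exact hx i

lemma bary_le_one {K : Affine.Simplex ℝ (E n) n} {x : E n} (hx : x ∈ cell K) (i : Fin (n + 1)) :
    bary K i x ≤ 1 := by
  rw [← sum_bary K x]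
  exact Finset.single_le_sum (fun j _ => bary_nonneg hx j) (Finset.mem_univ i)

lemma face_subset_cell (K : Affine.Simplex ℝ (E n) n) (i : Fin (n + 1)) : face K i ⊆ cell K :=
  convexHull_mono (Set.image_subset_range _ _)

lemma bary_zero_of_mem_convexHull {K : Affine.Simplex ℝ (E n) n} {S : Set (E n)} {i : Fin (n + 1)}
    (hS : ∀ y ∈ S, bary K i y = 0) {x : E n} (hx : x ∈ convexHull ℝ S) : bary K i x = 0 := by
  have : convexHull ℝ S ⊆ (bary K i) ⁻¹' {0} :=
    convexHull_min (fun y hy => hS y hy) ((convex_singleton (0 : ℝ)).affine_preimage _)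
  exact this hx

lemma face_eq (K : Affine.Simplex ℝ (E n) n) (i : Fin (n + 1)) :
    face K i = {x | x ∈ cell K ∧ bary K i x = 0} := by
  apply Set.Subset.antisymm
  · intro x hx
    refine ⟨face_subset_cell K i hx, bary_zero_of_mem_convexHull ?_ hx⟩
    rintro _ ⟨j, hj, rfl⟩
    exact bary_ne K (Ne.symm hj)
  · rintro x ⟨hx, hi⟩
    rw [← sum_bary_smul K x, ← Finset.sum_erase_add _ _ (Finset.mem_univ i), hi, zero_smul, add_zero]
    refine (convex_convexHull ℝ _).sum_mem (fun j _ => bary_nonneg hx j) ?_ ?_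
    · have := sum_bary K x
      rwa [← Finset.sum_erase_add _ _ (Finset.mem_univ i), hi, add_zero] at this
    · intro j hj
      exact subset_convexHull ℝ _ ⟨j, by simpa using Finset.ne_of_mem_erase hj, rfl⟩

lemma isCompact_face (K : Affine.Simplex ℝ (E n) n) (i : Fin (n + 1)) : IsCompact (face K i) :=
  ((Set.toFinite _).image _).isCompact_convexHull ℝ

lemma points_mem_face (K : Affine.Simplex ℝ (E n) n) {i j : Fin (n + 1)} (h : j ≠ i) :
    K.points j ∈ face K i := subset_convexHull ℝ _ ⟨j, h, rfl⟩

lemma centroid_mem_interior (K : Affine.Simplex ℝ (E n) n) : (interior (cell K)).Nonempty :=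
  ⟨_, (toBasis K).centroid_mem_interior_convexHull⟩

end Barycentric

/-! ### Normals, heights and diameters. -/

section Normal

variable [NeZero n] (K : Affine.Simplex ℝ (E n) n) (i : Fin (n + 1))

omit [NeZero n] in
lemma vec_ext_edges {f g : E n →ₗ[ℝ] ℝ}
    (h : ∀ j, j ≠ i → f (K.points j - K.points i) = g (K.points j - K.points i)) : f = g := by
  ext1 v
  rw [← sum_bary_linear_smul_sub K v (K.points i), map_sum, map_sum]
  refine Finset.sum_congr rfl fun j _ => ?_
  rw [map_smul, map_smul]
  by_cases hj : j = i
  · simp [hj]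
  · rw [h j hj]

/-- The `i`-th barycentric coordinate falls from one to zero along the altitude, so its gradient is
minus the normal over the height. It suffices to compare on edges at the vertex `i`, whose inner
product with the altitude is the squared height. This turns every normal component into barycentric
data. -/
lemma dot_normal (v : E n) :
    (fun a => v a) ⬝ᵥ normal K i = - K.height i * (bary K i).linear v := by
  have key : (innerₗ (E n) ((K.height i)⁻¹ • (K.altitudeFoot i - K.points i))) =
      (- K.height i) • (bary K i).linear := by
    apply vec_ext_edges K i
    intro j hj
    have h1 := K.inner_vsub_vsub_altitudeFoot_eq_height_sq (Ne.symm hj)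
    rw [LinearMap.smul_apply, bary_linear_sub, bary_self, bary_ne K (Ne.symm hj)]
    rw [innerₗ_apply_apply, inner_smul_left, real_inner_comm]
    rw [← neg_sub (K.points i) (K.points j), ← neg_sub (K.points i) (K.altitudeFoot i),
      inner_neg_neg]
    rw [vsub_eq_sub, vsub_eq_sub] at h1
    rw [h1]
    have := K.height_pos i
    simp; field_simp
  have := congrArg (fun f => f v) key
  simp only [LinearMap.smul_apply, innerₗ_apply_apply, smul_eq_mul] at this
  rw [← this, real_inner_comm]
  simp [dotProduct, normal, PiLp.inner_apply, mul_comm]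

lemma normal_eq (a : Fin n) :
    normal K i a = - K.height i * (bary K i).linear (EuclideanSpace.single a 1) := by
  rw [← dot_normal]
  simp [dotProduct]

/-- The unit normal as an element of Euclidean space. -/
def nu : E n := WithLp.toLp 2 (normal K i)

lemma nu_eq : nu K i = (K.height i)⁻¹ • (K.altitudeFoot i - K.points i) := by
  ext a; simp [nu, normal]

lemma norm_nu : ‖nu K i‖ = 1 := by
  rw [nu_eq, norm_smul, norm_inv, Real.norm_of_nonneg (K.height_pos i).le, ← dist_eq_norm, dist_comm]
  exact inv_mul_cancel₀ (K.height_pos i).ne'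

lemma inner_nu (v : E n) : inner ℝ (nu K i) v = - K.height i * (bary K i).linear v := by
  rw [← dot_normal]
  simp [nu, dotProduct, PiLp.inner_apply, mul_comm]

lemma normal_dot_self : normal K i ⬝ᵥ normal K i = 1 := by
  have h1 := inner_nu K i (nu K i)
  rw [real_inner_self_eq_norm_sq, norm_nu, ← dot_normal] at h1
  rw [show normal K i ⬝ᵥ normal K i = (fun a => (nu K i) a) ⬝ᵥ normal K i from rfl, ← h1]; norm_num

lemma bary_linear_nu : (bary K i).linear (nu K i) = - (K.height i)⁻¹ := by
  have h1 := inner_nu K i (nu K i)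
  rw [real_inner_self_eq_norm_sq, norm_nu] at h1
  have := K.height_pos i
  field_simp
  linarith

lemma abs_dot_normal_le (v : E n) : |(fun a => v a) ⬝ᵥ normal K i| ≤ ‖v‖ := by
  rw [dot_normal, ← inner_nu]
  simpa [norm_nu] using abs_real_inner_le_norm (nu K i) v

omit [NeZero n] in
lemma norm_sub_le_diamK {x y : E n} (hx : x ∈ cell K) (hy : y ∈ cell K) : ‖x - y‖ ≤ diamK K := by
  rw [← dist_eq_norm]
  exact Metric.dist_le_diam_of_mem (isCompact_cell K).isBounded hx hy

lemma height_le_diamK : K.height i ≤ diamK K := by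
  obtain ⟨j, hj⟩ : ∃ j, j ≠ i := by
    have : Nontrivial (Fin (n + 1)) := Fin.nontrivial_iff_two_le.2
      (by have := NeZero.pos n; omega)
    exact exists_ne i
  have h := abs_dot_normal_le K i (K.points j - K.points i)
  rw [dot_normal, bary_linear_sub, bary_self, bary_ne K (Ne.symm hj)] at h
  simp only [zero_sub, mul_neg, mul_one, neg_neg, abs_of_pos (K.height_pos i)] at h
  exact h.trans (norm_sub_le_diamK K (points_mem_cell K j) (points_mem_cell K i))

lemma diamK_pos : 0 < diamK K := (K.height_pos 0).trans_le (height_le_diamK K 0)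

/-- A step of length `ρ` along the outward normal lowers the `i`-th coordinate by `ρ` over the
height, and this coordinate stays in `[0, 1]` on the cell. Shape regularity enters the proof only
through the resulting bound of the diameter by the heights. -/
lemma le_height {x : E n} {ρ : ℝ} (hρ : 0 < ρ) (h : Metric.closedBall x ρ ⊆ cell K) :
    ρ ≤ K.height i := by
  have h1 : x + ρ • nu K i ∈ cell K := h (by simp [norm_smul, norm_nu, abs_of_pos hρ])
  have h2 : x ∈ cell K := h (Metric.mem_closedBall_self hρ.le)
  have h3 := bary_nonneg h1 i
  rw [bary_add, map_smul, bary_linear_nu] at h3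
  have h4 := bary_le_one h2 i
  have := K.height_pos i
  have h5 : ρ * (K.height i)⁻¹ ≤ 1 := by simp at h3; linarith
  rwa [← div_eq_mul_inv, div_le_one this] at h5

end Normal

end

section

variable {n : ℕ}

/-! ### A simplex as a cone over one of its faces. -/

section Cone

variable [NeZero n] (K : Affine.Simplex ℝ (E n) n) (i : Fin (n + 1))

/-- The hyperplane of directions of a face. -/
abbrev faceDir : Submodule ℝ (E n) := (Submodule.span ℝ {nu K i})ᗮ

/-- Cartesian coordinates adapted to a face: distance to the opposite vertex in normal direction and
tangential component. -/
def faceCoords : (ℝ × faceDir K i) ≃ᵐ E n :=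
  (MeasurableEquiv.prodCongr
    (LinearIsometryEquiv.toSpanUnitSingleton (𝕜 := ℝ)
      (nu K i) (norm_nu K i)).toHomeomorph.toMeasurableEquiv
    (MeasurableEquiv.refl _)).trans
  ((Submodule.span ℝ {nu K i}).measurableEquivProd (K.points i)).symm

lemma faceCoords_apply (s : ℝ) (z : faceDir K i) :
    faceCoords K i (s, z) = s • nu K i + z + K.points i := by
  simp only [faceCoords, MeasurableEquiv.trans_apply, Submodule.measurableEquivProd_symm_apply,
    vadd_eq_add]
  rfl

lemma measurePreserving_faceCoords :
    MeasurePreserving (faceCoords K i) (volume.prod volume) volume := by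
  have h1 := ((Submodule.span ℝ {nu K i}).measurePreserving_measurableEquivProd (K.points i)).symm
  rw [InnerProductSpace.euclideanHausdorffMeasure_eq_volume] at h1
  refine MeasurePreserving.trans ?_ h1
  exact (LinearIsometryEquiv.toSpanUnitSingleton (𝕜 := ℝ)
      (nu K i) (norm_nu K i)).measurePreserving.prod (MeasurePreserving.id _)

/-- The isometric parametrization of the hyperplane of a face. -/
def facePlane (z : faceDir K i) : E n := K.height i • nu K i + z + K.points i

lemma isometry_facePlane : Isometry (facePlane K i) := by
  refine Isometry.of_dist_eq fun x y => ?_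
  have h : facePlane K i x - facePlane K i y = ((x - y : faceDir K i) : E n) := by
    simp [facePlane]
  rw [dist_eq_norm, dist_eq_norm, h, Submodule.coe_norm]

lemma finrank_faceDir : Module.finrank ℝ (faceDir K i) = n - 1 := by
  have h0 : nu K i ≠ 0 := fun h => by simpa [h] using norm_nu K i
  have h : 1 + Module.finrank ℝ (faceDir K i) = n := by
    rw [← finrank_span_singleton (K := ℝ) h0, Submodule.finrank_add_finrank_orthogonal,
      finrank_euclideanSpace, Fintype.card_fin]
  omega

lemma bary_linear_faceDir (z : faceDir K i) : (bary K i).linear z = 0 := by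
  have h : inner ℝ (nu K i) (z : E n) = 0 :=
    (Submodule.mem_orthogonal _ _).1 z.2 _ (Submodule.mem_span_singleton_self _)
  rw [inner_nu] at h
  simpa [(K.height_pos i).ne'] using h

lemma bary_facePlane (z : faceDir K i) : bary K i (facePlane K i z) = 0 := by
  rw [facePlane, add_comm, bary_add, map_add, bary_linear_faceDir, map_smul, bary_linear_nu,
    bary_self]
  have := (K.height_pos i).ne'
  simp [this]

lemma face_subset_range : face K i ⊆ Set.range (facePlane K i) := by
  intro y hy
  rw [face_eq] at hy
  refine ⟨⟨y - K.points i - K.height i • nu K i, ?_⟩, by simp [facePlane]⟩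
  rw [Submodule.mem_orthogonal]
  intro u hu
  obtain ⟨a, rfl⟩ := Submodule.mem_span_singleton.1 hu
  rw [inner_smul_left, inner_nu, map_sub, map_smul, bary_linear_nu, bary_linear_sub, bary_self, hy.2]
  have := (K.height_pos i).ne'
  simp [this]

/-- The hyperplane of the face is parametrized isometrically, so the normalized Hausdorff measure
becomes Lebesgue measure on `faceDir K i`, where Fubini and scaling are available. -/
lemma intF_eq (g : E n → ℝ) :
    intF K i g = ∫ z in facePlane K i ⁻¹' face K i, g (facePlane K i z) := by
  have hm : MeasurableEmbedding (facePlane K i) :=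
    (isometry_facePlane K i).isClosedEmbedding.measurableEmbedding
  rw [← hm.setIntegral_map, ← InnerProductSpace.euclideanHausdorffMeasure_eq_volume,
    (isometry_facePlane K i).map_euclideanHausdorffMeasure, finrank_faceDir,
    Measure.restrict_restrict_of_subset (face_subset_range K i)]
  rfl

lemma isCompact_preimage_face : IsCompact (facePlane K i ⁻¹' face K i) :=
  (isometry_facePlane K i).isClosedEmbedding.isCompact_preimage (isCompact_face K i)

lemma integrableOn_face {g : E n → ℝ} (hg : Continuous g) :
    IntegrableOn g (face K i) (Measure.euclideanHausdorffMeasure (n - 1)) := by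
  have hm : MeasurableEmbedding (facePlane K i) :=
    (isometry_facePlane K i).isClosedEmbedding.measurableEmbedding
  have h : IntegrableOn g (face K i) (volume.map (facePlane K i)) := by
    rw [hm.integrableOn_map_iff]
    exact (hg.comp (isometry_facePlane K i).continuous).continuousOn.integrableOn_compact
      (isCompact_preimage_face K i)
  rwa [← InnerProductSpace.euclideanHausdorffMeasure_eq_volume,
    (isometry_facePlane K i).map_euclideanHausdorffMeasure, finrank_faceDir, IntegrableOn,
    Measure.restrict_restrict_of_subset (face_subset_range K i)] at h

lemma faceCoords_smul {s : ℝ} (z : faceDir K i) :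
    faceCoords K i (s, (s / K.height i) • z) =
      K.points i + (s / K.height i) • (facePlane K i z - K.points i) := by
  have := (K.height_pos i).ne'
  rw [faceCoords_apply, facePlane]
  simp [smul_smul, this]
  abel

/-- The slice at normal distance `s` from the vertex is the face shrunk by `s / height`: a homothety
centred at that vertex multiplies all other barycentric coordinates by the same factor. -/
lemma faceCoords_mem_cell_iff {s : ℝ} (hs : 0 < s) (z : faceDir K i) :
    faceCoords K i (s, (s / K.height i) • z) ∈ cell K ↔ s ≤ K.height i ∧ facePlane K i z ∈ face K i := by
  have hh := K.height_pos i
  have ht : 0 < s / K.height i := div_pos hs hh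
  have key : ∀ j, bary K j (faceCoords K i (s, (s / K.height i) • z)) =
      (if j = i then 1 - s / K.height i else 0) + s / K.height i * bary K j (facePlane K i z) := by
    intro j
    rw [faceCoords_smul, bary_add, map_smul, bary_linear_sub, bary_points, smul_eq_mul]
    split_ifs <;> ring
  rw [face_eq, cell_eq]
  simp only [Set.mem_ofPred_eq, key, bary_facePlane, and_true]
  constructor
  · intro h
    have hi := h i
    simp only [if_true, bary_facePlane, mul_zero, add_zero, sub_nonneg, div_le_one hh] at hi
    refine ⟨hi, fun j => ?_⟩
    by_cases hj : j = i
    · rw [hj, bary_facePlane]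
    · have := h j
      rw [if_neg hj, zero_add] at this
      exact nonneg_of_mul_nonneg_right this ht
  · rintro ⟨h1, h2⟩ j
    have h3 := mul_nonneg ht.le (h2 j)
    have h4 : s / K.height i ≤ 1 := (div_le_one hh).2 h1
    split_ifs <;> linarith

/-- Fubini over slices parallel to the face. Each slice is rescaled to the face, with the Jacobian
of a homothety in dimension `n - 1`. -/
lemma intK_eq_cone {g : E n → ℝ} (hg : Continuous g) :
    intK K g = ∫ s in Set.Ioc 0 (K.height i), ∫ z in facePlane K i ⁻¹' face K i,
      (s / K.height i) ^ (n - 1) *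
        g (K.points i + (s / K.height i) • (facePlane K i z - K.points i)) := by
  have hh := K.height_pos i
  have hmp := measurePreserving_faceCoords K i
  have hcell : MeasurableSet (cell K) := (isCompact_cell K).isClosed.measurableSet
  have h1 : intK K g = ∫ p, (faceCoords K i ⁻¹' cell K).indicator (fun p => g (faceCoords K i p)) p
      ∂(volume.prod volume) := by
    rw [integral_indicator ((faceCoords K i).measurable hcell),
      hmp.setIntegral_preimage_emb (faceCoords K i).measurableEmbedding]
    rfl
  rw [h1, integral_prod]
  · rw [← integral_indicator measurableSet_Ioc]
    have h0 : ∀ᵐ s : ℝ, s ≠ 0 := by simp [ae_iff]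
    refine integral_congr_ae (h0.mono fun s hs => ?_)
    simp only
    rcases lt_or_gt_of_ne hs with hs | hs
    · rw [Set.indicator_of_notMem (fun h => absurd h.1 (not_lt.2 hs.le))]
      refine integral_eq_zero_of_ae (Filter.Eventually.of_forall fun z => ?_)
      refine Set.indicator_of_notMem (fun h => ?_) _
      have h2 := bary_le_one h i
      rw [faceCoords_apply, add_comm, bary_add, map_add, bary_linear_faceDir, map_smul,
        bary_linear_nu, bary_self, smul_eq_mul] at h2
      have : s * (K.height i)⁻¹ < 0 := mul_neg_of_neg_of_pos hs (inv_pos.2 hh)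
      linarith
    · have ht : 0 < s / K.height i := div_pos hs hh
      have h3 := Measure.integral_comp_smul (volume : Measure (faceDir K i))
        (fun z => (faceCoords K i ⁻¹' cell K).indicator (fun p => g (faceCoords K i p)) (s, z))
        (s / K.height i)
      rw [finrank_faceDir, abs_of_pos (inv_pos.2 (pow_pos ht _)), smul_eq_mul,
        eq_inv_mul_iff_mul_eq₀ (pow_pos ht _).ne'] at h3
      rw [← h3]
      by_cases hsh : s ≤ K.height i
      · rw [Set.indicator_of_mem (Set.mem_Ioc.2 ⟨hs, hsh⟩), integral_const_mul]
        congr 1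
        rw [← integral_indicator ((isCompact_preimage_face K i).isClosed.measurableSet)]
        congr 1
        ext z
        by_cases hz : facePlane K i z ∈ face K i
        · rw [Set.indicator_of_mem (s := facePlane K i ⁻¹' face K i) hz,
            Set.indicator_of_mem (s := faceCoords K i ⁻¹' cell K)
              ((faceCoords_mem_cell_iff K i hs z).2 ⟨hsh, hz⟩), faceCoords_smul]
        · rw [Set.indicator_of_notMem (s := facePlane K i ⁻¹' face K i) hz,
            Set.indicator_of_notMem (s := faceCoords K i ⁻¹' cell K)
              (fun h => hz ((faceCoords_mem_cell_iff K i hs z).1 h).2)]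
      · rw [Set.indicator_of_notMem (fun h => hsh h.2)]
        refine mul_eq_zero_of_right _ (integral_eq_zero_of_ae (Filter.Eventually.of_forall fun z => ?_))
        exact Set.indicator_of_notMem (fun h => hsh ((faceCoords_mem_cell_iff K i hs z).1 h).1) _
  · rw [integrable_indicator_iff ((faceCoords K i).measurable hcell)]
    exact (hmp.integrableOn_comp_preimage (faceCoords K i).measurableEmbedding).2
      (hg.continuousOn.integrableOn_compact (isCompact_cell K))

/-- The divergence theorem on a simplex for the radial fields `f(x) (x - P_i)`. -/
lemma intK_cone {f : E n → ℝ} (hf : ContDiff ℝ 1 f) :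
    intK K (fun x => n * f x + fderiv ℝ f x (x - K.points i)) = K.height i * intF K i f := by
  have hh := K.height_pos i
  have hf' : Continuous (fun x => fderiv ℝ f x) := hf.continuous_fderiv (by norm_num)
  have hcont : Continuous fun x => n * f x + fderiv ℝ f x (x - K.points i) :=
    (continuous_const.mul hf.continuous).add (hf'.clm_apply (by fun_prop))
  have hpl : Continuous (facePlane K i) := (isometry_facePlane K i).continuous
  rw [intK_eq_cone K i hcont, intF_eq, integral_integral_swap, ← integral_const_mul]
  · refine setIntegral_congr_fun ((isCompact_preimage_face K i).isClosed.measurableSet) fun z _ => ?_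
    set w := facePlane K i z - K.points i with hw
    have hz : facePlane K i z = K.points i + w := by simp [hw]
    rw [← intervalIntegral.integral_of_le hh.le]
    -- On the ray from the vertex to a face point the integrand, including the Jacobian, is the
    -- exact derivative of `t ^ n * f`. The integral over the ray is thus the value of `f` on the
    -- face; the end `t = 0` contributes nothing because `n ≠ 0`.
    have hd : ∀ t : ℝ, HasDerivAt (fun t : ℝ => t ^ n * f (K.points i + t • w))
        (t ^ (n - 1) * (n * f (K.points i + t • w) +
          fderiv ℝ f (K.points i + t • w) (K.points i + t • w - K.points i))) t := by
      intro t
      have h1 : HasDerivAt (fun t : ℝ => K.points i + t • w) w t := by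
        simpa using ((hasDerivAt_id t).smul_const w).const_add (K.points i)
      have h2 := ((hf.differentiable (by norm_num)) (K.points i + t • w)).hasFDerivAt.comp_hasDerivAt
        t h1
      have h3 := (hasDerivAt_pow n t).mul h2
      convert! h3 using 1
      have hn : t ^ n = t ^ (n - 1) * t := by
        rw [← pow_succ, Nat.sub_add_cancel (NeZero.pos n)]
      simp only [add_sub_cancel_left, map_smul, smul_eq_mul, hn, Function.comp]
      ring
    have h4 := intervalIntegral.integral_comp_div (a := 0) (b := K.height i)
      (fun t => t ^ (n - 1) * (n * f (K.points i + t • w) +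
          fderiv ℝ f (K.points i + t • w) (K.points i + t • w - K.points i))) hh.ne'
    rw [h4, zero_div, div_self hh.ne', intervalIntegral.integral_eq_sub_of_hasDerivAt
      (fun t _ => hd t)]
    · simp [hz, NeZero.ne n]
    · apply Continuous.intervalIntegrable
      have : Continuous fun t : ℝ => K.points i + t • w := by fun_prop
      exact (continuous_pow _).mul (hcont.comp this)
  · have hc : Continuous (Function.uncurry fun (s : ℝ) (z : faceDir K i) =>
        (s / K.height i) ^ (n - 1) * (n * f (K.points i + (s / K.height i) •
          (facePlane K i z - K.points i)) + fderiv ℝ f (K.points i + (s / K.height i) •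
          (facePlane K i z - K.points i)) (K.points i + (s / K.height i) •
          (facePlane K i z - K.points i) - K.points i))) := by
      have : Continuous fun p : ℝ × faceDir K i => K.points i + (p.1 / K.height i) •
          (facePlane K i p.2 - K.points i) := by fun_prop
      refine Continuous.mul (by fun_prop) (hcont.comp this)
    rw [Measure.prod_restrict]
    have h5 := hc.continuousOn.integrableOn_compact (μ := (volume : Measure ℝ).prod volume)
      ((isCompact_Icc (a := 0) (b := K.height i)).prod (isCompact_preimage_face K i))
    exact h5.mono_set (Set.prod_mono Set.Ioc_subset_Icc_self le_rfl)

end Cone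

end

section

variable {n : ℕ}

/-! ### Integrals over cells and faces. -/

section Integrals

variable (K : Affine.Simplex ℝ (E n) n) (i : Fin (n + 1))

lemma integrableOn_cell {g : E n → ℝ} (hg : Continuous g) : IntegrableOn g (cell K) :=
  hg.continuousOn.integrableOn_compact (isCompact_cell K)

lemma measurableSet_cell : MeasurableSet (cell K) := (isCompact_cell K).isClosed.measurableSet

lemma measurableSet_face : MeasurableSet (face K i) := (isCompact_face K i).isClosed.measurableSet

lemma intK_congr {f g : E n → ℝ} (h : ∀ x ∈ cell K, f x = g x) : intK K f = intK K g :=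
  setIntegral_congr_fun (measurableSet_cell K) h

lemma intK_add {f g : E n → ℝ} (hf : Continuous f) (hg : Continuous g) :
    intK K (fun x => f x + g x) = intK K f + intK K g :=
  integral_add (integrableOn_cell K hf) (integrableOn_cell K hg)

lemma intK_const_mul (a : ℝ) (f : E n → ℝ) : intK K (fun x => a * f x) = a * intK K f :=
  integral_const_mul a f

lemma intK_sum {ι : Type*} (s : Finset ι) {f : ι → E n → ℝ} (hf : ∀ j ∈ s, Continuous (f j)) :
    intK K (fun x => ∑ j ∈ s, f j x) = ∑ j ∈ s, intK K (f j) :=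
  integral_finsetSum s fun j hj => integrableOn_cell K (hf j hj)

lemma intK_mono {f g : E n → ℝ} (hf : Continuous f) (hg : Continuous g)
    (h : ∀ x ∈ cell K, f x ≤ g x) : intK K f ≤ intK K g :=
  setIntegral_mono_on (integrableOn_cell K hf) (integrableOn_cell K hg) (measurableSet_cell K) h

lemma intK_nonneg {f : E n → ℝ} (h : ∀ x ∈ cell K, 0 ≤ f x) : 0 ≤ intK K f :=
  setIntegral_nonneg (measurableSet_cell K) h

lemma intF_congr {f g : E n → ℝ} (h : ∀ x ∈ face K i, f x = g x) : intF K i f = intF K i g :=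
  setIntegral_congr_fun (measurableSet_face K i) h

lemma intF_const_mul (a : ℝ) (f : E n → ℝ) : intF K i (fun x => a * f x) = a * intF K i f :=
  integral_const_mul a f

lemma intF_nonneg {f : E n → ℝ} (h : ∀ x ∈ face K i, 0 ≤ f x) : 0 ≤ intF K i f :=
  setIntegral_nonneg (measurableSet_face K i) h

/-- A continuous nonnegative function with vanishing integral over a cell vanishes in its
interior. -/
lemma eq_zero_of_intK_eq_zero {f : E n → ℝ} (hf : Continuous f) (h0 : ∀ x ∈ cell K, 0 ≤ f x)
    (h : intK K f = 0) : ∀ x ∈ interior (cell K), f x = 0 := by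
  have h1 : f =ᵐ[volume.restrict (cell K)] 0 :=
    (setIntegral_eq_zero_iff_of_nonneg_ae ((ae_restrict_iff' (measurableSet_cell K)).2
      (Filter.Eventually.of_forall h0)) (integrableOn_cell K hf)).1 h
  have h2 : f =ᵐ[volume.restrict (interior (cell K))] fun _ => 0 :=
    ae_restrict_of_ae_restrict_of_subset interior_subset h1
  exact Measure.eqOn_open_of_ae_eq h2 isOpen_interior hf.continuousOn continuousOn_const

variable [NeZero n]

lemma intF_add {f g : E n → ℝ} (hf : Continuous f) (hg : Continuous g) :
    intF K i (fun x => f x + g x) = intF K i f + intF K i g :=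
  integral_add (integrableOn_face K i hf) (integrableOn_face K i hg)

lemma intF_sub {f g : E n → ℝ} (hf : Continuous f) (hg : Continuous g) :
    intF K i (fun x => f x - g x) = intF K i f - intF K i g :=
  integral_sub (integrableOn_face K i hf) (integrableOn_face K i hg)

lemma intF_sum {ι : Type*} (s : Finset ι) {f : ι → E n → ℝ} (hf : ∀ j ∈ s, Continuous (f j)) :
    intF K i (fun x => ∑ j ∈ s, f j x) = ∑ j ∈ s, intF K i (f j) :=
  integral_finsetSum s fun j hj => integrableOn_face K i (hf j hj)

/-- The barycenter of a face. -/
def faceCenter : E n := ∑ j, (if j = i then 0 else (n : ℝ)⁻¹) • K.points j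

omit [NeZero n] in
lemma bary_sum_smul (w : Fin (n + 1) → ℝ) (hw : ∑ j, w j = 1) (m : Fin (n + 1)) :
    bary K m (∑ j, w j • K.points j) = w m := by
  rw [← Finset.univ.affineCombination_eq_linear_combination _ _ hw]
  exact (toBasis K).coord_apply_combination_of_mem (Finset.mem_univ m) hw

lemma bary_faceCenter (m : Fin (n + 1)) :
    bary K m (faceCenter K i) = if m = i then 0 else (n : ℝ)⁻¹ := by
  refine bary_sum_smul K _ ?_ m
  have : (n : ℝ) ≠ 0 := NeZero.ne _
  rw [Finset.sum_ite]
  simp [Finset.filter_ne', this]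

lemma bary_faceCenter_self : bary K i (faceCenter K i) = 0 := by simp [bary_faceCenter]

lemma bary_faceCenter_pos {m : Fin (n + 1)} (h : m ≠ i) : 0 < bary K m (faceCenter K i) := by
  have : 0 < (n : ℝ) := Nat.cast_pos.2 (NeZero.pos n)
  simp [bary_faceCenter, h, this]

lemma faceCenter_mem : faceCenter K i ∈ face K i := by
  rw [face_eq, cell_eq]
  refine ⟨fun m => ?_, bary_faceCenter_self K i⟩
  by_cases h : m = i
  · rw [h, bary_faceCenter_self]
  · exact (bary_faceCenter_pos K i h).le

/-- A continuous nonnegative function with vanishing integral over a face vanishes on the face. -/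
lemma eq_zero_of_intF_eq_zero {f : E n → ℝ} (hf : Continuous f) (h0 : ∀ x ∈ face K i, 0 ≤ f x)
    (h : intF K i f = 0) : ∀ x ∈ face K i, f x = 0 := by
  have hpl := (isometry_facePlane K i).continuous
  -- The relative interior of the face, open in the parametrizing hyperplane: vanishing almost
  -- everywhere becomes vanishing there. The remaining points of the face are reached along segments
  -- towards its barycentre.
  set U : Set (faceDir K i) := {z | ∀ j, j ≠ i → 0 < bary K j (facePlane K i z)} with hU
  have hUo : IsOpen U := by
    have : U = ⋂ j, {z | j ≠ i → 0 < bary K j (facePlane K i z)} := by ext; simp [hU]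
    rw [this]
    refine isOpen_iInter_of_finite fun j => ?_
    by_cases hj : j = i
    · simp [hj]
    · simpa [hj] using isOpen_lt continuous_const ((continuous_bary K j).comp hpl)
  have hUs : U ⊆ facePlane K i ⁻¹' face K i := by
    intro z hz
    rw [Set.mem_preimage, face_eq, cell_eq]
    refine ⟨fun j => ?_, bary_facePlane K i z⟩
    by_cases hj : j = i
    · rw [hj, bary_facePlane]
    · exact (hz j hj).le
  have hm := (isCompact_preimage_face K i).isClosed.measurableSet
  rw [intF_eq] at h
  have h1 : (fun z => f (facePlane K i z)) =ᵐ[volume.restrict (facePlane K i ⁻¹' face K i)] 0 := by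
    refine (setIntegral_eq_zero_iff_of_nonneg_ae ((ae_restrict_iff' hm).2
      (Filter.Eventually.of_forall fun z hz => h0 _ hz)) ?_).1 h
    exact (hf.comp hpl).continuousOn.integrableOn_compact (isCompact_preimage_face K i)
  have h2 : (fun z => f (facePlane K i z)) =ᵐ[volume.restrict U] fun _ => 0 :=
    ae_restrict_of_ae_restrict_of_subset hUs h1
  have h3 := Measure.eqOn_open_of_ae_eq h2 hUo (hf.comp hpl).continuousOn continuousOn_const
  intro x hx
  set c := faceCenter K i
  have hb : ∀ (t : ℝ) j, bary K j (x + t • (c - x)) = (1 - t) * bary K j x + t * bary K j c := by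
    intro t j
    rw [bary_add, map_smul, bary_linear_sub, smul_eq_mul]; ring
  have h4 : ∀ t ∈ Set.Ioo (0 : ℝ) 1, f (x + t • (c - x)) = 0 := by
    intro t ht
    have hxi : bary K i x = 0 := by rw [face_eq] at hx; exact hx.2
    have hxc := face_subset_cell K i hx
    have hmem : x + t • (c - x) ∈ face K i :=
      (convex_convexHull ℝ _).add_smul_sub_mem hx (faceCenter_mem K i) ⟨ht.1.le, ht.2.le⟩
    obtain ⟨z, hz⟩ := face_subset_range K i hmem
    rw [← hz]
    refine h3 (x := z) fun j hj => ?_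
    rw [hz, hb]
    have := mul_nonneg (sub_nonneg.2 ht.2.le) (bary_nonneg hxc j)
    have := mul_pos ht.1 (bary_faceCenter_pos K i hj)
    linarith
  have h5 : Filter.Tendsto (fun t : ℝ => f (x + t • (c - x))) (nhdsWithin 0 (Set.Ioi 0))
      (nhds (f (x + (0 : ℝ) • (c - x)))) :=
    (Continuous.tendsto (by fun_prop) 0).mono_left nhdsWithin_le_nhds
  have h6 : Filter.Tendsto (fun t : ℝ => f (x + t • (c - x))) (nhdsWithin 0 (Set.Ioi 0))
      (nhds 0) := by
    refine tendsto_const_nhds.congr' ?_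
    filter_upwards [Ioo_mem_nhdsGT (zero_lt_one' ℝ)] with t ht using (h4 t ht).symm
  simpa using tendsto_nhds_unique h5 h6

end Integrals

/-! ### Cauchy–Schwarz inequalities for integrals. -/

section CauchySchwarz

/-- The Cauchy–Schwarz inequality on cells. -/
lemma sq_integral_mul_le {X : Type*} [MeasurableSpace X] {μ : Measure X} {f g : X → ℝ}
    (hf : MemLp f 2 μ) (hg : MemLp g 2 μ) :
    (∫ x, f x * g x ∂μ) ^ 2 ≤ (∫ x, f x ^ 2 ∂μ) * ∫ x, g x ^ 2 ∂μ := by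
  have hfg : Integrable (fun x => f x * g x) μ := hf.integrable_mul hg
  have hf2 := hf.integrable_sq
  have hg2 := hg.integrable_sq
  have key : ∀ t : ℝ, 0 ≤ (∫ x, g x ^ 2 ∂μ) * (t * t) + (2 * ∫ x, f x * g x ∂μ) * t +
      ∫ x, f x ^ 2 ∂μ := by
    intro t
    have h : ∫ x, (t * g x + f x) ^ 2 ∂μ = (∫ x, g x ^ 2 ∂μ) * (t * t) +
        (2 * ∫ x, f x * g x ∂μ) * t + ∫ x, f x ^ 2 ∂μ := by
      have h1 : Integrable (fun x => t * t * g x ^ 2 + 2 * (f x * g x) * t) μ :=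
        (hg2.const_mul _).add ((hfg.const_mul _).mul_const _)
      rw [mul_comm _ (t * t), ← integral_const_mul 2, ← integral_const_mul (t * t),
        ← integral_mul_const, ← integral_add (hg2.const_mul _) ((hfg.const_mul _).mul_const _),
        ← integral_add h1 hf2]
      congr 1; ext x; ring
    rw [← h]
    exact integral_nonneg fun x => sq_nonneg _
  have := discrim_le_zero key
  rw [discrim] at this
  nlinarith

variable (K : Affine.Simplex ℝ (E n) n) (i : Fin (n + 1))

lemma memLp_cell {g : E n → ℝ} (hg : Continuous g) : MemLp g 2 (volume.restrict (cell K)) := by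
  rw [memLp_two_iff_integrable_sq hg.aestronglyMeasurable]
  exact integrableOn_cell K (by fun_prop)

lemma memLp_face [NeZero n] {g : E n → ℝ} (hg : Continuous g) :
    MemLp g 2 ((Measure.euclideanHausdorffMeasure (n - 1)).restrict (face K i)) := by
  rw [memLp_two_iff_integrable_sq hg.aestronglyMeasurable]
  exact integrableOn_face K i (by fun_prop)

lemma sq_intK_mul_le {f g : E n → ℝ} (hf : Continuous f) (hg : Continuous g) :
    intK K (fun x => f x * g x) ^ 2 ≤ intK K (fun x => f x ^ 2) * intK K (fun x => g x ^ 2) :=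
  sq_integral_mul_le (memLp_cell K hf) (memLp_cell K hg)

lemma sq_intF_mul_le [NeZero n] {f g : E n → ℝ} (hf : Continuous f) (hg : Continuous g) :
    intF K i (fun x => f x * g x) ^ 2 ≤
      intF K i (fun x => f x ^ 2) * intF K i (fun x => g x ^ 2) :=
  sq_integral_mul_le (memLp_face K i hf) (memLp_face K i hg)

end CauchySchwarz

end

section

variable {n : ℕ}

/-! ### Polynomials as functions: derivatives, degrees, affine substitution. -/

section Polynomials

open MvPolynomial

lemma val_add (p q : MvPolynomial (Fin n) ℝ) (x : E n) : val (p + q) x = val p x + val q x := by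
  simp [val]

lemma val_sub (p q : MvPolynomial (Fin n) ℝ) (x : E n) : val (p - q) x = val p x - val q x := by
  simp [val]

lemma val_mul (p q : MvPolynomial (Fin n) ℝ) (x : E n) : val (p * q) x = val p x * val q x := by
  simp [val]

lemma val_C (a : ℝ) (x : E n) : val (C a) x = a := by simp [val]

lemma val_smul (a : ℝ) (p : MvPolynomial (Fin n) ℝ) (x : E n) : val (a • p) x = a * val p x := by
  simp [val]

@[simp] lemma val_zero (x : E n) : val 0 x = 0 := by simp [val]

lemma val_sum {ι : Type*} (s : Finset ι) (p : ι → MvPolynomial (Fin n) ℝ) (x : E n) :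
    val (∑ j ∈ s, p j) x = ∑ j ∈ s, val (p j) x := by simp [val]

lemma val_X (a : Fin n) (x : E n) : val (X a) x = x a := by simp [val]

/-- The derivative of a polynomial in a direction. -/
def dirD (v : E n) (p : MvPolynomial (Fin n) ℝ) : MvPolynomial (Fin n) ℝ :=
  ∑ a, C (v a) * pderiv a p

lemma val_dirD (v : E n) (p : MvPolynomial (Fin n) ℝ) (x : E n) :
    val (dirD v p) x = ∑ a, v a * gradVal p x a := by
  simp [dirD, val_sum, val_mul, val_C, gradVal]

lemma hasFDerivAt_val (p : MvPolynomial (Fin n) ℝ) (x : E n) :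
    HasFDerivAt (val p) (∑ a, gradVal p x a • (EuclideanSpace.proj a : E n →L[ℝ] ℝ)) x := by
  induction p using MvPolynomial.induction_on with
  | C a =>
    have h : val (C a : MvPolynomial (Fin n) ℝ) = fun _ => a := by ext; exact val_C a _
    rw [h]
    simpa [gradVal] using hasFDerivAt_const (𝕜 := ℝ) a x
  | add p q hp hq =>
    have h : val (p + q) = fun x => val p x + val q x := by ext; exact val_add _ _ _
    rw [h]
    convert! hp.add hq using 1
    simp [gradVal, val_add, add_smul, Finset.sum_add_distrib]
  | mul_X p b hp =>
    have h : val (p * X b) = fun x => val p x * x b := by ext; rw [val_mul, val_X]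
    rw [h]
    have hb : HasFDerivAt (fun x : E n => x b) (EuclideanSpace.proj b : E n →L[ℝ] ℝ) x :=
      (EuclideanSpace.proj b : E n →L[ℝ] ℝ).hasFDerivAt
    convert! hp.mul hb using 1
    simp only [gradVal, Derivation.leibniz, val_add, smul_eq_mul, val_mul, val_X, add_smul,
      Finset.sum_add_distrib, Finset.smul_sum, smul_smul]
    congr 1
    rw [Finset.sum_eq_single b]
    · simp [val]
    · intro a _ hab
      simp [pderiv_X_of_ne hab.symm]
    · simp

lemma fderiv_val (p : MvPolynomial (Fin n) ℝ) (x v : E n) :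
    fderiv ℝ (val p) x v = val (dirD v p) x := by
  rw [(hasFDerivAt_val p x).fderiv, val_dirD]
  simp [mul_comm]

lemma continuous_val (p : MvPolynomial (Fin n) ℝ) : Continuous (val p) := by
  have : Continuous fun x : E n => fun a => x a := by fun_prop
  exact (MvPolynomial.continuous_eval p).comp this

lemma contDiff_val (p : MvPolynomial (Fin n) ℝ) : ContDiff ℝ 1 (val p) := by
  rw [contDiff_one_iff_fderiv]
  refine ⟨fun x => (hasFDerivAt_val p x).differentiableAt, ?_⟩
  have : fderiv ℝ (val p) =
      fun x => ∑ a, gradVal p x a • (EuclideanSpace.proj a : E n →L[ℝ] ℝ) := by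
    ext1 x; exact (hasFDerivAt_val p x).fderiv
  rw [this]
  exact continuous_finsetSum _ fun a _ => (continuous_val _).smul continuous_const

lemma dirD_mul (v : E n) (p q : MvPolynomial (Fin n) ℝ) :
    dirD v (p * q) = dirD v p * q + p * dirD v q := by
  rw [dirD, dirD, dirD, Finset.sum_mul, Finset.mul_sum, ← Finset.sum_add_distrib]
  refine Finset.sum_congr rfl fun a _ => ?_
  rw [Derivation.leibniz, smul_eq_mul, smul_eq_mul]
  ring

lemma val_dirD_linear (p : MvPolynomial (Fin n) ℝ) (x : E n) {ι : Type*} (s : Finset ι)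
    (w : ι → ℝ) (v : ι → E n) :
    val (dirD (∑ j ∈ s, w j • v j) p) x = ∑ j ∈ s, w j * val (dirD (v j) p) x := by
  simp only [← fderiv_val, map_sum, map_smul, smul_eq_mul]

lemma totalDegree_pderiv_le (a : Fin n) (p : MvPolynomial (Fin n) ℝ) :
    (pderiv a p).totalDegree ≤ p.totalDegree - 1 := by
  conv_lhs => rw [p.as_sum, map_sum]
  refine totalDegree_finsetSum_le fun s hs => ?_
  rw [pderiv_monomial]
  by_cases h : s a = 0
  · simp [h]
  · refine (totalDegree_monomial_le _ _).trans ?_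
    have h1 : s.sum (fun _ e => e) ≤ p.totalDegree := le_totalDegree hs
    have h2 : s = (s - Finsupp.single a 1) + Finsupp.single a 1 := by
      rw [tsub_add_cancel_of_le]
      simpa [Finsupp.single_le_iff] using Nat.one_le_iff_ne_zero.2 h
    have h3 : s.degree = (s - Finsupp.single a 1).degree + 1 := by
      conv_lhs => rw [h2]
      simp
    have h4 : s.degree ≤ p.totalDegree := h1
    change (s - Finsupp.single a 1).degree ≤ _
    omega

lemma totalDegree_dirD_le (v : E n) (p : MvPolynomial (Fin n) ℝ) :
    (dirD v p).totalDegree ≤ p.totalDegree - 1 := by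
  refine totalDegree_finsetSum_le fun a _ => (totalDegree_mul _ _).trans ?_
  simpa using totalDegree_pderiv_le a p

lemma dirD_mem {k : ℕ} (v : E n) (p : Poly n k) :
    dirD v p.1 ∈ MvPolynomial.restrictTotalDegree (Fin n) ℝ k := by
  have := (mem_restrictTotalDegree _ _ _).1 p.2
  rw [mem_restrictTotalDegree]
  have := totalDegree_dirD_le v p.1
  omega

/-- An affine function as a polynomial. -/
def affPoly (l : E n →ᵃ[ℝ] ℝ) : MvPolynomial (Fin n) ℝ :=
  C (l 0) + ∑ a, C (l.linear (EuclideanSpace.single a 1)) * X a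

lemma sum_smul_single (v : E n) : ∑ a, v a • EuclideanSpace.single a (1 : ℝ) = v := by
  ext b
  simp [Finset.sum_apply, Pi.single_apply]

lemma val_affPoly (l : E n →ᵃ[ℝ] ℝ) (x : E n) : val (affPoly l) x = l x := by
  have h := l.map_vadd 0 x
  rw [vadd_eq_add, add_zero, vadd_eq_add] at h
  rw [h, affPoly, val_add, val_C, val_sum, add_comm]
  congr 1
  conv_rhs => rw [← sum_smul_single x, map_sum]
  refine Finset.sum_congr rfl fun a _ => ?_
  rw [val_mul, val_C, val_X, map_smul, smul_eq_mul, mul_comm]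

lemma totalDegree_affPoly (l : E n →ᵃ[ℝ] ℝ) : (affPoly l).totalDegree ≤ 1 := by
  refine (totalDegree_add _ _).trans (max_le (by simp) (totalDegree_finsetSum_le fun a _ => ?_))
  exact (totalDegree_mul _ _).trans (by simp)

/-- The degree lost by differentiating pays for the affine factor. Constants need their own case
because the degree bound uses truncated subtraction; their derivative is zero. This admits
barycentric coordinate times derivative as a test function. -/
lemma affPoly_mul_dirD_mem {k : ℕ} (l : E n →ᵃ[ℝ] ℝ) (v : E n) (p : Poly n k) :
    affPoly l * dirD v p.1 ∈ MvPolynomial.restrictTotalDegree (Fin n) ℝ k := by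
  have hp := (mem_restrictTotalDegree _ _ _).1 p.2
  rw [mem_restrictTotalDegree]
  rcases Nat.eq_zero_or_pos p.1.totalDegree with h | h
  · have h0 : dirD v p.1 = 0 := by
      rw [totalDegree_eq_zero_iff_eq_C.1 h]
      simp [dirD]
    simp [h0]
  · refine (totalDegree_mul _ _).trans ?_
    have h1 := totalDegree_affPoly l
    have h2 := totalDegree_dirD_le v p.1
    omega

/-- Polynomials of degree at most `k` are invariant under affine changes of variables. -/
lemma exists_val_comp_affine {k : ℕ} (p : Poly n k) (Φ : E n →ᵃ[ℝ] E n) :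
    ∃ q : Poly n k, ∀ x, val q.1 x = val p.1 (Φ x) := by
  set l : Fin n → (E n →ᵃ[ℝ] ℝ) := fun a =>
    (EuclideanSpace.proj a : E n →L[ℝ] ℝ).toLinearMap.toAffineMap.comp Φ with hl
  refine ⟨⟨aeval (fun a => affPoly (l a)) p.1, ?_⟩, fun x => ?_⟩
  · rw [mem_restrictTotalDegree]
    conv_lhs => rw [p.1.as_sum, map_sum]
    refine totalDegree_finsetSum_le fun s hs => ?_
    have hp := (mem_restrictTotalDegree _ _ _).1 p.2
    have h1 : s.sum (fun _ e => e) ≤ p.1.totalDegree := le_totalDegree hs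
    rw [aeval_monomial]
    refine (totalDegree_mul _ _).trans ?_
    rw [algebraMap_eq, totalDegree_C, zero_add]
    refine le_trans ?_ (h1.trans hp)
    refine (totalDegree_finsetProd _ _).trans (Finset.sum_le_sum fun a _ => ?_)
    refine (totalDegree_pow _ _).trans ?_
    calc s a * (affPoly (l a)).totalDegree ≤ s a * 1 :=
          Nat.mul_le_mul_left _ (totalDegree_affPoly _)
      _ = s a := mul_one _
  · have h2 : ∀ q : MvPolynomial (Fin n) ℝ,
        val (aeval (fun a => affPoly (l a)) q) x = val q (Φ x) := by
      intro q
      induction q using MvPolynomial.induction_on with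
      | C a => simp [val]
      | add p q hp hq => rw [map_add, val_add, hp, hq, val_add]
      | mul_X p b hp =>
        rw [map_mul, val_mul, hp, aeval_X, val_affPoly, val_mul, val_X]
        simp [hl]
    exact h2 p.1

/-- A polynomial that vanishes in the interior of a simplex is zero. -/
lemma eq_zero_of_val_eq_zero {p : MvPolynomial (Fin n) ℝ} (K : Affine.Simplex ℝ (E n) n)
    (h : ∀ x ∈ interior (cell K), val p x = 0) : p = 0 := by
  obtain ⟨c, hc⟩ := centroid_mem_interior K
  have hopen : IsOpen ((WithLp.toLp 2 : (Fin n → ℝ) → E n) ⁻¹' interior (cell K)) :=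
    isOpen_interior.preimage (PiLp.continuous_toLp 2 _)
  obtain ⟨ε, hε, hb⟩ := Metric.isOpen_iff.1 hopen (WithLp.ofLp c) (by simpa using hc)
  refine MvPolynomial.funext_set (fun a => Metric.ball (c a) ε) (fun a => ?_) fun x hx => ?_
  · rw [Real.ball_eq_Ioo]
    exact Set.Ioo_infinite (by linarith)
  · have hx' : x ∈ Metric.ball (WithLp.ofLp c) ε := by
      rw [ball_pi _ hε]; exact hx
    have := h _ (hb hx')
    simpa [val] using this

end Polynomials

end

section

variable {n : ℕ}

/-! ### Divergence theorem and Green's formula on a simplex. -/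

section IntegrationByParts

variable [NeZero n] (K : Affine.Simplex ℝ (E n) n)

/-- Integration by parts for a constant direction. -/
lemma intK_fderiv {f : E n → ℝ} (hf : ContDiff ℝ 1 f) (v : E n) :
    intK K (fun x => fderiv ℝ f x v) =
      -∑ i, (bary K i).linear v * (K.height i * intF K i f) := by
  have hf' : Continuous (fun x => fderiv ℝ f x) := hf.continuous_fderiv (by norm_num)
  have hc : ∀ i, Continuous fun x => n * f x + fderiv ℝ f x (x - K.points i) := fun i =>
    (continuous_const.mul hf.continuous).add (hf'.clm_apply (by fun_prop))
  simp only [← intK_cone K _ hf, ← intK_const_mul]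
  rw [← intK_sum K Finset.univ (f := fun i x => (bary K i).linear v *
    (n * f x + fderiv ℝ f x (x - K.points i))) fun i _ => continuous_const.mul (hc i),
    ← neg_one_mul, ← intK_const_mul]
  congr 1
  ext x
  -- A constant field is a combination of the radial fields at the vertices with constant
  -- coefficients, so the general formula follows from the radial identities; the terms with the
  -- factor `n` drop out because the coefficients sum to zero.
  have h1 : ∑ i, (bary K i).linear v • (x - K.points i) = -v := by
    rw [← sum_bary_linear_smul_sub K (-v) x]
    exact Finset.sum_congr rfl fun i _ => by rw [map_neg, neg_smul, ← smul_neg, neg_sub]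
  simp only [mul_add, Finset.sum_add_distrib]
  rw [← Finset.sum_mul, sum_bary_linear, zero_mul, mul_zero, zero_add]
  simp only [← smul_eq_mul, ← map_smul]
  rw [← map_sum, h1]
  simp

lemma intK_dirD (v : E n) (p : MvPolynomial (Fin n) ℝ) :
    intK K (val (dirD v p)) = -∑ i, (bary K i).linear v * (K.height i * intF K i (val p)) := by
  rw [← intK_fderiv K (contDiff_val p)]
  simp only [fderiv_val]

lemma intK_cone_val (i : Fin (n + 1)) (p : MvPolynomial (Fin n) ℝ) :
    intK K (fun x => n * val p x + val (dirD (x - K.points i) p) x) =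
      K.height i * intF K i (val p) := by
  rw [← intK_cone K i (contDiff_val p)]
  simp only [fderiv_val]

omit [NeZero n] in
lemma val_dirD_single (a : Fin n) (p : MvPolynomial (Fin n) ℝ) (x : E n) :
    val (dirD (EuclideanSpace.single a 1) p) x = gradVal p x a := by
  rw [val_dirD, Finset.sum_eq_single a] <;> simp +contextual

/-- Green's formula for polynomials. -/
lemma green {k : ℕ} (w : MvPolynomial (Fin n) ℝ) (r : Fin n → Poly n k) :
    intK K (fun x => val w x * divVal r x) =
      -intK K (fun x => gradVal w x ⬝ᵥ vecVal r x) +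
        ∑ i, intF K i (fun x => val w x * (vecVal r x ⬝ᵥ normal K i)) := by
  have h1 : ∀ a, intK K (fun x => gradVal w x a * val (r a).1 x +
      val w x * val (MvPolynomial.pderiv a (r a).1) x) =
      ∑ i, intF K i (fun x => val w x * (val (r a).1 x * normal K i a)) := by
    intro a
    have h2 := intK_dirD K (EuclideanSpace.single a 1) (w * (r a).1)
    have h3 : val (dirD (EuclideanSpace.single a 1) (w * (r a).1)) = fun x =>
        gradVal w x a * val (r a).1 x + val w x * val (MvPolynomial.pderiv a (r a).1) x := by
      ext x
      rw [dirD_mul, val_add, val_mul, val_mul, val_dirD_single, val_dirD_single]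
      rfl
    rw [← h3, h2, ← Finset.sum_neg_distrib]
    refine Finset.sum_congr rfl fun i _ => ?_
    have h4 : (fun x => val w x * (val (r a).1 x * normal K i a)) =
        fun x => normal K i a * val (w * (r a).1) x := by
      ext x; rw [val_mul]; ring
    rw [h4, intF_const_mul, normal_eq]
    ring
  have hcw := continuous_val w
  have hcr : ∀ a, Continuous (val (r a).1) := fun a => continuous_val _
  have hcg : ∀ a, Continuous (fun x => gradVal w x a) := fun a => continuous_val _
  have hcd : ∀ a, Continuous (val (MvPolynomial.pderiv a (r a).1)) := fun a => continuous_val _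
  have h5 : ∑ i, intF K i (fun x => val w x * (vecVal r x ⬝ᵥ normal K i)) =
      ∑ a, ∑ i, intF K i (fun x => val w x * (val (r a).1 x * normal K i a)) := by
    rw [Finset.sum_comm]
    refine Finset.sum_congr rfl fun i _ => ?_
    rw [← intF_sum K i _ fun a _ => by fun_prop]
    simp only [dotProduct, vecVal, Finset.mul_sum]
  rw [h5, ← Finset.sum_congr rfl fun a _ => h1 a, ← intK_sum K _ fun a _ => by fun_prop,
    eq_neg_add_iff_add_eq, ← intK_add]
  · congr 1
    ext x
    simp only [divVal, dotProduct, vecVal, Finset.mul_sum, Finset.sum_add_distrib]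
  · simp only [dotProduct, vecVal]; fun_prop
  · simp only [divVal]; fun_prop

end IntegrationByParts

/-! ### Affine maps between simplices and the scaling of integrals. -/

section Scaling

variable (K₀ K : Affine.Simplex ℝ (E n) n)

/-- The affine map taking the vertices of one simplex to those of another. -/
def simplexMap : E n →ᵃ[ℝ] E n :=
  ∑ i, (LinearMap.toSpanSingleton ℝ (E n) (K.points i)).toAffineMap.comp (bary K₀ i)

lemma simplexMap_apply (x : E n) : simplexMap K₀ K x = ∑ i, bary K₀ i x • K.points i := by
  have : ∀ (s : Finset (Fin (n + 1))) (f : Fin (n + 1) → (E n →ᵃ[ℝ] E n)),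
      (∑ i ∈ s, f i) x = ∑ i ∈ s, f i x := by
    intro s f
    induction s using Finset.induction_on with
    | empty => simp
    | insert a s ha ih => simp [Finset.sum_insert ha, ih]
  simp [simplexMap, this]

lemma bary_simplexMap (i : Fin (n + 1)) (x : E n) :
    bary K i (simplexMap K₀ K x) = bary K₀ i x := by
  rw [simplexMap_apply]
  exact bary_sum_smul K _ (sum_bary K₀ x) i

lemma simplexMap_simplexMap (x : E n) : simplexMap K K₀ (simplexMap K₀ K x) = x := by
  rw [simplexMap_apply]
  simp only [bary_simplexMap, sum_bary_smul]

lemma simplexMap_points (i : Fin (n + 1)) : simplexMap K₀ K (K₀.points i) = K.points i := by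
  simp [simplexMap_apply, bary_points]

lemma image_simplexMap : simplexMap K₀ K '' cell K₀ = cell K := by
  ext x
  constructor
  · rintro ⟨y, hy, rfl⟩
    rw [cell_eq] at hy ⊢
    exact fun i => by rw [bary_simplexMap]; exact hy i
  · intro hx
    refine ⟨simplexMap K K₀ x, ?_, simplexMap_simplexMap K K₀ x⟩
    rw [cell_eq] at hx ⊢
    exact fun i => by rw [bary_simplexMap]; exact hx i

lemma hasFDerivAt_simplexMap (x : E n) :
    HasFDerivAt (simplexMap K₀ K) (simplexMap K₀ K).linear.toContinuousLinearMap x := by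
  have h : (simplexMap K₀ K : E n → E n) =
      fun x => (simplexMap K₀ K).linear.toContinuousLinearMap x + simplexMap K₀ K 0 := by
    ext1 x
    have := (simplexMap K₀ K).map_vadd 0 x
    simpa using this
  exact ((ContinuousLinearMap.hasFDerivAt _).add_const _).congr_of_eventuallyEq
    (Filter.Eventually.of_forall (congrFun h))

lemma intK_pos : 0 < intK K (fun _ => 1) := by
  rw [intK, setIntegral_const, smul_eq_mul, mul_one]
  exact ENNReal.toReal_pos (Measure.measure_pos_of_nonempty_interior _ (centroid_mem_interior K)).ne'
    (isCompact_cell K).measure_lt_top.ne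

/-- Change of variables between simplices. -/
lemma exists_intK_simplexMap : ∃ J : ℝ, 0 < J ∧
    ∀ f : E n → ℝ, intK K f = J * intK K₀ (fun x => f (simplexMap K₀ K x)) := by
  have h : ∀ f : E n → ℝ, intK K f = |(simplexMap K₀ K).linear.toContinuousLinearMap.det| *
      intK K₀ (fun x => f (simplexMap K₀ K x)) := by
    intro f
    rw [← intK_const_mul, intK, ← image_simplexMap K₀ K]
    exact integral_image_eq_integral_abs_det_fderiv_smul volume (measurableSet_cell K₀)
      (fun x _ => (hasFDerivAt_simplexMap K₀ K x).hasFDerivWithinAt)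
      (Function.LeftInverse.injective (simplexMap_simplexMap K₀ K)).injOn f
  -- A vanishing Jacobian would give the target simplex zero volume.
  refine ⟨_, lt_of_le_of_ne (abs_nonneg _) fun h0 => ?_, h⟩
  have := h fun _ => 1
  rw [← h0, zero_mul] at this
  exact (intK_pos K).ne' this

/-- Change of variables between simplices and their faces. -/
lemma exists_scaling [NeZero n] : ∃ J : ℝ, 0 < J ∧
    (∀ f : E n → ℝ, intK K f = J * intK K₀ (fun x => f (simplexMap K₀ K x))) ∧
    ∀ i, ∀ f : E n → ℝ, ContDiff ℝ 1 f → K.height i * intF K i f =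
      J * (K₀.height i * intF K₀ i (fun x => f (simplexMap K₀ K x))) := by
  obtain ⟨J, hJ, h⟩ := exists_intK_simplexMap K₀ K
  refine ⟨J, hJ, h, fun i f hf => ?_⟩
  have hs : ContDiff ℝ 1 (simplexMap K₀ K) := by
    rw [contDiff_one_iff_fderiv]
    refine ⟨fun x => (hasFDerivAt_simplexMap K₀ K x).differentiableAt, ?_⟩
    have : fderiv ℝ (simplexMap K₀ K) = fun _ => (simplexMap K₀ K).linear.toContinuousLinearMap := by
      ext1 x; exact (hasFDerivAt_simplexMap K₀ K x).fderiv
    rw [this]; exact continuous_const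
  -- A face integral times its height is a volume integral by `intK_cone`, and the affine map
  -- carries radial fields to radial fields. No surface Jacobian is computed, and height-weighted
  -- face integrals scale by the same factor as volumes, whatever the shape.
  have hcone : _ = K₀.height i * intF K₀ i (fun x => f (simplexMap K₀ K x)) :=
    intK_cone K₀ i (hf.comp hs)
  rw [← intK_cone K i hf, ← hcone, h]
  congr 2
  ext x
  have hd := ((hf.differentiable (by norm_num)) (simplexMap K₀ K x)).hasFDerivAt.comp x
    (hasFDerivAt_simplexMap K₀ K x)
  have hd' : fderiv ℝ (fun x => f (simplexMap K₀ K x)) x = _ := hd.fderiv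
  have hl : (simplexMap K₀ K).linear (x - K₀.points i) = simplexMap K₀ K x - K.points i := by
    have := (simplexMap K₀ K).linearMap_vsub x (K₀.points i)
    rw [simplexMap_points] at this
    exact this
  change _ = n * f (simplexMap K₀ K x) + fderiv ℝ (fun x => f (simplexMap K₀ K x)) x _
  rw [hd', ContinuousLinearMap.comp_apply, LinearMap.coe_toContinuousLinearMap', hl]

lemma exists_simplex (n : ℕ) : Nonempty (Affine.Simplex ℝ (E n) n) := by
  obtain ⟨s, b, hb⟩ := AffineBasis.exists_affineBasis ℝ (E n) (E n)
  have hfin : Finite s := finite_of_fin_dim_affineIndependent ℝ b.ind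
  have := Fintype.ofFinite s
  have hcard : Fintype.card s = n + 1 := by
    have := b.card_eq_finrank_add_one
    simpa using this
  exact ⟨⟨fun i => b ((Fintype.equivFinOfCardEq hcard).symm i),
    b.ind.comp_embedding (Fintype.equivFinOfCardEq hcard).symm.toEmbedding⟩⟩

end Scaling

end

section

variable {n : ℕ}

/-! ### Comparison of quadratic forms in finite dimension. -/

section FiniteDimensional

/-- On a finite-dimensional space a quadratic form is bounded by a positive definite one. -/
lemma exists_quadratic_bound {V : Type*} [AddCommGroup V] [Module ℝ V] [FiniteDimensional ℝ V]
    (A B : V →ₗ[ℝ] V →ₗ[ℝ] ℝ) (hB : ∀ v, v ≠ 0 → 0 < B v v) :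
    ∃ C : ℝ, 0 < C ∧ ∀ v, A v v ≤ C * B v v := by
  set b := Module.finBasis ℝ V
  set e := b.equivFun
  have hcont : ∀ Q : V →ₗ[ℝ] V →ₗ[ℝ] ℝ,
      Continuous fun z : Fin (Module.finrank ℝ V) → ℝ => Q (e.symm z) (e.symm z) := by
    intro Q
    have : (fun z : Fin (Module.finrank ℝ V) → ℝ => Q (e.symm z) (e.symm z)) =
        fun z => ∑ i, ∑ j, z i * (z j * Q (b i) (b j)) := by
      ext z
      simp only [e, Module.Basis.equivFun_symm_apply, map_sum, LinearMap.sum_apply, map_smul,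
        LinearMap.smul_apply, smul_eq_mul, Finset.mul_sum]
      rw [Finset.sum_comm]
      exact Finset.sum_congr rfl fun i _ => Finset.sum_congr rfl fun j _ => by ring
    rw [this]; fun_prop
  have hpos : ∀ z ∈ Metric.sphere (0 : Fin (Module.finrank ℝ V) → ℝ) 1,
      0 < B (e.symm z) (e.symm z) := by
    intro z hz
    refine hB _ fun h => ?_
    rw [LinearEquiv.map_eq_zero_iff] at h
    simp [h] at hz
  have hc : ContinuousOn (fun z => A (e.symm z) (e.symm z) / B (e.symm z) (e.symm z))
      (Metric.sphere (0 : Fin (Module.finrank ℝ V) → ℝ) 1) :=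
    (hcont A).continuousOn.div (hcont B).continuousOn fun z hz => (hpos z hz).ne'
  obtain ⟨M, hM⟩ := ((isCompact_sphere _ _).bddAbove_image hc)
  refine ⟨max M 1, by positivity, fun v => ?_⟩
  by_cases hv : v = 0
  · simp [hv]
  have hn : 0 < ‖e v‖ := norm_pos_iff.2 (by simpa using hv)
  set z := ‖e v‖⁻¹ • e v with hz
  have hzs : z ∈ Metric.sphere (0 : Fin (Module.finrank ℝ V) → ℝ) 1 := by
    simp [hz, norm_smul, hn.ne']
  have h1 := hM ⟨z, hzs, rfl⟩
  simp only at h1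
  rw [div_le_iff₀ (hpos z hzs), hz] at h1
  simp only [map_smul, LinearEquiv.symm_apply_apply, LinearMap.smul_apply, smul_eq_mul] at h1
  have h2 : A v v ≤ M * B v v := by
    have h3 : 0 < ‖e v‖⁻¹ * ‖e v‖⁻¹ := by positivity
    refine le_of_mul_le_mul_left ?_ h3
    linarith
  exact h2.trans (mul_le_mul_of_nonneg_right (le_max_left _ _) (hB v hv).le)

end FiniteDimensional

/-! ### Weighted, trace and extension estimates scaled from one reference simplex. -/

section ReferenceEstimates

variable (K : Affine.Simplex ℝ (E n) n) (i : Fin (n + 1)) (k : ℕ)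

lemma continuous_valP {k : ℕ} (p : Poly n k) : Continuous (val p.1) := continuous_val p.1

/-- Weighted `L²` form on a cell. -/
def cellForm (ω : E n → ℝ) (hω : Continuous ω) : Poly n k →ₗ[ℝ] Poly n k →ₗ[ℝ] ℝ :=
  LinearMap.mk₂ ℝ (fun p q => intK K fun x => ω x * (val p.1 x * val q.1 x))
    (fun p p' q => by
      have := continuous_valP p; have := continuous_valP p'; have := continuous_valP q
      rw [← intK_add K (by fun_prop) (by fun_prop)]
      simp only [Submodule.coe_add, val_add]
      congr 1; ext x; ring)
    (fun a p q => by
      rw [smul_eq_mul, ← intK_const_mul]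
      simp only [Submodule.coe_smul, val_smul]
      congr 1; ext x; ring)
    (fun p q q' => by
      have := continuous_valP p; have := continuous_valP q; have := continuous_valP q'
      rw [← intK_add K (by fun_prop) (by fun_prop)]
      simp only [Submodule.coe_add, val_add]
      congr 1; ext x; ring)
    (fun a p q => by
      rw [smul_eq_mul, ← intK_const_mul]
      simp only [Submodule.coe_smul, val_smul]
      congr 1; ext x; ring)

lemma cellForm_pos (ω : E n → ℝ) (hω : Continuous ω) (h0 : ∀ x ∈ cell K, 0 ≤ ω x)
    (h1 : ∀ x ∈ interior (cell K), 0 < ω x) {p : Poly n k} (hp : p ≠ 0) :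
    0 < cellForm K k ω hω p p := by
  have hnn : ∀ x ∈ cell K, 0 ≤ ω x * (val p.1 x * val p.1 x) := fun x hx =>
    mul_nonneg (h0 x hx) (mul_self_nonneg _)
  refine lt_of_le_of_ne (intK_nonneg K hnn) fun h => hp ?_
  have hc := continuous_valP p
  have h2 := eq_zero_of_intK_eq_zero K (by fun_prop) hnn h.symm
  refine Subtype.ext (eq_zero_of_val_eq_zero K fun x hx => ?_)
  have := h2 x hx
  simpa [(h1 x hx).ne'] using this

variable [NeZero n]

/-- `L²` form on a face. -/
def faceForm : Poly n k →ₗ[ℝ] Poly n k →ₗ[ℝ] ℝ :=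
  LinearMap.mk₂ ℝ (fun p q => intF K i fun x => val p.1 x * val q.1 x)
    (fun p p' q => by
      have := continuous_valP p; have := continuous_valP p'; have := continuous_valP q
      rw [← intF_add K i (by fun_prop) (by fun_prop)]
      simp only [Submodule.coe_add, val_add]
      congr 1; ext x; ring)
    (fun a p q => by
      rw [smul_eq_mul, ← intF_const_mul]
      simp only [Submodule.coe_smul, val_smul]
      congr 1; ext x; ring)
    (fun p q q' => by
      have := continuous_valP p; have := continuous_valP q; have := continuous_valP q'
      rw [← intF_add K i (by fun_prop) (by fun_prop)]
      simp only [Submodule.coe_add, val_add]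
      congr 1; ext x; ring)
    (fun a p q => by
      rw [smul_eq_mul, ← intF_const_mul]
      simp only [Submodule.coe_smul, val_smul]
      congr 1; ext x; ring)

lemma faceForm_comm (p q : Poly n k) : faceForm K i k p q = faceForm K i k q p := by
  simp only [faceForm, LinearMap.mk₂_apply, mul_comm]

lemma faceForm_eq_zero {p : Poly n k} (h : faceForm K i k p p = 0) (q : Poly n k) :
    faceForm K i k p q = 0 := by
  have := sq_intF_mul_le K i (continuous_valP p) (continuous_valP q)
  simp only [faceForm, LinearMap.mk₂_apply, ← sq] at h ⊢
  rw [h, zero_mul] at this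
  exact pow_eq_zero_iff two_ne_zero |>.1 (le_antisymm this (sq_nonneg _))

omit [NeZero n] in
lemma exists_uniform_bound {ι : Type*} [Fintype ι] {P : ι → ℝ → Prop}
    (hP : ∀ i a b, a ≤ b → P i a → P i b) (h : ∀ i, ∃ C, 0 < C ∧ P i C) :
    ∃ C, 0 < C ∧ ∀ i, P i C := by
  choose C hC h using h
  refine ⟨1 + ∑ i, C i, by have := Finset.sum_nonneg fun i (_ : i ∈ Finset.univ) => (hC i).le;
                           linarith, fun i => hP i _ _ ?_ (h i)⟩
  have := Finset.single_le_sum (fun i _ => (hC i).le) (Finset.mem_univ i)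
  linarith

variable (n)

omit [NeZero n] in
/-- Weighting with a barycentric coordinate gives an equivalent `L²` norm on polynomials. -/
lemma exists_bary_bound : ∃ C : ℝ, 0 < C ∧ ∀ (i : Fin (n + 1)) (K : Affine.Simplex ℝ (E n) n)
    (p : Poly n k), intK K (fun x => val p.1 x ^ 2) ≤
      C * intK K (fun x => bary K i x * val p.1 x ^ 2) := by
  obtain ⟨K₀⟩ := exists_simplex n
  refine exists_uniform_bound ?_ ?_
  · intro i a b hab h K p
    refine (h K p).trans (mul_le_mul_of_nonneg_right hab (intK_nonneg K fun x hx => ?_))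
    exact mul_nonneg (bary_nonneg hx i) (sq_nonneg _)
  · intro i
    obtain ⟨C, hC, h⟩ := exists_quadratic_bound
      (cellForm K₀ k (fun _ => 1) continuous_const)
      (cellForm K₀ k (bary K₀ i) (continuous_bary K₀ i)) fun v hv =>
        cellForm_pos K₀ k _ _ (fun x hx => bary_nonneg hx i)
          (fun x hx => by rw [interior_cell] at hx; exact hx i) hv
    refine ⟨C, hC, fun K p => ?_⟩
    obtain ⟨J, hJ, hK⟩ := exists_intK_simplexMap K₀ K
    obtain ⟨q, hq⟩ := exists_val_comp_affine p (simplexMap K₀ K)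
    have := h q
    simp only [cellForm, LinearMap.mk₂_apply, one_mul, ← sq, hq] at this
    rw [hK, hK fun x => bary K i x * val p.1 x ^ 2, mul_left_comm]
    simp only [bary_simplexMap]
    exact mul_le_mul_of_nonneg_left this hJ.le

/-- The discrete trace inequality. -/
lemma exists_trace_bound : ∃ C : ℝ, 0 < C ∧ ∀ (i : Fin (n + 1)) (K : Affine.Simplex ℝ (E n) n)
    (p : Poly n k), K.height i * intF K i (fun x => val p.1 x ^ 2) ≤
      C * intK K (fun x => val p.1 x ^ 2) := by
  obtain ⟨K₀⟩ := exists_simplex n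
  refine exists_uniform_bound ?_ ?_
  · intro i a b hab h K p
    exact (h K p).trans (mul_le_mul_of_nonneg_right hab (intK_nonneg K fun x hx => sq_nonneg _))
  · intro i
    obtain ⟨C, hC, h⟩ := exists_quadratic_bound
      (K₀.height i • faceForm K₀ i k)
      (cellForm K₀ k (fun _ => 1) continuous_const) fun v hv =>
        cellForm_pos K₀ k _ _ (fun x hx => zero_le_one) (fun x hx => zero_lt_one) hv
    refine ⟨C, hC, fun K p => ?_⟩
    obtain ⟨J, hJ, hK, hF⟩ := exists_scaling K₀ K
    obtain ⟨q, hq⟩ := exists_val_comp_affine p (simplexMap K₀ K)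
    have := h q
    simp only [cellForm, faceForm, LinearMap.smul_apply, LinearMap.mk₂_apply, one_mul, ← sq, hq,
      smul_eq_mul] at this
    rw [hK, hF i _ ((contDiff_val p.1).pow 2), mul_left_comm C]
    exact mul_le_mul_of_nonneg_left this hJ.le

/-- Stable extension of polynomials from a face to the cell. -/
lemma exists_extension_bound : ∃ C : ℝ, 0 < C ∧ ∀ (i : Fin (n + 1))
    (K : Affine.Simplex ℝ (E n) n) (e : Poly n k), ∃ w : Poly n k,
      intF K i (fun x => val e.1 x * val w.1 x) = intF K i (fun x => val e.1 x ^ 2) ∧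
      intK K (fun x => val w.1 x ^ 2) ≤ C * (K.height i * intF K i (fun x => val e.1 x ^ 2)) := by
  obtain ⟨K₀⟩ := exists_simplex n
  refine exists_uniform_bound ?_ ?_
  · intro i a b hab h K e
    obtain ⟨w, h1, h2⟩ := h K e
    refine ⟨w, h1, h2.trans (mul_le_mul_of_nonneg_right hab ?_)⟩
    exact mul_nonneg (K.height_pos i).le (intF_nonneg K i fun x hx => sq_nonneg _)
  · intro i
    -- Polynomials vanishing on the face make the face form merely semidefinite. On a complement of
    -- its kernel it is definite, hence bounds the cell norm there, and the complement still
    -- realizes all face values. The extension is the complement component of the pulled-back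
    -- polynomial.
    obtain ⟨Y, hY⟩ := Submodule.exists_isCompl (LinearMap.ker (faceForm K₀ i k))
    have hpos : ∀ v : Y, v ≠ 0 → 0 < (faceForm K₀ i k).domRestrict₁₂ Y Y v v := by
      intro v hv
      have hnn : 0 ≤ faceForm K₀ i k v v := by
        simp only [faceForm, LinearMap.mk₂_apply, ← sq]
        exact intF_nonneg K₀ i fun x hx => sq_nonneg _
      refine lt_of_le_of_ne hnn fun h => hv ?_
      have hker : (v : Poly n k) ∈ LinearMap.ker (faceForm K₀ i k) := by
        rw [LinearMap.mem_ker]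
        ext1 q
        exact faceForm_eq_zero K₀ i k h.symm q
      exact Subtype.ext (Submodule.disjoint_def.1 hY.disjoint _ hker v.2)
    obtain ⟨C, hC, h⟩ := exists_quadratic_bound
      ((cellForm K₀ k (fun _ => 1) continuous_const).domRestrict₁₂ Y Y)
      ((K₀.height i • faceForm K₀ i k).domRestrict₁₂ Y Y) fun v hv =>
        mul_pos (K₀.height_pos i) (hpos v hv)
    refine ⟨C, hC, fun K e => ?_⟩
    obtain ⟨J, hJ, hK, hF⟩ := exists_scaling K₀ K
    obtain ⟨q, hq⟩ := exists_val_comp_affine e (simplexMap K₀ K)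
    obtain ⟨m, y, hm, hy, hmy⟩ := Submodule.codisjoint_iff_exists_add_eq.1 hY.codisjoint q
    obtain ⟨w, hw⟩ := exists_val_comp_affine y (simplexMap K K₀)
    have hw' : ∀ x, val w.1 (simplexMap K₀ K x) = val y.1 x := fun x => by
      rw [hw, simplexMap_simplexMap]
    have hm0 : ∀ p, faceForm K₀ i k m p = 0 := fun p => by
      rw [LinearMap.mem_ker.1 hm, LinearMap.zero_apply]
    have h1 : faceForm K₀ i k q y = faceForm K₀ i k y y := by
      rw [← hmy, map_add, LinearMap.add_apply, hm0, zero_add]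
    have h2 : faceForm K₀ i k q q = faceForm K₀ i k y y := by
      have : faceForm K₀ i k q q = faceForm K₀ i k m q + faceForm K₀ i k y q := by
        rw [← LinearMap.add_apply, ← map_add, hmy]
      rw [this, hm0, zero_add, faceForm_comm, h1]
    refine ⟨w, ?_, ?_⟩
    · have h3 := h1.trans h2.symm
      simp only [faceForm, LinearMap.mk₂_apply, ← sq, hq] at h3
      refine mul_left_cancel₀ (K.height_pos i).ne' ?_
      rw [hF i _ ((contDiff_val e.1).pow 2), hF i _ ((contDiff_val e.1).mul (contDiff_val w.1))]
      simp only [hw', h3]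
    · have h3 : cellForm K₀ k (fun _ => 1) continuous_const y y ≤
          C * (K₀.height i * faceForm K₀ i k y y) := h ⟨y, hy⟩
      rw [← h2] at h3
      simp only [cellForm, faceForm, LinearMap.mk₂_apply, one_mul, ← sq, hq] at h3
      rw [hK, hF i _ ((contDiff_val e.1).pow 2), mul_left_comm]
      simp only [hw']
      exact mul_le_mul_of_nonneg_left h3 hJ.le

end ReferenceEstimates

end

section

variable {n : ℕ}

/-! ### Derivatives and jumps controlled from a single face. -/

section LocalEstimates

variable [NeZero n]

/-- The edges emanating from a vertex. -/
abbrev edge (K : Affine.Simplex ℝ (E n) n) (i₀ i : Fin (n + 1)) : E n := K.points i - K.points i₀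

omit [NeZero n] in
lemma val_dirD_radial (K : Affine.Simplex ℝ (E n) n) (i₀ : Fin (n + 1))
    (u : MvPolynomial (Fin n) ℝ) (x : E n) :
    val (dirD (x - K.points i₀) u) x = ∑ j, bary K j x * val (dirD (edge K i₀ j) u) x := by
  rw [← val_dirD_linear, sum_bary_smul_sub]

omit [NeZero n] in
lemma continuous_radial (K : Affine.Simplex ℝ (E n) n) (i₀ : Fin (n + 1))
    (u : MvPolynomial (Fin n) ℝ) : Continuous fun x => val (dirD (x - K.points i₀) u) x := by
  simp only [val_dirD_radial]
  exact continuous_finsetSum _ fun j _ => (continuous_bary K j).mul (continuous_val _)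

-- On the cell the radial vector is a combination of edges with coefficients in `[0, 1]`. Young's
-- inequality is weighted by `1 / (2 (n + 1))` so that the `n + 1` terms add up to half of the
-- squared norm.
omit [NeZero n] in
lemma radial_bound (K : Affine.Simplex ℝ (E n) n) (i₀ : Fin (n + 1)) (u : MvPolynomial (Fin n) ℝ) :
    -(2 * intK K (fun x => val u x * val (dirD (x - K.points i₀) u) x)) ≤
      1 / 2 * intK K (fun x => val u x ^ 2) +
        2 * (n + 1) * ∑ j, intK K (fun x => val (dirD (edge K i₀ j) u) x ^ 2) := by
  have hu := continuous_val u
  have hd : ∀ j, Continuous (val (dirD (edge K i₀ j) u)) := fun j => continuous_val _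
  have hr := continuous_radial K i₀ u
  rw [← intK_sum K Finset.univ (f := fun j x => val (dirD (edge K i₀ j) u) x ^ 2)
    fun j _ => by fun_prop, ← intK_const_mul, ← intK_const_mul, ← intK_const_mul,
    ← intK_add K (by fun_prop) (by fun_prop), ← neg_one_mul, ← intK_const_mul]
  refine intK_mono K (by fun_prop) (by fun_prop) fun x hx => ?_
  rw [val_dirD_radial]
  have hn : (0 : ℝ) < n + 1 := by positivity
  have h : ∀ j, -1 * (2 * (val u x * (bary K j x * val (dirD (edge K i₀ j) u) x))) ≤
      1 / (2 * (n + 1)) * val u x ^ 2 + 2 * (n + 1) * val (dirD (edge K i₀ j) u) x ^ 2 := by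
    intro j
    have h1 := bary_nonneg hx j
    have h2 := bary_le_one hx j
    set a := val u x
    set b := val (dirD (edge K i₀ j) u) x
    set l := bary K j x
    have h3 : 1 / (2 * (n + 1)) * a ^ 2 + 2 * (n + 1) * b ^ 2 + 2 * (a * (l * b)) =
      1 / (2 * (n + 1)) * (a + 2 * (n + 1) * l * b) ^ 2 + 2 * (n + 1) * ((1 - l) * (1 + l)) * b ^ 2 := by
      field_simp; ring
    have h4 : 0 ≤ 1 / (2 * (n + 1)) * (a + 2 * (n + 1) * l * b) ^ 2 +
        2 * (n + 1) * ((1 - l) * (1 + l)) * b ^ 2 := by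
      have : 0 ≤ 1 - l := by linarith
      positivity
    linarith
  calc _ = ∑ j, -1 * (2 * (val u x * (bary K j x * val (dirD (edge K i₀ j) u) x))) := by
        simp only [Finset.mul_sum]
    _ ≤ ∑ j : Fin (n + 1), (1 / (2 * (n + 1)) * val u x ^ 2 +
          2 * (n + 1) * val (dirD (edge K i₀ j) u) x ^ 2) := Finset.sum_le_sum fun j _ => h j
    _ = _ := by
      rw [Finset.sum_add_distrib, Finset.sum_const, ← Finset.mul_sum]
      simp only [Finset.card_univ, Fintype.card_fin, nsmul_eq_mul]
      push_cast
      field_simp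

/-- The radial identity for squares. -/
lemma intK_sq_cone (K : Affine.Simplex ℝ (E n) n) (i₀ : Fin (n + 1)) (u : MvPolynomial (Fin n) ℝ) :
    n * intK K (fun x => val u x ^ 2) +
      2 * intK K (fun x => val u x * val (dirD (x - K.points i₀) u) x) =
      K.height i₀ * intF K i₀ (fun x => val u x ^ 2) := by
  have hu := continuous_val u
  have hr := continuous_radial K i₀ u
  have h := intK_cone_val K i₀ (u * u)
  have h1 : val (u * u) = fun x => val u x ^ 2 := by ext x; rw [val_mul, sq]
  rw [← intK_const_mul, ← intK_const_mul, ← intK_add K (by fun_prop) (by fun_prop), ← h1, ← h]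
  congr 1
  ext x
  rw [dirD_mul, val_add]
  simp only [val_mul]
  ring

/-- A polynomial is bounded by its derivatives and its values on a face. -/
lemma intK_sq_le (K : Affine.Simplex ℝ (E n) n) (i₀ : Fin (n + 1)) (u : MvPolynomial (Fin n) ℝ) :
    intK K (fun x => val u x ^ 2) ≤ 2 * (K.height i₀ * intF K i₀ (fun x => val u x ^ 2)) +
      4 * (n + 1) * ∑ j, intK K (fun x => val (dirD (edge K i₀ j) u) x ^ 2) := by
  have h1 := intK_sq_cone K i₀ u
  have h2 := radial_bound K i₀ u
  -- The radial term absorbs half of the squared norm, and `n ≥ 1` leaves the other half.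
  have h3 : (1 : ℝ) ≤ n := Nat.one_le_cast.2 (NeZero.pos n)
  have h4 : 0 ≤ intK K (fun x => val u x ^ 2) := intK_nonneg K fun x _ => sq_nonneg _
  nlinarith

variable (n)

/-- The constant in the local estimate for gradients and jumps. -/
lemma exists_jump_bound (k : ℕ) : ∃ C : ℝ, 0 < C ∧ ∀ (K : Affine.Simplex ℝ (E n) n)
    (i₀ : Fin (n + 1)) (u : Poly n k) (e : Fin (n + 1) → Poly n k) (A : ℝ),
    (∀ r : Fin n → Poly n k,
      (-intK K (fun x => gradVal u.1 x ⬝ᵥ vecVal r x) +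
        ∑ i, intF K i (fun x => val (e i).1 x * (vecVal r x ⬝ᵥ normal K i))) ^ 2 ≤
        A * intK K (fun x => vecVal r x ⬝ᵥ vecVal r x)) →
    ∀ i, i ≠ i₀ →
      intK K (fun x => val (dirD (edge K i₀ i) u.1) x ^ 2) ≤
        C * (A * diamK K ^ 2 + K.height i₀ * intF K i₀ (fun x => val (e i₀).1 x ^ 2)) ∧
      K.height i * intF K i (fun x => val (e i).1 x ^ 2) ≤
        C * (A * diamK K ^ 2 + K.height i₀ * intF K i₀ (fun x => val (e i₀).1 x ^ 2)) := by
  obtain ⟨C₁, hC₁, H₁⟩ := exists_bary_bound n k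
  obtain ⟨C₂, hC₂, H₂⟩ := exists_trace_bound n k
  obtain ⟨C₃, hC₃, H₃⟩ := exists_extension_bound n k
  refine ⟨C₁ * (2 * (1 + C₂)) + 2 * C₃ * (1 + C₁) * (2 * (1 + C₂)), by positivity,
    fun K i₀ u e A hA i hi => ?_⟩
  set t := edge K i₀ i with ht
  set p : Poly n k := ⟨dirD t u.1, dirD_mem t u⟩ with hp
  set b := K.height i₀ * intF K i₀ (fun x => val (e i₀).1 x ^ 2) with hb
  have hb0 : 0 ≤ b := mul_nonneg (K.height_pos _).le (intF_nonneg K _ fun x _ => sq_nonneg _)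
  have hA0 : 0 ≤ A := by
    -- A constant unit field, tested in the hypothesis, forces `A` to be nonnegative.
    have h := hA fun a => if a = 0 then ⟨1, by simp [MvPolynomial.mem_restrictTotalDegree]⟩ else 0
    refine nonneg_of_mul_nonneg_left ((sq_nonneg _).trans h) (lt_of_lt_of_le (intK_pos K) ?_)
    refine (intK_congr K fun x _ => ?_).le
    rw [dotProduct, Finset.sum_eq_single 0]
    · simp [vecVal, val]
    · intro a _ ha; simp [vecVal, ha]
    · simp
  set G := 2 * (1 + C₂) * (A * diamK K ^ 2 + b) with hG
  have hG0 : 0 ≤ G := by positivity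
  have htn : ‖t‖ ≤ diamK K := norm_sub_le_diamK K (points_mem_cell K _) (points_mem_cell K _)
  -- the functional tested with `w t`
  have key : ∀ w : Poly n k, (-intK K (fun x => val w.1 x * val p.1 x) -
      K.height i * intF K i (fun x => val (e i).1 x * val w.1 x)) ^ 2 ≤
      G * intK K (fun x => val w.1 x ^ 2) := by
    intro w
    have h := hA fun a => t a • w
    have hv : ∀ x, vecVal (fun a => t a • w) x = fun a => val w.1 x * t a := by
      intro x; ext a; simp [vecVal, val_smul, mul_comm]
    have h1 : intK K (fun x => gradVal u.1 x ⬝ᵥ vecVal (fun a => t a • w) x) =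
        intK K (fun x => val w.1 x * val p.1 x) := by
      refine intK_congr K fun x _ => ?_
      rw [hv, hp, val_dirD, dotProduct, Finset.mul_sum]
      exact Finset.sum_congr rfl fun a _ => by ring
    have h2 : intK K (fun x => vecVal (fun a => t a • w) x ⬝ᵥ vecVal (fun a => t a • w) x) =
        ‖t‖ ^ 2 * intK K (fun x => val w.1 x ^ 2) := by
      rw [← intK_const_mul]
      refine intK_congr K fun x _ => ?_
      rw [hv, EuclideanSpace.real_norm_sq_eq, Finset.sum_mul, dotProduct]
      exact Finset.sum_congr rfl fun a _ => by ring
    have h3 : ∑ m, intF K m (fun x => val (e m).1 x * (vecVal (fun a => t a • w) x ⬝ᵥ normal K m)) =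
        -(K.height i * intF K i (fun x => val (e i).1 x * val w.1 x)) +
          K.height i₀ * intF K i₀ (fun x => val (e i₀).1 x * val w.1 x) := by
      have h4 : ∀ m, intF K m
          (fun x => val (e m).1 x * (vecVal (fun a => t a • w) x ⬝ᵥ normal K m)) =
          -(bary K m).linear t * (K.height m * intF K m (fun x => val (e m).1 x * val w.1 x)) := by
        intro m
        rw [← intF_const_mul, ← intF_const_mul]
        congr 1
        ext x
        have : vecVal (fun a => t a • w) x ⬝ᵥ normal K m =
            val w.1 x * ((fun a => t a) ⬝ᵥ normal K m) := by
          rw [hv, dotProduct, dotProduct, Finset.mul_sum]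
          exact Finset.sum_congr rfl fun a _ => by ring
        rw [this, dot_normal]
        ring
      -- The edge joins the vertices `i₀` and `i`, so its direction is tangential to every face
      -- except those two: only one unknown jump survives.
      rw [Finset.sum_congr rfl fun m _ => h4 m]
      simp only [ht, edge, bary_linear_sub, bary_points]
      rw [← Finset.add_sum_erase _ _ (Finset.mem_univ i), ← Finset.add_sum_erase _ _
        (Finset.mem_erase.2 ⟨hi.symm, Finset.mem_univ i₀⟩), Finset.sum_eq_zero]
      · simp [hi, hi.symm]
      · intro m hm
        simp only [Finset.mem_erase] at hm
        simp [hm.1, hm.2.1]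
    rw [h1, h2, h3] at h
    have h5 := sq_intF_mul_le K i₀ (continuous_valP (e i₀)) (continuous_valP w)
    have h6 := H₂ i₀ K w
    set W := intK K (fun x => val w.1 x ^ 2)
    have hW0 : 0 ≤ W := intK_nonneg K fun x _ => sq_nonneg _
    set y := K.height i₀ * intF K i₀ (fun x => val (e i₀).1 x * val w.1 x) with hy
    have h7 : y ^ 2 ≤ b * (C₂ * W) := by
      calc y ^ 2 = K.height i₀ ^ 2 * intF K i₀ (fun x => val (e i₀).1 x * val w.1 x) ^ 2 := by
            rw [hy]; ring
        _ ≤ K.height i₀ ^ 2 * (intF K i₀ (fun x => val (e i₀).1 x ^ 2) *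
              intF K i₀ (fun x => val w.1 x ^ 2)) := by gcongr
        _ = b * (K.height i₀ * intF K i₀ (fun x => val w.1 x ^ 2)) := by rw [hb]; ring
        _ ≤ _ := by gcongr
    have h8 : A * (‖t‖ ^ 2 * W) ≤ A * diamK K ^ 2 * W := by
      rw [mul_assoc]; gcongr
    set a := -intK K (fun x => val w.1 x * val p.1 x) -
      K.height i * intF K i (fun x => val (e i).1 x * val w.1 x) with ha
    have h9 : (a + y) ^ 2 ≤ A * diamK K ^ 2 * W := by
      refine le_trans (le_of_eq ?_) (h.trans h8)
      rw [ha]; ring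
    have h10 : a ^ 2 ≤ 2 * (a + y) ^ 2 + 2 * y ^ 2 := by nlinarith [sq_nonneg (a + 2 * y)]
    have h11 : 0 ≤ A * diamK K ^ 2 * W := by positivity
    have h12 : 0 ≤ C₂ * (A * diamK K ^ 2 * W) := by positivity
    have h13 : 0 ≤ b * W := by positivity
    rw [hG]
    nlinarith
  have hpc := continuous_valP p
  have hbc := continuous_bary K i
  have hP : intK K (fun x => val p.1 x ^ 2) ≤ C₁ * G := by
    -- The factor `bary K i` vanishes on face `i` and removes the unknown jump. What remains is the
    -- weighted norm of the edge derivative, equivalent to the unweighted one.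
    set w : Poly n k := ⟨affPoly (bary K i) * dirD t u.1, affPoly_mul_dirD_mem _ _ _⟩ with hw
    have hwv : ∀ x, val w.1 x = bary K i x * val p.1 x := fun x => by
      rw [hw, val_mul, val_affPoly]
    have h1 : intF K i (fun x => val (e i).1 x * val w.1 x) = 0 := by
      rw [← zero_mul (intF K i fun _ => 0), ← intF_const_mul]
      refine intF_congr K i fun x hx => ?_
      rw [face_eq] at hx
      rw [hwv, hx.2]; ring
    have h2 := key w
    rw [h1, mul_zero, sub_zero, neg_sq] at h2
    have h3 : intK K (fun x => val w.1 x * val p.1 x) =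
        intK K (fun x => bary K i x * val p.1 x ^ 2) :=
      intK_congr K fun x _ => by rw [hwv]; ring
    have h4 : intK K (fun x => val w.1 x ^ 2) ≤ intK K (fun x => bary K i x * val p.1 x ^ 2) := by
      refine intK_mono K ((continuous_valP w).pow 2) (by fun_prop) fun x hx => ?_
      rw [hwv, mul_pow]
      refine mul_le_mul_of_nonneg_right ?_ (sq_nonneg _)
      have := bary_nonneg hx i
      have := bary_le_one hx i
      nlinarith
    rw [h3] at h2
    set Z := intK K (fun x => bary K i x * val p.1 x ^ 2)
    have hZ0 : 0 ≤ Z := intK_nonneg K fun x hx => mul_nonneg (bary_nonneg hx i) (sq_nonneg _)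
    have h5 : Z ≤ G := by
      rcases hZ0.eq_or_lt with h | h
      · rw [← h]; exact hG0
      · have := h2.trans (mul_le_mul_of_nonneg_left h4 hG0)
        rw [sq] at this
        exact le_of_mul_le_mul_right this h
    exact (H₁ i K p).trans (mul_le_mul_of_nonneg_left h5 hC₁.le)
  have hX : K.height i * intF K i (fun x => val (e i).1 x ^ 2) ≤ 2 * C₃ * (1 + C₁) * G := by
    -- Once the derivative is bounded, a stable extension of the jump as test function isolates the
    -- jump on face `i`.
    obtain ⟨w, hw1, hw2⟩ := H₃ i K (e i)
    have h1 := key w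
    rw [hw1] at h1
    have h2 := sq_intK_mul_le K (continuous_valP w) hpc
    set X := K.height i * intF K i (fun x => val (e i).1 x ^ 2)
    have hX0 : 0 ≤ X := mul_nonneg (K.height_pos _).le (intF_nonneg K _ fun x _ => sq_nonneg _)
    set W := intK K (fun x => val w.1 x ^ 2)
    have hW0 : 0 ≤ W := intK_nonneg K fun x _ => sq_nonneg _
    set z := intK K (fun x => val w.1 x * val p.1 x)
    have h3 : z ^ 2 ≤ C₃ * X * (C₁ * G) :=
      h2.trans (mul_le_mul hw2 hP (intK_nonneg K fun x _ => sq_nonneg _) (by positivity))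
    have h4 : (-z - X) ^ 2 ≤ G * (C₃ * X) := h1.trans (mul_le_mul_of_nonneg_left hw2 hG0)
    rcases hX0.eq_or_lt with h | h
    · rw [← h]; positivity
    · have h5 : X * X ≤ (2 * C₃ * (1 + C₁) * G) * X := by nlinarith [sq_nonneg (X + 2 * z)]
      exact le_of_mul_le_mul_right h5 h
  have hC₀ : 0 ≤ C₁ * G := by positivity
  have hC₀' : 0 ≤ 2 * C₃ * (1 + C₁) * G := by positivity
  have hsum : (C₁ * (2 * (1 + C₂)) + 2 * C₃ * (1 + C₁) * (2 * (1 + C₂))) *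
      (A * diamK K ^ 2 + b) = C₁ * G + 2 * C₃ * (1 + C₁) * G := by rw [hG]; ring
  rw [hsum]
  exact ⟨hP.trans (by linarith), hX.trans (by linarith)⟩

end LocalEstimates

end

section

variable {n : ℕ}

/-! ### The weighted form of the coefficient. -/

section Coefficient

variable {Ω : Set (E n)} {α : E n → Matrix (Fin n) (Fin n) ℝ}

lemma aemeasurable_det {X : Type*} [MeasurableSpace X] {μ : Measure X} {m : ℕ}
    {B : X → Matrix (Fin m) (Fin m) ℝ} (hB : ∀ a b, AEMeasurable (fun x => B x a b) μ) :
    AEMeasurable (fun x => (B x).det) μ := by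
  simp only [Matrix.det_apply]
  refine Finset.aemeasurable_fun_sum _ fun σ _ => AEMeasurable.const_smul ?_ _
  exact Finset.aemeasurable_fun_prod _ fun a _ => hB _ _

/-- By Cramer's rule the entries of the inverse are quotients of determinants in the given entries.
-/
lemma aemeasurable_inv {X : Type*} [MeasurableSpace X] {μ : Measure X} {m : ℕ}
    {B : X → Matrix (Fin m) (Fin m) ℝ} (hB : ∀ a b, AEMeasurable (fun x => B x a b) μ)
    (a b : Fin m) : AEMeasurable (fun x => (B x)⁻¹ a b) μ := by
  simp only [Matrix.inv_def, Matrix.smul_apply, smul_eq_mul, Matrix.adjugate_apply,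
    Ring.inverse_eq_inv]
  refine (aemeasurable_det hB).inv.mul (aemeasurable_det fun c d => ?_)
  by_cases h : c = b
  · subst h
    simp only [Matrix.updateRow_self]
    exact aemeasurable_const
  · simp only [Matrix.updateRow_ne h]
    exact hB c d

variable {K : Affine.Simplex ℝ (E n) n}

/-- Convex sets have null frontier. This matters because a mesh only places the open cells inside
`Ω`, where the coefficient is controlled. -/
lemma interior_ae_eq_cell (K : Affine.Simplex ℝ (E n) n) :
    (interior (cell K) : Set (E n)) =ᵐ[volume] cell K :=
  interior_ae_eq_of_null_frontier ((convex_cell K).addHaar_frontier volume)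

lemma restrict_interior_cell (K : Affine.Simplex ℝ (E n) n) :
    volume.restrict (interior (cell K)) = volume.restrict (cell K) :=
  Measure.restrict_congr_set (interior_ae_eq_cell K)

lemma ae_mem_interior (K : Affine.Simplex ℝ (E n) n) :
    ∀ᵐ x ∂(volume.restrict (cell K)), x ∈ interior (cell K) := by
  rw [← restrict_interior_cell]
  exact ae_restrict_mem isOpen_interior.measurableSet

lemma aemeasurable_coeff (hα : IsCoefficient Ω α) (hK : interior (cell K) ⊆ Ω) (a b : Fin n) :
    AEMeasurable (fun x => (α x)⁻¹ a b) (volume.restrict (cell K)) := by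
  refine aemeasurable_inv (fun c d => ?_) a b
  rw [← restrict_interior_cell]
  exact (hα.measurable c d).mono_measure (Measure.restrict_mono hK le_rfl)

/-- A bound for the entries of the coefficient. -/
def coeffBound (hα : IsCoefficient Ω α) : ℝ := |hα.bounded.choose|

lemma abs_inv_le (hα : IsCoefficient Ω α) {x : E n} (hx : x ∈ Ω) (a b : Fin n) :
    |(α x)⁻¹ a b| ≤ coeffBound hα :=
  (hα.bounded.choose_spec x hx a b).2.trans (le_abs_self _)

lemma integrable_coeff_mul (hα : IsCoefficient Ω α) (hK : interior (cell K) ⊆ Ω) {g : E n → ℝ}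
    (hg : Continuous g) (a b : Fin n) :
    Integrable (fun x => (α x)⁻¹ a b * g x) (volume.restrict (cell K)) := by
  refine (integrableOn_cell K hg).bdd_mul (c := coeffBound hα)
    (aemeasurable_coeff hα hK a b).aestronglyMeasurable ?_
  filter_upwards [ae_mem_interior K] with x hx
  exact abs_inv_le hα (hK hx) a b

lemma cForm_integrand_eq {k : ℕ} (q r : Fin n → Poly n k) (x : E n) :
    ((α x)⁻¹ *ᵥ vecVal q x) ⬝ᵥ vecVal r x =
      ∑ a, ∑ b, (α x)⁻¹ a b * (val (q b).1 x * val (r a).1 x) := by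
  simp only [dotProduct, Matrix.mulVec, vecVal, Finset.sum_mul]
  exact Finset.sum_congr rfl fun a _ => Finset.sum_congr rfl fun b _ => by ring

lemma integrable_cForm (hα : IsCoefficient Ω α) (hK : interior (cell K) ⊆ Ω) {k : ℕ}
    (q r : Fin n → Poly n k) :
    Integrable (fun x => ((α x)⁻¹ *ᵥ vecVal q x) ⬝ᵥ vecVal r x) (volume.restrict (cell K)) := by
  simp only [cForm_integrand_eq]
  refine integrable_finsetSum _ fun a _ => integrable_finsetSum _ fun b _ =>
    integrable_coeff_mul hα hK ?_ a b
  exact (continuous_valP _).mul (continuous_valP _)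

lemma vecVal_add {k : ℕ} (q r : Fin n → Poly n k) (x : E n) :
    vecVal (q + r) x = vecVal q x + vecVal r x := by
  ext a; simp [vecVal, val_add]

lemma vecVal_smul {k : ℕ} (a : ℝ) (q : Fin n → Poly n k) (x : E n) :
    vecVal (a • q) x = a • vecVal q x := by
  ext b; simp [vecVal, val_smul]

/-- The weighted `L²` form `(c q, r)_K` as a bilinear form. -/
def cBil (hα : IsCoefficient Ω α) (hK : interior (cell K) ⊆ Ω) (k : ℕ) :
    (Fin n → Poly n k) →ₗ[ℝ] (Fin n → Poly n k) →ₗ[ℝ] ℝ :=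
  LinearMap.mk₂ ℝ (cForm α K)
    (fun q q' r => by
      rw [cForm, cForm, cForm, intK, intK, intK,
        ← integral_add (integrable_cForm hα hK _ _) (integrable_cForm hα hK _ _)]
      simp only [vecVal_add, Matrix.mulVec_add, add_dotProduct])
    (fun a q r => by
      rw [cForm, cForm, smul_eq_mul, ← intK_const_mul]
      simp only [vecVal_smul, Matrix.mulVec_smul, smul_dotProduct, smul_eq_mul])
    (fun q r r' => by
      rw [cForm, cForm, cForm, intK, intK, intK,
        ← integral_add (integrable_cForm hα hK _ _) (integrable_cForm hα hK _ _)]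
      simp only [vecVal_add, dotProduct_add])
    (fun a q r => by
      rw [cForm, cForm, smul_eq_mul, ← intK_const_mul]
      simp only [vecVal_smul, dotProduct_smul, smul_eq_mul])

lemma cBil_apply (hα : IsCoefficient Ω α) (hK : interior (cell K) ⊆ Ω) {k : ℕ}
    (q r : Fin n → Poly n k) : cBil hα hK k q r = cForm α K q r := rfl

lemma cForm_comm (hα : IsCoefficient Ω α) (hK : interior (cell K) ⊆ Ω) {k : ℕ}
    (q r : Fin n → Poly n k) : cForm α K q r = cForm α K r q := by
  refine integral_congr_ae ?_
  filter_upwards [ae_mem_interior K] with x hx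
  have h : ((α x)⁻¹)ᵀ = (α x)⁻¹ := by
    have := (hα.posDef x (hK hx)).inv.isHermitian
    rwa [Matrix.IsHermitian, Matrix.conjTranspose_eq_transpose_of_trivial] at this
  rw [dotProduct_comm, Matrix.dotProduct_mulVec, ← Matrix.mulVec_transpose, h]

lemma cForm_integrand_nonneg (hα : IsCoefficient Ω α) {x : E n} (hx : x ∈ Ω) (v : Fin n → ℝ) :
    0 ≤ ((α x)⁻¹ *ᵥ v) ⬝ᵥ v := by
  have := (hα.posDef x hx).inv.posSemidef.dotProduct_mulVec_nonneg v
  rw [dotProduct_comm]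
  simpa using this

lemma cForm_nonneg (hα : IsCoefficient Ω α) (hK : interior (cell K) ⊆ Ω) {k : ℕ}
    (q : Fin n → Poly n k) : 0 ≤ cForm α K q q := by
  refine integral_nonneg_of_ae ?_
  filter_upwards [ae_mem_interior K] with x hx using cForm_integrand_nonneg hα (hK hx) _

lemma vec_eq_zero_of_ae {k : ℕ} {q : Fin n → Poly n k}
    (h : ∀ᵐ x ∂(volume.restrict (cell K)), vecVal q x = 0) : q = 0 := by
  ext1 a
  refine Subtype.ext (eq_zero_of_val_eq_zero K ?_)
  have h1 : val (q a).1 =ᵐ[volume.restrict (interior (cell K))] fun _ => 0 := by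
    rw [restrict_interior_cell]
    filter_upwards [h] with x hx using congrFun hx a
  exact Measure.eqOn_open_of_ae_eq h1 isOpen_interior (continuous_val _).continuousOn
    continuousOn_const

lemma eq_zero_of_cForm_eq_zero (hα : IsCoefficient Ω α) (hK : interior (cell K) ⊆ Ω) {k : ℕ}
    {q : Fin n → Poly n k} (h : cForm α K q q = 0) : q = 0 := by
  have hnn : 0 ≤ᵐ[volume.restrict (cell K)] fun x => ((α x)⁻¹ *ᵥ vecVal q x) ⬝ᵥ vecVal q x := by
    filter_upwards [ae_mem_interior K] with x hx using cForm_integrand_nonneg hα (hK hx) _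
  have h1 := (integral_eq_zero_iff_of_nonneg_ae hnn (integrable_cForm hα hK q q)).1 h
  refine vec_eq_zero_of_ae (K := K) ?_
  filter_upwards [ae_mem_interior K, h1] with x hx hx1
  by_contra hne
  have := (hα.posDef x (hK hx)).inv.dotProduct_mulVec_pos hne
  rw [dotProduct_comm] at this
  simp only [star_trivial, Pi.zero_apply] at this hx1
  exact this.ne' hx1

lemma cForm_self_le (hα : IsCoefficient Ω α) (hK : interior (cell K) ⊆ Ω) {k : ℕ}
    (r : Fin n → Poly n k) :
    cForm α K r r ≤ n * coeffBound hα * intK K (fun x => vecVal r x ⬝ᵥ vecVal r x) := by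
  rw [← intK_const_mul]
  have hc : Continuous fun x => vecVal r x ⬝ᵥ vecVal r x := by
    have : ∀ a, Continuous (val (r a).1) := fun a => continuous_valP _
    simp only [dotProduct, vecVal]; fun_prop
  refine integral_mono_ae (integrable_cForm hα hK r r)
    (integrableOn_cell K (continuous_const.mul hc)) ?_
  filter_upwards [ae_mem_interior K] with x hx
  rw [cForm_integrand_eq]
  have hb : 0 ≤ coeffBound hα := abs_nonneg _
  calc ∑ a, ∑ b, (α x)⁻¹ a b * (val (r b).1 x * val (r a).1 x)
      ≤ ∑ a : Fin n, ∑ b : Fin n, coeffBound hα * ((val (r b).1 x ^ 2 + val (r a).1 x ^ 2) / 2) := by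
        refine Finset.sum_le_sum fun a _ => Finset.sum_le_sum fun b _ => ?_
        refine (le_abs_self _).trans ?_
        rw [abs_mul]
        refine mul_le_mul (abs_inv_le hα (hK hx) a b) ?_ (abs_nonneg _) hb
        rw [abs_le]
        constructor <;> nlinarith [sq_nonneg (val (r b).1 x - val (r a).1 x),
          sq_nonneg (val (r b).1 x + val (r a).1 x)]
    _ = n * coeffBound hα * (vecVal r x ⬝ᵥ vecVal r x) := by
        simp only [← Finset.mul_sum, ← Finset.sum_div, Finset.sum_add_distrib, Finset.sum_const,
          Finset.card_univ, Fintype.card_fin, nsmul_eq_mul, dotProduct, vecVal, ← sq]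
        ring

/-- The Cauchy–Schwarz inequality for symmetric positive semidefinite forms. -/
lemma sq_bilin_le {V : Type*} [AddCommGroup V] [Module ℝ V] (B : V →ₗ[ℝ] V →ₗ[ℝ] ℝ)
    (hs : ∀ v w, B v w = B w v) (hp : ∀ v, 0 ≤ B v v) (v w : V) :
    B v w ^ 2 ≤ B v v * B w w := by
  have key : ∀ t : ℝ, 0 ≤ B w w * (t * t) + (2 * B v w) * t + B v v := by
    intro t
    have h := hp (v + t • w)
    simp only [map_add, map_smul, LinearMap.add_apply, LinearMap.smul_apply, smul_eq_mul, hs w v] at h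
    linarith
  have := discrim_le_zero key
  rw [discrim] at this
  nlinarith

/-- Only the test field passes to the unweighted norm, so the constant `A` of `exists_jump_bound`
becomes a multiple of the weighted energy of `q`. -/
lemma sq_cForm_le (hα : IsCoefficient Ω α) (hK : interior (cell K) ⊆ Ω) {k : ℕ}
    (q r : Fin n → Poly n k) :
    cForm α K q r ^ 2 ≤ n * coeffBound hα * cForm α K q q *
      intK K (fun x => vecVal r x ⬝ᵥ vecVal r x) := by
  refine (sq_bilin_le (cBil hα hK k) (cForm_comm hα hK) (cForm_nonneg hα hK) q r).trans ?_
  calc _ ≤ cForm α K q q * (n * coeffBound hα * intK K (fun x => vecVal r x ⬝ᵥ vecVal r x)) :=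
        mul_le_mul_of_nonneg_left (cForm_self_le hα hK r) (cForm_nonneg hα hK q)
    _ = _ := by ring

end Coefficient

end

section

variable {n : ℕ}

/-! ### The local problem: energy estimates and unique solvability. -/

section LocalProblem

variable {Ω : Set (E n)} {α : E n → Matrix (Fin n) (Fin n) ℝ} {K : Affine.Simplex ℝ (E n) n} {k : ℕ}

/-- The integral over a cell as a functional on polynomials. -/
def cellInt (K : Affine.Simplex ℝ (E n) n) : MvPolynomial (Fin n) ℝ →ₗ[ℝ] ℝ where
  toFun p := intK K (val p)
  map_add' p q := by
    rw [← intK_add K (continuous_val p) (continuous_val q)]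
    congr 1; ext x; exact val_add p q x
  map_smul' a p := by
    rw [RingHom.id_apply, smul_eq_mul, ← intK_const_mul]
    congr 1; ext x; exact val_smul a p x

/-- The divergence of a polynomial vector field as a polynomial. -/
def divPoly : (Fin n → Poly n k) →ₗ[ℝ] MvPolynomial (Fin n) ℝ where
  toFun r := ∑ a, MvPolynomial.pderiv a (r a).1
  map_add' r r' := by simp [Finset.sum_add_distrib]
  map_smul' a r := by simp [Finset.smul_sum]

lemma val_divPoly (r : Fin n → Poly n k) (x : E n) : val (divPoly r) x = divVal r x := by
  simp [divPoly, val_sum, divVal]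

variable [NeZero n]

/-- The integral over a face as a functional on polynomials. -/
def faceInt (K : Affine.Simplex ℝ (E n) n) (i : Fin (n + 1)) : MvPolynomial (Fin n) ℝ →ₗ[ℝ] ℝ where
  toFun p := intF K i (val p)
  map_add' p q := by
    rw [← intF_add K i (continuous_val p) (continuous_val q)]
    congr 1; ext x; exact val_add p q x
  map_smul' a p := by
    rw [RingHom.id_apply, smul_eq_mul, ← intF_const_mul]
    congr 1; ext x; exact val_smul a p x

/-- The normal component of a polynomial vector field on a face as a polynomial. -/
def normalPoly (K : Affine.Simplex ℝ (E n) n) (i : Fin (n + 1)) :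
    (Fin n → Poly n k) →ₗ[ℝ] MvPolynomial (Fin n) ℝ where
  toFun r := ∑ a, normal K i a • (r a).1
  map_add' r r' := by simp [Finset.sum_add_distrib]
  map_smul' a r := by
    simp only [Pi.smul_apply, Submodule.coe_smul, RingHom.id_apply, Finset.smul_sum]
    exact Finset.sum_congr rfl fun b _ => smul_comm _ _ _

lemma val_normalPoly (i : Fin (n + 1)) (r : Fin n → Poly n k) (x : E n) :
    val (normalPoly K i r) x = vecVal r x ⬝ᵥ normal K i := by
  simp [normalPoly, val_sum, val_smul, dotProduct, vecVal, mul_comm]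

/-- Functions on the faces of a cell agree there with polynomials. -/
def IsTrace (K : Affine.Simplex ℝ (E n) n) (g : Fin (n + 1) → E n → ℝ)
    (p : Fin (n + 1) → Poly n k) : Prop := ∀ i, ∀ x ∈ face K i, g i x = val (p i).1 x

omit [NeZero n] in
lemma isTrace_zero : IsTrace (k := k) K 0 0 := fun i x _ => by simp

omit [NeZero n] in
lemma IsTrace.add {g g' : Fin (n + 1) → E n → ℝ} {p p' : Fin (n + 1) → Poly n k}
    (h : IsTrace K g p) (h' : IsTrace K g' p') : IsTrace K (g + g') (p + p') := fun i x hx => by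
  simp [h i x hx, h' i x hx, val_add]

omit [NeZero n] in
lemma IsTrace.smul {g : Fin (n + 1) → E n → ℝ} {p : Fin (n + 1) → Poly n k}
    (h : IsTrace K g p) (a : ℝ) : IsTrace K (a • g) (a • p) := fun i x hx => by
  simp [h i x hx, val_smul]

/-- The bilinear form of the local problem. -/
def localForm (hα : IsCoefficient Ω α) (hK : interior (cell K) ⊆ Ω) (k : ℕ) (t : Fin (n + 1) → ℝ) :
    ((Fin n → Poly n k) × Poly n k) →ₗ[ℝ] ((Fin n → Poly n k) × Poly n k) →ₗ[ℝ] ℝ :=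
  LinearMap.mk₂ ℝ (fun s z => cBil hα hK k s.1 z.1 - cellInt K (s.2.1 * divPoly z.1) +
      cellInt K (z.2.1 * divPoly s.1) + ∑ i, t i * faceInt K i (s.2.1 * z.2.1))
    (fun s s' z => by
      simp only [Prod.fst_add, Prod.snd_add, map_add, LinearMap.add_apply, Submodule.coe_add,
        add_mul, mul_add, Finset.sum_add_distrib]
      ring)
    (fun a s z => by
      simp only [Prod.smul_fst, Prod.smul_snd, map_smul, LinearMap.smul_apply, Submodule.coe_smul,
        smul_mul_assoc, mul_smul_comm, smul_eq_mul, mul_add, mul_sub, Finset.mul_sum]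
      congr 1
      exact Finset.sum_congr rfl fun i _ => by ring)
    (fun s z z' => by
      simp only [Prod.fst_add, Prod.snd_add, map_add, Submodule.coe_add,
        add_mul, mul_add, Finset.sum_add_distrib]
      ring)
    (fun a s z => by
      simp only [Prod.smul_fst, Prod.smul_snd, map_smul, Submodule.coe_smul,
        smul_mul_assoc, mul_smul_comm, smul_eq_mul, mul_add, mul_sub, Finset.mul_sum]
      congr 1
      exact Finset.sum_congr rfl fun i _ => by ring)

/-- The right-hand side of the local problem for polynomial data. -/
def localData (K : Affine.Simplex ℝ (E n) n) (k : ℕ) (t : Fin (n + 1) → ℝ) :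
    ((Fin (n + 1) → Poly n k) × Poly n k) →ₗ[ℝ] ((Fin n → Poly n k) × Poly n k) →ₗ[ℝ] ℝ :=
  LinearMap.mk₂ ℝ (fun d z => -(∑ i, faceInt K i ((d.1 i).1 * normalPoly K i z.1)) +
      cellInt K (d.2.1 * z.2.1) + ∑ i, t i * faceInt K i ((d.1 i).1 * z.2.1))
    (fun s s' z => by
      simp only [Prod.fst_add, Prod.snd_add, map_add, Submodule.coe_add, Pi.add_apply,
        add_mul, mul_add, Finset.sum_add_distrib]
      ring)
    (fun a s z => by
      simp only [Prod.smul_fst, Prod.smul_snd, map_smul, Submodule.coe_smul, Pi.smul_apply,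
        smul_mul_assoc, smul_eq_mul, mul_add, mul_neg, Finset.mul_sum]
      congr 1
      exact Finset.sum_congr rfl fun i _ => by ring)
    (fun s z z' => by
      simp only [Prod.fst_add, Prod.snd_add, map_add, Submodule.coe_add,
        mul_add, Finset.sum_add_distrib]
      ring)
    (fun a s z => by
      simp only [Prod.smul_fst, Prod.smul_snd, map_smul, Submodule.coe_smul,
        mul_smul_comm, smul_eq_mul, mul_add, mul_neg, Finset.mul_sum]
      congr 1
      exact Finset.sum_congr rfl fun i _ => by ring)

omit [NeZero n] in
lemma cellInt_mul (p q : MvPolynomial (Fin n) ℝ) :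
    cellInt K (p * q) = intK K (fun x => val p x * val q x) := by
  simp only [cellInt, LinearMap.coe_mk, AddHom.coe_mk, ← val_mul]

lemma faceInt_mul (i : Fin (n + 1)) (p q : MvPolynomial (Fin n) ℝ) :
    faceInt K i (p * q) = intF K i (fun x => val p x * val q x) := by
  simp only [faceInt, LinearMap.coe_mk, AddHom.coe_mk, ← val_mul]

/-- Adding the two equations loses nothing, as the test pairs `(r, 0)` and `(0, w)` separate them
again. The local problem thus becomes one square linear system. -/
lemma isLocalSolution_iff (hα : IsCoefficient Ω α) (hK : interior (cell K) ⊆ Ω)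
    {t : Fin (n + 1) → ℝ} {g : Fin (n + 1) → E n → ℝ} {p : Fin (n + 1) → Poly n k}
    (hg : IsTrace K g p) (f : Poly n k) (s : (Fin n → Poly n k) × Poly n k) :
    IsLocalSolution α K t g (val f.1) s ↔ localForm hα hK k t s = localData K k t (p, f) := by
  have h1 : ∀ r : Fin n → Poly n k, ∀ i, intF K i (fun x => g i x * (vecVal r x ⬝ᵥ normal K i)) =
      faceInt K i ((p i).1 * normalPoly K i r) := by
    intro r i
    rw [faceInt_mul]
    exact intF_congr K i fun x hx => by rw [hg i x hx, val_normalPoly]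
  have h2 : ∀ w : Poly n k, ∀ i, intF K i (fun x => t i * (val s.2.1 x - g i x) * val w.1 x) =
      t i * faceInt K i (s.2.1 * w.1) - t i * faceInt K i ((p i).1 * w.1) := by
    intro w i
    rw [← mul_sub, ← map_sub, ← sub_mul, faceInt_mul, ← intF_const_mul]
    exact intF_congr K i fun x hx => by rw [hg i x hx, val_sub]; ring
  simp only [IsLocalSolution, h1, h2, ← val_divPoly, ← cellInt_mul, Finset.sum_sub_distrib]
  constructor
  · rintro ⟨e1, e2⟩
    refine LinearMap.ext fun z => ?_
    have a1 := e1 z.1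
    have a2 := e2 z.2
    simp only [localForm, localData, LinearMap.mk₂_apply, cBil_apply]
    linarith
  · intro h
    constructor
    · intro r
      have := LinearMap.congr_fun h (r, 0)
      simpa [localForm, localData, cBil_apply] using this
    · intro w
      have := LinearMap.congr_fun h (0, w)
      simp only [localForm, localData, LinearMap.mk₂_apply, map_zero, mul_zero, sub_zero,
        Finset.sum_const_zero, neg_zero, zero_add] at this
      linarith

/-- The square of `dConst` dominates both weights that occur: one, in front of the flux energy, and
`1 / (τ_max h)`, in front of the jump on the face of maximal penalty. -/
lemma dConst_sq_ge {t : Fin (n + 1) → ℝ} (ht : 0 < tauMax t) :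
    1 ≤ dConst K t ^ 2 ∧ (tauMax t * diamK K)⁻¹ ≤ dConst K t ^ 2 := by
  have hy : 0 < tauMax t * diamK K := mul_pos ht (diamK_pos K)
  have h0 : 0 ≤ (tauMax t * diamK K) ^ (-(1 / 2) : ℝ) := by positivity
  have h1 : ((tauMax t * diamK K) ^ (-(1 / 2) : ℝ)) ^ 2 = (tauMax t * diamK K)⁻¹ := by
    rw [← Real.rpow_natCast, ← Real.rpow_mul hy.le, ← Real.rpow_neg_one]
    norm_num
  rw [dConst, ← h1]
  constructor <;> nlinarith

omit [NeZero n] in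
lemma le_tauMax (t : Fin (n + 1) → ℝ) (i : Fin (n + 1)) : t i ≤ tauMax t :=
  Classical.choose_spec (Finite.exists_max t) i

/-- The local energy. -/
def energy (α : E n → Matrix (Fin n) (Fin n) ℝ) (K : Affine.Simplex ℝ (E n) n)
    (t : Fin (n + 1) → ℝ) (q : Fin n → Poly n k) (e : Fin (n + 1) → Poly n k) : ℝ :=
  cForm α K q q + ∑ i, t i * intF K i (fun x => val (e i).1 x ^ 2)

omit [NeZero n] in
lemma energy_ge (hα : IsCoefficient Ω α) (hK : interior (cell K) ⊆ Ω) {t : Fin (n + 1) → ℝ}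
    (ht : ∀ i, 0 ≤ t i) (q : Fin n → Poly n k) (e : Fin (n + 1) → Poly n k) :
    0 ≤ cForm α K q q ∧ cForm α K q q ≤ energy α K t q e ∧
      ∀ i, t i * intF K i (fun x => val (e i).1 x ^ 2) ≤ energy α K t q e := by
  have h1 := cForm_nonneg hα hK q
  have h2 : ∀ i, 0 ≤ t i * intF K i (fun x => val (e i).1 x ^ 2) := fun i =>
    mul_nonneg (ht i) (intF_nonneg K i fun x _ => sq_nonneg _)
  have h3 := Finset.sum_nonneg fun i (_ : i ∈ Finset.univ) => h2 i
  refine ⟨h1, by rw [energy]; linarith, fun i => ?_⟩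
  have := Finset.single_le_sum (fun i _ => h2 i) (Finset.mem_univ i)
  rw [energy]; linarith

/-- The first equation of the local problem, integrated by parts; `e` is the jump `u - μ`. -/
def FluxRelation (α : E n → Matrix (Fin n) (Fin n) ℝ) (K : Affine.Simplex ℝ (E n) n)
    (q : Fin n → Poly n k) (u : Poly n k) (e : Fin (n + 1) → Poly n k) : Prop :=
  ∀ r : Fin n → Poly n k, cForm α K q r = -intK K (fun x => gradVal u.1 x ⬝ᵥ vecVal r x) +
    ∑ i, intF K i (fun x => val (e i).1 x * (vecVal r x ⬝ᵥ normal K i))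

lemma fluxRelation_of_eq {q : Fin n → Poly n k} {u : Poly n k} {g : Fin (n + 1) → E n → ℝ}
    {p : Fin (n + 1) → Poly n k} (hg : IsTrace K g p)
    (h : ∀ r : Fin n → Poly n k, cForm α K q r - intK K (fun x => val u.1 x * divVal r x) =
      -∑ i, intF K i (fun x => g i x * (vecVal r x ⬝ᵥ normal K i))) :
    FluxRelation α K q u (fun i => u - p i) := by
  intro r
  have h1 := h r
  rw [green] at h1
  have h2 : ∀ i, intF K i (fun x => val (u - p i).1 x * (vecVal r x ⬝ᵥ normal K i)) =
      intF K i (fun x => val u.1 x * (vecVal r x ⬝ᵥ normal K i)) -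
        intF K i (fun x => g i x * (vecVal r x ⬝ᵥ normal K i)) := by
    intro i
    have h3 : intF K i (fun x => g i x * (vecVal r x ⬝ᵥ normal K i)) =
        intF K i (fun x => val (p i).1 x * (vecVal r x ⬝ᵥ normal K i)) :=
      intF_congr K i fun x hx => by rw [hg i x hx]
    have hr : Continuous fun x => vecVal r x ⬝ᵥ normal K i := by
      simp only [← val_normalPoly]; exact continuous_val _
    have hu := continuous_valP u
    have hp := continuous_valP (p i)
    rw [h3, ← intF_sub K i (by fun_prop) (by fun_prop)]
    refine intF_congr K i fun x _ => ?_
    rw [Submodule.coe_sub, val_sub]; ring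
  simp only [h2, Finset.sum_sub_distrib]
  linarith

/-- Gradients and jumps are bounded by the energy. -/
lemma exists_energy_bound (hα : IsCoefficient Ω α) (k : ℕ) : ∃ C : ℝ, 0 < C ∧
    ∀ (K : Affine.Simplex ℝ (E n) n) (t : Fin (n + 1) → ℝ), interior (cell K) ⊆ Ω →
      (∀ i, 0 ≤ t i) → 0 < tauMax t → ∀ (q : Fin n → Poly n k) (u : Poly n k)
      (e : Fin (n + 1) → Poly n k), FluxRelation α K q u e →
      ∀ i, intK K (fun x => val (dirD (edge K (faceMax t) i) u.1) x ^ 2) ≤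
          C * (dConst K t ^ 2 * diamK K ^ 2) * energy α K t q e ∧
        K.height i * intF K i (fun x => val (e i).1 x ^ 2) ≤
          C * (dConst K t ^ 2 * diamK K ^ 2) * energy α K t q e := by
  obtain ⟨C, hC, H⟩ := exists_jump_bound n k
  have hβ : 0 ≤ n * coeffBound hα := mul_nonneg (Nat.cast_nonneg _) (abs_nonneg _)
  refine ⟨C * (n * coeffBound hα + 1) + 1, by positivity, fun K t hK ht htm q u e hR i => ?_⟩
  have hd := diamK_pos K
  obtain ⟨hd1, hd2⟩ := dConst_sq_ge (K := K) htm
  obtain ⟨hq0, hqE, heE⟩ := energy_ge hα hK ht q e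
  set EE := energy α K t q e
  have hE0 : 0 ≤ EE := hq0.trans hqE
  set D := dConst K t ^ 2 * diamK K ^ 2 with hD
  have hD0 : 0 ≤ D := by positivity
  set I := intF K (faceMax t) (fun x => val (e (faceMax t)).1 x ^ 2) with hI
  have hI0 : 0 ≤ I := intF_nonneg K _ fun x _ => sq_nonneg _
  -- The penalty is known to be positive only at its maximum, so this is the one jump that the
  -- energy controls directly. It starts the transfer to the other faces.
  have hmax : K.height (faceMax t) * I ≤ D * EE := by
    have h1 : tauMax t * I ≤ EE := heE (faceMax t)
    calc K.height (faceMax t) * I ≤ diamK K * I :=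
          mul_le_mul_of_nonneg_right (height_le_diamK K _) hI0
      _ = ((tauMax t * diamK K)⁻¹ * diamK K ^ 2) * (tauMax t * I) := by field_simp
      _ ≤ (dConst K t ^ 2 * diamK K ^ 2) * EE :=
          mul_le_mul (mul_le_mul_of_nonneg_right hd2 (by positivity)) h1 (by positivity) hD0
  have hCD : D * EE ≤ (C * (n * coeffBound hα + 1) + 1) * D * EE := by
    have : 0 ≤ C * (n * coeffBound hα + 1) * D * EE := by positivity
    linarith
  by_cases hi : i = faceMax t
  · subst hi
    refine ⟨?_, hmax.trans hCD⟩
    have : ∀ x, val (dirD (edge K (faceMax t) (faceMax t)) u.1) x = 0 := by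
      intro x; rw [val_dirD]; simp [edge]
    simp only [this]
    have h0 : intK K (fun _ => (0 : ℝ) ^ 2) = 0 := by simp [intK]
    rw [h0]; positivity
  · have h := H K (faceMax t) u e (n * coeffBound hα * cForm α K q q) (fun r => by
      rw [← hR r]; exact sq_cForm_le hα hK q r) i hi
    have h2 : C * (n * coeffBound hα * cForm α K q q * diamK K ^ 2 + K.height (faceMax t) * I) ≤
        (C * (n * coeffBound hα + 1) + 1) * D * EE := by
      have h3 : cForm α K q q * diamK K ^ 2 ≤ EE * D := by
        refine mul_le_mul hqE ?_ (by positivity) hE0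
        rw [hD]
        exact le_mul_of_one_le_left (by positivity) hd1
      have h4 : n * coeffBound hα * cForm α K q q * diamK K ^ 2 ≤ n * coeffBound hα * (EE * D) := by
        rw [mul_assoc]; exact mul_le_mul_of_nonneg_left h3 hβ
      calc _ ≤ C * (n * coeffBound hα * (EE * D) + D * EE) :=
            mul_le_mul_of_nonneg_left (add_le_add h4 hmax) hC.le
        _ = C * (n * coeffBound hα + 1) * D * EE := by ring
        _ ≤ _ := by
          have : 0 ≤ D * EE := by positivity
          linarith
    exact ⟨h.1.trans h2, h.2.trans h2⟩

/-- The `L²` bound for solutions of the local problem without boundary data. -/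
lemma exists_source_bound (hα : IsCoefficient Ω α) (k : ℕ) : ∃ C : ℝ, 0 < C ∧
    ∀ (K : Affine.Simplex ℝ (E n) n) (t : Fin (n + 1) → ℝ), interior (cell K) ⊆ Ω →
      (∀ i, 0 ≤ t i) → 0 < tauMax t → ∀ (f : E n → ℝ), MemLp f 2 (volume.restrict (cell K)) →
      ∀ s : (Fin n → Poly n k) × Poly n k, IsLocalSolution α K t 0 f s →
        0 ≤ cForm α K s.1 s.1 ∧ cForm α K s.1 s.1 ≤ intK K (fun x => f x * val s.2.1 x) ∧
        normK K (val s.2.1) ≤ C * dConst K t ^ 2 * diamK K ^ 2 * normK K f := by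
  obtain ⟨C, hC, H⟩ := exists_energy_bound hα k
  refine ⟨2 * C + 4 * (n + 1) * ((n + 1) * C), by positivity,
    fun K t hK ht htm f hf s hs => ?_⟩
  obtain ⟨q, u⟩ := s
  have hR : FluxRelation α K q u (fun _ => u) := by
    have := fluxRelation_of_eq (p := (0 : Fin (n + 1) → Poly n k)) isTrace_zero hs.1
    simpa using this
  -- Testing the local equations with the solution itself cancels the two divergence terms.
  have hE : energy α K t q (fun _ => u) = intK K (fun x => f x * val u.1 x) := by
    have e1 := hs.1 q
    have e2 := hs.2 u
    simp only [Pi.zero_apply, zero_mul, sub_zero] at e1 e2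
    have e3 : ∀ i, intF K i (fun x => t i * val u.1 x * val u.1 x) =
        t i * intF K i (fun x => val u.1 x ^ 2) := by
      intro i; rw [← intF_const_mul]; congr 1; ext x; ring
    have e4 : intF K 0 (fun _ => (0 : ℝ)) = 0 := by simp [intF]
    have e5 : ∀ i, intF K i (fun _ => (0 : ℝ)) = 0 := fun i => by simp [intF]
    simp only [e3, e5, Finset.sum_const_zero, neg_zero] at e1 e2
    rw [energy, ← e2]
    linarith
  obtain ⟨hq0, hqE, -⟩ := energy_ge hα hK ht q (fun _ => u)
  refine ⟨hq0, by rw [← hE]; exact hqE, ?_⟩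
  set D := dConst K t ^ 2 * diamK K ^ 2 with hD
  have hD0 : 0 ≤ D := by positivity
  set EE := energy α K t q (fun _ => u)
  set U := intK K (fun x => val u.1 x ^ 2) with hU
  have hU0 : 0 ≤ U := intK_nonneg K fun x _ => sq_nonneg _
  set FF := intK K (fun x => f x ^ 2) with hFF
  have hF0 : 0 ≤ FF := intK_nonneg K fun x _ => sq_nonneg _
  set C' := 2 * C + 4 * (n + 1) * ((n + 1) * C) with hC'
  have hC'0 : 0 ≤ C' := by positivity
  have h1 : U ≤ C' * D * EE := by
    refine (intK_sq_le K (faceMax t) u.1).trans ?_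
    have h2 := (H K t hK ht htm q u _ hR (faceMax t)).2
    have h3 : ∑ j, intK K (fun x => val (dirD (edge K (faceMax t) j) u.1) x ^ 2) ≤
        (n + 1) * (C * D * EE) := by
      refine (Finset.sum_le_sum fun j _ => (H K t hK ht htm q u _ hR j).1).trans (le_of_eq ?_)
      rw [Finset.sum_const, Finset.card_univ, Fintype.card_fin, nsmul_eq_mul]
      push_cast; rfl
    calc _ ≤ 2 * (C * D * EE) + 4 * (n + 1) * ((n + 1) * (C * D * EE)) :=
          add_le_add (mul_le_mul_of_nonneg_left h2 (by norm_num))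
            (mul_le_mul_of_nonneg_left h3 (by positivity))
      _ = _ := by rw [hC']; ring
  have h4 : EE ^ 2 ≤ FF * U := by
    rw [hE]; exact sq_integral_mul_le hf (memLp_cell K (continuous_valP u))
  have h5 : EE ≤ Real.sqrt FF * Real.sqrt U := by
    rw [← Real.sqrt_mul hF0]; exact Real.le_sqrt_of_sq_le h4
  change Real.sqrt U ≤ C' * dConst K t ^ 2 * diamK K ^ 2 * Real.sqrt FF
  rw [mul_assoc C', ← hD]
  -- The squared norm of `u` is bounded by the energy, and the energy by `‖f‖ ‖u‖`; one factor `‖u‖`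
  -- is divided out.
  rcases hU0.eq_or_lt with h | h
  · rw [← h, Real.sqrt_zero]; positivity
  · refine le_of_mul_le_mul_right ?_ (Real.sqrt_pos.2 h)
    calc Real.sqrt U * Real.sqrt U = U := Real.mul_self_sqrt hU0
      _ ≤ C' * D * EE := h1
      _ ≤ C' * D * (Real.sqrt FF * Real.sqrt U) := mul_le_mul_of_nonneg_left h5 (by positivity)
      _ = _ := by ring

omit [NeZero n] in
lemma intK_sq_eq_zero {u : Poly n k} (h : intK K (fun x => val u.1 x ^ 2) = 0) : u = 0 := by
  refine Subtype.ext (eq_zero_of_val_eq_zero K fun x hx => ?_)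
  have := eq_zero_of_intK_eq_zero K ((continuous_valP u).pow 2) (fun x _ => sq_nonneg _) h x hx
  exact pow_eq_zero_iff two_ne_zero |>.1 this

/-- For zero data the source bound kills the potential, and the energy inequality then kills the
flux. Since a space and its dual have the same dimension, unique solvability follows. -/
lemma localForm_injective (hα : IsCoefficient Ω α) (hK : interior (cell K) ⊆ Ω)
    {t : Fin (n + 1) → ℝ} (ht : ∀ i, 0 ≤ t i) (htm : 0 < tauMax t) :
    Function.Injective (localForm hα hK k t) := by
  rw [← LinearMap.ker_eq_bot, LinearMap.ker_eq_bot']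
  intro s hs
  obtain ⟨C, hC, H⟩ := exists_source_bound hα k
  have h0 : IsLocalSolution α K t 0 (val (0 : Poly n k).1) s := by
    rw [isLocalSolution_iff hα hK isTrace_zero, hs]
    exact (map_zero (localData K k t)).symm
  have hf : (val (0 : Poly n k).1 : E n → ℝ) = fun _ => 0 := by ext x; simp
  rw [hf] at h0
  obtain ⟨h1, h2, h3⟩ := H K t hK ht htm _ MemLp.zero' s h0
  have hz : normK K (fun _ => 0) = 0 := by simp [normK, intK]
  rw [hz, mul_zero] at h3
  have h4 : intK K (fun x => val s.2.1 x ^ 2) = 0 := by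
    have := le_antisymm h3 (Real.sqrt_nonneg _)
    exact (Real.sqrt_eq_zero (intK_nonneg K fun x _ => sq_nonneg _)).1 this
  have h5 : cForm α K s.1 s.1 = 0 := by
    refine le_antisymm (h2.trans (le_of_eq ?_)) h1
    simp [intK]
  exact Prod.ext (eq_zero_of_cForm_eq_zero hα hK h5) (intK_sq_eq_zero h4)

/-- The solution operator of the local problem for polynomial data. -/
def localSolve (hα : IsCoefficient Ω α) (hK : interior (cell K) ⊆ Ω) (k : ℕ)
    {t : Fin (n + 1) → ℝ} (ht : ∀ i, 0 ≤ t i) (htm : 0 < tauMax t) :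
    ((Fin (n + 1) → Poly n k) × Poly n k) →ₗ[ℝ] (Fin n → Poly n k) × Poly n k :=
  (LinearEquiv.ofInjectiveOfFinrankEq (localForm hα hK k t) (localForm_injective hα hK ht htm)
    (Subspace.dual_finrank_eq).symm).symm.toLinearMap ∘ₗ localData K k t

lemma localForm_localSolve (hα : IsCoefficient Ω α) (hK : interior (cell K) ⊆ Ω)
    {t : Fin (n + 1) → ℝ} (ht : ∀ i, 0 ≤ t i) (htm : 0 < tauMax t)
    (d : (Fin (n + 1) → Poly n k) × Poly n k) :
    localForm hα hK k t (localSolve hα hK k ht htm d) = localData K k t d := by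
  have := (LinearEquiv.ofInjectiveOfFinrankEq (localForm hα hK k t)
    (localForm_injective hα hK ht htm) (Subspace.dual_finrank_eq).symm).apply_symm_apply
      (localData K k t d)
  exact this

lemma isLocalSolution_iff_eq (hα : IsCoefficient Ω α) (hK : interior (cell K) ⊆ Ω)
    {t : Fin (n + 1) → ℝ} (ht : ∀ i, 0 ≤ t i) (htm : 0 < tauMax t)
    {g : Fin (n + 1) → E n → ℝ} {p : Fin (n + 1) → Poly n k} (hg : IsTrace K g p) (f : Poly n k)
    (s : (Fin n → Poly n k) × Poly n k) :
    IsLocalSolution α K t g (val f.1) s ↔ s = localSolve hα hK k ht htm (p, f) := by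
  rw [isLocalSolution_iff hα hK hg, ← localForm_localSolve hα hK ht htm,
    (localForm_injective hα hK ht htm).eq_iff]

lemma localSolution_eq (hα : IsCoefficient Ω α) (hK : interior (cell K) ⊆ Ω)
    {t : Fin (n + 1) → ℝ} (ht : ∀ i, 0 ≤ t i) (htm : 0 < tauMax t)
    {g : Fin (n + 1) → E n → ℝ} {p : Fin (n + 1) → Poly n k} (hg : IsTrace K g p) (f : Poly n k) :
    localSolution k α K t g (val f.1) = localSolve hα hK k ht htm (p, f) := by
  have hex : ∃ s : (Fin n → Poly n k) × Poly n k, IsLocalSolution α K t g (val f.1) s :=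
    ⟨_, (isLocalSolution_iff_eq hα hK ht htm hg f _).2 rfl⟩
  rw [localSolution, dif_pos hex]
  exact (isLocalSolution_iff_eq hα hK ht htm hg f _).1 hex.choose_spec

end LocalProblem

end

section

variable {n : ℕ}

/-! ### Two cells sharing a face. -/

section Adjacent

variable (K K' : Affine.Simplex ℝ (E n) n)

lemma affine_eq_sum_bary (l : E n →ᵃ[ℝ] ℝ) (x : E n) :
    l x = ∑ m, bary K m x * l (K.points m) := by
  have h1 : ∀ y, l y = l 0 + l.linear y := fun y => by
    have := l.map_vadd 0 y
    simpa [add_comm] using this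
  rw [h1]
  conv_lhs => rw [← sum_bary_smul K x]
  simp only [h1 (K.points _), mul_add, Finset.sum_add_distrib, ← Finset.sum_mul, sum_bary, one_mul,
    map_sum, map_smul, smul_eq_mul]

variable [NeZero n]

/-- Two cells with a common face and disjoint interiors lie on opposite sides of the face. -/
lemma height_mul_bary_neg (hd : Disjoint (interior (cell K)) (interior (cell K')))
    {i i' : Fin (n + 1)} (hf : face K i = face K' i') (x : E n) :
    K'.height i' * bary K' i' x = -(K.height i * bary K i x) := by
  set c := bary K' i' (K.points i) with hc
  have h0 : ∀ m, m ≠ i → bary K' i' (K.points m) = 0 := by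
    intro m hm
    have := points_mem_face K hm
    rw [hf, face_eq] at this
    exact this.2
  -- Both coordinates vanish on the hyperplane of the common face, hence are proportional. The unit
  -- normals are then proportional too, with factor `s = ±1`, and only the sign has to be settled.
  have h1 : ∀ x, bary K' i' x = c * bary K i x := by
    intro x
    rw [affine_eq_sum_bary K, Finset.sum_eq_single i]
    · ring
    · intro m _ hm; rw [h0 m hm, mul_zero]
    · simp
  have h2 : ∀ v, (bary K' i').linear v = c * (bary K i).linear v := by
    intro v
    have a1 := bary_add K' i' 0 v
    have a2 := bary_add K i 0 v
    rw [h1, h1] at a1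
    linear_combination c * a2 - a1
  have hh := K.height_pos i
  have hh' := K'.height_pos i'
  set s := K'.height i' * c / K.height i with hs
  have h3 : nu K' i' = s • nu K i := by
    ext a
    change normal K' i' a = s * normal K i a
    rw [normal_eq, normal_eq, h2, hs]
    field_simp
  have h4 : |s| = 1 := by
    have := norm_nu K' i'
    rwa [h3, norm_smul, norm_nu, mul_one, Real.norm_eq_abs] at this
  have h5 : s = -1 := by
    rcases (abs_eq zero_le_one).1 h4 with h | h
    · exfalso
      rw [h, one_smul] at h3
      -- If the normals agreed, a small inward step from `y` would enter both interiors. The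
      -- midpoint of the two barycentres has its remaining coordinates positive with respect to both
      -- simplices, so the vertices need not be matched.
      set y := (1 / 2 : ℝ) • faceCenter K i + (1 / 2 : ℝ) • faceCenter K' i' with hy
      have hlin : ∀ (l : E n →ᵃ[ℝ] ℝ), l y = 1 / 2 * l (faceCenter K i) + 1 / 2 * l (faceCenter K' i') := by
        intro l
        exact Convex.combo_affine_apply (by norm_num)
      have hcK : faceCenter K i ∈ face K' i' := hf ▸ faceCenter_mem K i
      have hcK' : faceCenter K' i' ∈ face K i := hf ▸ faceCenter_mem K' i'
      have aux : ∀ (L : Affine.Simplex ℝ (E n) n) (l : Fin (n + 1)), nu L l = nu K i →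
          (∀ m, m ≠ l → 0 < bary L m y) → bary L l y = 0 →
          ∀ᶠ ε in nhdsWithin (0 : ℝ) (Set.Ioi 0), y + (-ε) • nu K i ∈ interior (cell L) := by
        intro L l hnu hpos hz
        rw [interior_cell]
        simp only [Set.mem_ofPred_eq, Filter.eventually_all]
        intro m
        by_cases hm : m = l
        · subst hm
          filter_upwards [self_mem_nhdsWithin] with ε hε
          rw [bary_add, hz, map_smul, ← hnu, bary_linear_nu]
          have := L.height_pos m
          have h6 : (0 : ℝ) < ε := hε
          simp only [smul_eq_mul, zero_add]
          have : 0 < ε * (L.height m)⁻¹ := by positivity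
          linarith
        · have hcont : Continuous fun ε : ℝ => bary L m (y + (-ε) • nu K i) :=
            (continuous_bary L m).comp (by fun_prop)
          have := hcont.tendsto 0
          simp only [neg_zero, zero_smul, add_zero] at this
          exact (this.eventually (lt_mem_nhds (hpos m hm))).filter_mono nhdsWithin_le_nhds
      have e1 := aux K i rfl (fun m hm => by
        rw [hlin]
        have a1 := bary_faceCenter_pos K i hm
        have a2 := bary_nonneg (face_subset_cell K i hcK') m
        linarith) (by
        rw [hlin, bary_faceCenter_self]
        rw [face_eq] at hcK'
        rw [hcK'.2]; ring)
      have e2 := aux K' i' h3 (fun m hm => by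
        rw [hlin]
        have a1 := bary_faceCenter_pos K' i' hm
        have a2 := bary_nonneg (face_subset_cell K' i' hcK) m
        linarith) (by
        rw [hlin, bary_faceCenter_self]
        rw [face_eq] at hcK
        rw [hcK.2]; ring)
      obtain ⟨ε, h6, h7⟩ := (e1.and e2).exists
      exact Set.disjoint_left.1 hd h6 h7
    · exact h
  rw [hs, div_eq_iff hh.ne'] at h5
  rw [h1, ← mul_assoc, h5]; ring

lemma faceCenter_mem_intrinsicInterior (i : Fin (n + 1)) :
    faceCenter K i ∈ intrinsicInterior ℝ (face K i) := by
  rw [mem_intrinsicInterior]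
  refine ⟨⟨faceCenter K i, subset_affineSpan ℝ _ (faceCenter_mem K i)⟩, ?_, rfl⟩
  rw [mem_interior]
  refine ⟨{x | ∀ m, m ≠ i → 0 < bary K m (x : E n)}, ?_, ?_, ?_⟩
  · intro x hx
    have hxi : bary K i (x : E n) = 0 := by
      have hsub : affineSpan ℝ (face K i) ≤ (AffineSubspace.mk' (0 : ℝ) ⊥).comap (bary K i) := by
        rw [affineSpan_le]
        intro y hy
        rw [face_eq] at hy
        simp [hy.2]
      have := hsub x.2
      simpa using this
    refine (Set.ext_iff.1 (face_eq K i) (x : E n)).2 ⟨(Set.ext_iff.1 (cell_eq K) (x : E n)).2 fun m => ?_, hxi⟩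
    by_cases hm : m = i
    · rw [hm, hxi]
    · exact (hx m hm).le
  · have : {x : affineSpan ℝ (face K i) | ∀ m, m ≠ i → 0 < bary K m (x : E n)} =
        ⋂ m, {x : affineSpan ℝ (face K i) | m ≠ i → 0 < bary K m (x : E n)} := by ext; simp
    rw [this]
    refine isOpen_iInter_of_finite fun m => ?_
    by_cases hm : m = i
    · simp [hm]
    · simpa [hm] using isOpen_lt continuous_const ((continuous_bary K m).comp continuous_subtype_val)
  · exact fun m hm => bary_faceCenter_pos K i hm

end Adjacent

/-! ### Neighbours across interior faces and cancellation of fluxes. -/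

namespace Mesh

variable [NeZero n] {Ω : Set (E n)} (T : Mesh Ω)

/-- An interior face belongs to a second element. -/
lemma exists_neighbor (hΩ : IsOpen Ω) (j : Fin T.N) (i : Fin (n + 1))
    (hF : ¬ face (T.elem j) i ⊆ frontier Ω) :
    ∃ j' i', j' ≠ j ∧ face (T.elem j') i' = face (T.elem j) i := by
  set K := T.elem j with hK
  set y := faceCenter K i with hy
  have hyΩ : y ∈ Ω := ((T.faces j i).resolve_left hF) (faceCenter_mem_intrinsicInterior K i)
  have hcont : Filter.Tendsto (fun ε : ℝ => y + ε • nu K i) (nhdsWithin 0 (Set.Ioi 0)) (nhds y) := by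
    have : Continuous fun ε : ℝ => y + ε • nu K i := by fun_prop
    simpa using (this.tendsto 0).mono_left nhdsWithin_le_nhds
  -- Points just beyond the barycentre of the face still lie in `Ω`, hence in a cell, but have left
  -- the given one. As there are finitely many cells, one of them occurs for arbitrarily small
  -- steps; being closed, it contains the barycentre.
  have h1 : ∀ᶠ ε in nhdsWithin (0 : ℝ) (Set.Ioi 0), ∃ j', j' ≠ j ∧ y + ε • nu K i ∈ cell (T.elem j') := by
    filter_upwards [hcont.eventually (hΩ.mem_nhds hyΩ), self_mem_nhdsWithin] with ε hε hε0
    have h2 : y + ε • nu K i ∈ ⋃ j, cell (T.elem j) := T.cover ▸ subset_closure hε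
    obtain ⟨j', hj'⟩ := Set.mem_iUnion.1 h2
    refine ⟨j', fun h => ?_, hj'⟩
    rw [h] at hj'
    have h3 := bary_nonneg hj' i
    rw [← hK, bary_add, hy, bary_faceCenter_self, map_smul, bary_linear_nu] at h3
    have h4 : (0 : ℝ) < ε := hε0
    have h5 := K.height_pos i
    have : 0 < ε * (K.height i)⁻¹ := by positivity
    simp only [smul_eq_mul, zero_add] at h3
    linarith
  have h2 : ∃ j', ∃ᶠ ε in nhdsWithin (0 : ℝ) (Set.Ioi 0),
      j' ≠ j ∧ y + ε • nu K i ∈ cell (T.elem j') := by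
    by_contra hcon
    push Not at hcon
    have h3 : ∀ᶠ ε in nhdsWithin (0 : ℝ) (Set.Ioi 0),
        ∀ j', ¬ (j' ≠ j ∧ y + ε • nu K i ∈ cell (T.elem j')) := by
      rw [Filter.eventually_all]
      intro j'
      have := hcon j'
      filter_upwards [this] with ε h h'
      exact h h'.1 h'.2
    obtain ⟨ε, ⟨j', ha⟩, hb⟩ := (h1.and h3).exists
    exact hb j' ha
  obtain ⟨j', hj'⟩ := h2
  have hne : j' ≠ j := hj'.exists.choose_spec.1
  set K' := T.elem j' with hK'
  have hyK' : y ∈ cell K' :=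
    (isCompact_cell K').isClosed.mem_of_frequently_of_tendsto (hj'.mono fun ε h => h.2) hcont
  have hyS : y ∈ convexHull ℝ (Set.range K.points ∩ Set.range K'.points) := by
    rw [← T.conforming j j' hne.symm]
    exact ⟨face_subset_cell K i (faceCenter_mem K i), hyK'⟩
  set S := Set.range K.points ∩ Set.range K'.points with hS
  -- By conformity the barycentre lies in the hull of the common vertices. Its coordinates at all
  -- vertices of the face are positive, so none of these can be missing.
  have h3 : ∀ m, m ≠ i → K.points m ∈ S := by
    intro m hm
    by_contra hmS
    have h4 : bary K m y = 0 := by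
      refine bary_zero_of_mem_convexHull (fun z hz => ?_) hyS
      obtain ⟨l, rfl⟩ := hz.1
      refine bary_ne K fun h => hmS ?_
      rw [h]; exact hz
    exact (bary_faceCenter_pos K i hm).ne' h4
  -- Otherwise all vertices would be common and one cell would contain the other, against disjoint
  -- interiors. So exactly `n` vertices are common, and they span a face of the neighbour.
  have h4 : K.points i ∉ S := by
    intro hi
    have hsub : cell K ⊆ cell K' := by
      refine convexHull_mono ?_
      rintro _ ⟨m, rfl⟩
      by_cases hm : m = i
      · rw [hm]; exact hi.2
      · exact (h3 m hm).2
    obtain ⟨z, hz⟩ := centroid_mem_interior K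
    exact Set.disjoint_left.1 (T.disjoint j j' hne.symm) hz (interior_mono hsub hz)
  have hSeq : S = K.points '' {i}ᶜ := by
    ext z
    constructor
    · intro hz
      obtain ⟨m, rfl⟩ := hz.1
      exact ⟨m, fun h => h4 (by rw [← Set.mem_singleton_iff.1 h]; exact hz), rfl⟩
    · rintro ⟨m, hm, rfl⟩
      exact h3 m hm
  have hcard : S.ncard = n := by
    rw [hSeq, Set.ncard_image_of_injective _ K.independent.injective, Set.ncard_compl]
    simp
  have hsub : K'.points ⁻¹' S ≠ Set.univ := by
    intro h
    have h5 : Set.range K'.points ⊆ S := by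
      rintro _ ⟨m, rfl⟩
      exact (h ▸ Set.mem_univ m : m ∈ K'.points ⁻¹' S)
    have h6 := Set.ncard_le_ncard h5 (by rw [hSeq]; exact Set.toFinite _)
    rw [← Set.image_univ, Set.ncard_image_of_injective _ K'.independent.injective,
      Set.ncard_univ, Nat.card_eq_fintype_card, Fintype.card_fin, hcard] at h6
    omega
  obtain ⟨i', hi'⟩ := (Set.ne_univ_iff_exists_notMem _).1 hsub
  refine ⟨j', i', hne, ?_⟩
  have h7 : S = K'.points '' {i'}ᶜ := by
    refine Set.eq_of_subset_of_ncard_le ?_ ?_ (Set.toFinite _)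
    · intro z hz
      obtain ⟨m, rfl⟩ := hz.2
      exact ⟨m, fun h => hi' (by rw [← Set.mem_singleton_iff.1 h]; exact hz), rfl⟩
    · rw [hcard, Set.ncard_image_of_injective _ K'.independent.injective, Set.ncard_compl]
      simp
  rw [face, face, ← h7, hSeq]

omit [NeZero n] in
lemma face_injective (K : Affine.Simplex ℝ (E n) n) {i i' : Fin (n + 1)}
    (h : face K i = face K i') : i = i' := by
  by_contra hne
  have h1 := points_mem_face K hne
  rw [← h, face_eq] at h1
  exact one_ne_zero ((bary_self K i).symm.trans h1.2)

/-- Radial fluxes of single-valued functions that vanish on the boundary cancel. -/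
lemma sum_flux_eq_zero (hΩ : IsOpen Ω) (x₀ : E n) (Φ : T.Face → ℝ)
    (hΦ : ∀ F : T.Face, F.1 ⊆ frontier Ω → Φ F = 0) :
    ∑ j, ∑ i, (T.elem j).height i * bary (T.elem j) i x₀ * Φ (T.faceOf j i) = 0 := by
  classical
  have hopp : ∀ p p' : Fin T.N × Fin (n + 1), p ≠ p' →
      face (T.elem p.1) p.2 = face (T.elem p'.1) p'.2 →
      (T.elem p'.1).height p'.2 * bary (T.elem p'.1) p'.2 x₀ =
        -((T.elem p.1).height p.2 * bary (T.elem p.1) p.2 x₀) := by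
    rintro ⟨j, i⟩ ⟨j', i'⟩ hne hf
    have hj : j ≠ j' := by
      rintro rfl
      have hi : i = i' := face_injective _ hf
      exact hne (by rw [hi])
    exact height_mul_bary_neg _ _ (T.disjoint j j' hj) hf x₀
  rw [← Fintype.sum_prod_type' (f := fun j i =>
    (T.elem j).height i * bary (T.elem j) i x₀ * Φ (T.faceOf j i))]
  -- Boundary faces are matched with themselves only to make the neighbour map total; their terms
  -- vanish and are filtered out of the sum.
  have hnb : ∀ p : Fin T.N × Fin (n + 1), ∃ p' : Fin T.N × Fin (n + 1),
      face (T.elem p'.1) p'.2 = face (T.elem p.1) p.2 ∧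
      (¬ face (T.elem p.1) p.2 ⊆ frontier Ω → p' ≠ p) := by
    rintro ⟨j, i⟩
    by_cases hF : face (T.elem j) i ⊆ frontier Ω
    · exact ⟨(j, i), rfl, fun h => absurd hF h⟩
    · obtain ⟨j', i', h1, h2⟩ := T.exists_neighbor hΩ j i hF
      exact ⟨(j', i'), h2, fun _ h => h1 (congrArg Prod.fst h)⟩
  choose g hg1 hg2 using hnb
  set w : Fin T.N × Fin (n + 1) → ℝ := fun p =>
    (T.elem p.1).height p.2 * bary (T.elem p.1) p.2 x₀ with hw
  have hΦg : ∀ p, Φ (T.faceOf (g p).1 (g p).2) = Φ (T.faceOf p.1 p.2) := fun p =>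
    congrArg Φ (Subtype.ext (hg1 p))
  have hzero : ∀ p : Fin T.N × Fin (n + 1), w p * Φ (T.faceOf p.1 p.2) ≠ 0 →
      ¬ face (T.elem p.1) p.2 ⊆ frontier Ω := by
    intro p hp hF
    exact hp (by rw [hΦ _ hF, mul_zero])
  -- the sum equals its opposite after reindexing by the neighbour map
  change ∑ p, w p * Φ (T.faceOf p.1 p.2) = 0
  rw [← Finset.sum_filter_ne_zero]
  refine Finset.sum_involution (fun p _ => g p) ?_ ?_ ?_ ?_
  · intro p hp
    have hp' := (Finset.mem_filter.1 hp).2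
    have := hopp p (g p) (hg2 p (hzero p hp')).symm (hg1 p).symm
    rw [hΦg, ← add_mul]
    change (w p + w (g p)) * _ = 0
    rw [show w (g p) = -w p from this]; ring
  · intro p hp _
    exact hg2 p (hzero p (Finset.mem_filter.1 hp).2)
  · intro p hp
    have hp' := (Finset.mem_filter.1 hp).2
    have := hopp p (g p) (hg2 p (hzero p hp')).symm (hg1 p).symm
    refine Finset.mem_filter.2 ⟨Finset.mem_univ _, ?_⟩
    rw [hΦg, show w (g p) = -w p from this]
    simpa using hp'
  · intro p hp
    have hp' := (Finset.mem_filter.1 hp).2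
    have h1 := hopp p (g p) (hg2 p (hzero p hp')).symm (hg1 p).symm
    -- If the neighbour map failed to be an involution, three distinct element-face pairs would
    -- share one face with pairwise opposite weights, which forces the weight to vanish.
    by_contra hne
    have hF : ¬ face (T.elem (g p).1) (g p).2 ⊆ frontier Ω := by
      rw [hg1]; exact hzero p hp'
    have h2 := hopp (g p) (g (g p)) (hg2 _ hF).symm (hg1 _).symm
    have h3 := hopp p (g (g p)) (Ne.symm hne) ((hg1 p).symm.trans (hg1 (g p)).symm)
    rw [h2, h1] at h3
    have h4 : w p = 0 := by
      have : w p = -w p := by simpa using h3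
      linarith
    exact hp' (by rw [h4, zero_mul])

end Mesh

end

section

variable {n : ℕ}

/-! ### Rellich identity and the elementwise Poincaré estimate. -/

section LocalPoincare

variable {Ω : Set (E n)} {α : E n → Matrix (Fin n) (Fin n) ℝ} {K : Affine.Simplex ℝ (E n) n} {k : ℕ}
  [NeZero n]

/-- Testing the flux relation with `u v` for a constant vector `v`. -/
lemma FluxRelation.const_dir {q : Fin n → Poly n k} {u : Poly n k} {p : Fin (n + 1) → Poly n k}
    (h : FluxRelation α K q u (fun i => u - p i)) (v : E n) :
    2 * cForm α K q (fun a => v a • u) =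
      ∑ i, ((fun a => v a) ⬝ᵥ normal K i) * (intF K i (fun x => val (u - p i).1 x ^ 2) -
        intF K i (fun x => val (p i).1 x ^ 2)) := by
  have hu := continuous_valP u
  have hv : ∀ x, vecVal (fun a => v a • u) x = val u.1 x • (fun a => v a) := by
    intro x; ext a
    simp [vecVal, val_smul, mul_comm]
  have h1 : 2 * intK K (fun x => gradVal u.1 x ⬝ᵥ vecVal (fun a => v a • u) x) =
      ∑ i, ((fun a => v a) ⬝ᵥ normal K i) * intF K i (fun x => val u.1 x ^ 2) := by
    have h2 : ∀ x, val (dirD v (u.1 * u.1)) x =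
        2 * (gradVal u.1 x ⬝ᵥ vecVal (fun a => v a • u) x) := by
      intro x
      rw [dirD_mul, val_add, val_mul, val_mul, val_dirD, hv, dotProduct_smul, smul_eq_mul,
        dotProduct]
      simp only [mul_comm (v _)]
      ring
    have h3 := intK_dirD K v (u.1 * u.1)
    rw [show val (dirD v (u.1 * u.1)) = fun x => 2 * (gradVal u.1 x ⬝ᵥ vecVal (fun a => v a • u) x)
      from funext h2, intK_const_mul] at h3
    rw [h3, ← Finset.sum_neg_distrib]
    refine Finset.sum_congr rfl fun i _ => ?_
    rw [dot_normal, show val (u.1 * u.1) = fun x => val u.1 x ^ 2 from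
      funext fun x => by rw [val_mul, sq]]
    ring
  have h2 := h (fun a => v a • u)
  -- With `e = u - p` one has `2 u e = e² - p² + u²`; the `u²` terms cancel against the volume term
  -- of `h1`.
  have h3 : ∀ i, 2 * intF K i (fun x => val (u - p i).1 x *
      (vecVal (fun a => v a • u) x ⬝ᵥ normal K i)) = ((fun a => v a) ⬝ᵥ normal K i) *
        (intF K i (fun x => val (u - p i).1 x ^ 2) - intF K i (fun x => val (p i).1 x ^ 2)
          + intF K i (fun x => val u.1 x ^ 2)) := by
    intro i
    have hp := continuous_valP (p i)
    have he := continuous_valP (u - p i)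
    rw [← intF_sub K i (by fun_prop) (by fun_prop), ← intF_add K i (by fun_prop) (by fun_prop),
      ← intF_const_mul, ← intF_const_mul]
    congr 1; ext x
    rw [hv, smul_dotProduct, Submodule.coe_sub, val_sub, smul_eq_mul]; ring
  rw [h2, mul_add, mul_neg, h1, Finset.mul_sum, Finset.sum_congr rfl fun i _ => h3 i,
    ← Finset.sum_neg_distrib, ← Finset.sum_add_distrib]
  exact Finset.sum_congr rfl fun i _ => by ring

/-- A Rellich type identity. -/
lemma FluxRelation.rellich {q : Fin n → Poly n k} {u : Poly n k} {p : Fin (n + 1) → Poly n k}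
    (h : FluxRelation α K q u (fun i => u - p i)) (i₀ : Fin (n + 1)) (x₀ : E n) :
    n * intK K (fun x => val u.1 x ^ 2) =
      -(2 * intK K (fun x => val u.1 x * val (dirD (x - K.points i₀) u.1) x)) +
      K.height i₀ * intF K i₀ (fun x => 2 * (val u.1 x * val (u - p i₀).1 x) -
        val (u - p i₀).1 x ^ 2) +
      2 * cForm α K q (fun a => (K.points i₀ - x₀) a • u) -
      ∑ i, ((fun a => (K.points i₀ - x₀) a) ⬝ᵥ normal K i) *
        intF K i (fun x => val (u - p i).1 x ^ 2) +
      ∑ i, K.height i * bary K i x₀ * intF K i (fun x => val (p i).1 x ^ 2) := by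
  have h1 := intK_sq_cone K i₀ u.1
  have h2 := h.const_dir (K.points i₀ - x₀)
  -- The left side is the normal component of `x - x₀` on face `i`. The field is split into the
  -- radial field at the vertex `i₀`, whose normal component lives on face `i₀` alone, and a
  -- constant vector handled by `const_dir`.
  have hm : ∀ i, K.height i * bary K i x₀ = (if i = i₀ then K.height i₀ else 0) +
      ((fun a => (K.points i₀ - x₀) a) ⬝ᵥ normal K i) := by
    intro i
    have h3 := bary_add K i x₀ (K.points i₀ - x₀)
    rw [add_sub_cancel] at h3
    rw [dot_normal]
    split_ifs with hi
    · subst hi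
      rw [bary_self] at h3
      linear_combination (-K.height i) * h3
    · rw [bary_ne K hi] at h3
      linear_combination (-K.height i) * h3
  have h4 : intF K i₀ (fun x => val u.1 x ^ 2) =
      intF K i₀ (fun x => 2 * (val u.1 x * val (u - p i₀).1 x) - val (u - p i₀).1 x ^ 2) +
        intF K i₀ (fun x => val (p i₀).1 x ^ 2) := by
    have hu := continuous_valP u
    have hp := continuous_valP (p i₀)
    have he := continuous_valP (u - p i₀)
    rw [← intF_add K i₀ (by fun_prop) (by fun_prop)]
    congr 1; ext x
    rw [Submodule.coe_sub, val_sub]; ring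
  simp only [mul_sub, Finset.sum_sub_distrib] at h2
  simp only [hm, add_mul, Finset.sum_add_distrib, ite_mul, zero_mul, Finset.sum_ite_eq',
    Finset.mem_univ, if_true]
  rw [h2]
  rw [h4, mul_add] at h1
  linarith

/-- The local contribution to the discrete Poincaré inequality. -/
lemma exists_local_poincare (hn : 2 ≤ n) (hα : IsCoefficient Ω α) (k : ℕ) (R γ Cstar : ℝ) :
    ∃ C : ℝ, 0 < C ∧ ∀ (K : Affine.Simplex ℝ (E n) n) (t : Fin (n + 1) → ℝ),
      interior (cell K) ⊆ Ω → (∀ i, 0 ≤ t i) → 0 < tauMax t →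
      dConst K t ^ 2 * diamK K ≤ Cstar → (∀ i, diamK K ≤ γ * K.height i) →
      ∀ x₀ : E n, (∀ x ∈ cell K, ‖x - x₀‖ ≤ R) →
      ∀ (q : Fin n → Poly n k) (u : Poly n k) (p : Fin (n + 1) → Poly n k),
        FluxRelation α K q u (fun i => u - p i) →
        intK K (fun x => val u.1 x ^ 2) ≤ C * energy α K t q (fun i => u - p i) +
          ∑ i, K.height i * bary K i x₀ * intF K i (fun x => val (p i).1 x ^ 2) := by
  obtain ⟨C, hC, H⟩ := exists_energy_bound hα k
  obtain ⟨CT, hCT, HT⟩ := exists_trace_bound n k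
  have hβ : 0 ≤ n * coeffBound hα := mul_nonneg (Nat.cast_nonneg _) (abs_nonneg _)
  set B := n * coeffBound hα
  -- The first four summands collect the bounds `b1` to `b4` below. Absolute values keep the
  -- constant positive before any sign of `R`, `γ`, `Cstar` is known; an element supplies those
  -- signs.
  refine ⟨2 * (n + 1) * ((n + 1) * (C * Cstar ^ 2)) + 4 * CT * (C * Cstar ^ 2) + 4 * (B * R ^ 2) +
    (n + 1) * (|R| * |γ| * C * |Cstar|) + 1, by positivity,
    fun K t hK ht htm hdC hγ x₀ hR q u p hF => ?_⟩
  have hd := diamK_pos K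
  obtain ⟨hd1, -⟩ := dConst_sq_ge (K := K) htm
  obtain ⟨hq0, hqE, -⟩ := energy_ge hα hK ht q (fun i => u - p i)
  have HE := H K t hK ht htm q u _ hF
  set EE := energy α K t q (fun i => u - p i)
  have hE0 : 0 ≤ EE := hq0.trans hqE
  set U := intK K (fun x => val u.1 x ^ 2) with hU
  have hU0 : 0 ≤ U := intK_nonneg K fun x _ => sq_nonneg _
  set D := dConst K t ^ 2 * diamK K ^ 2 with hD
  have hC0 : diamK K ≤ Cstar := (le_mul_of_one_le_left hd.le hd1).trans hdC
  have hCs : 0 < Cstar := hd.trans_le hC0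
  have hDC : D ≤ Cstar ^ 2 := by
    calc D = dConst K t ^ 2 * diamK K * diamK K := by rw [hD]; ring
      _ ≤ Cstar * Cstar := mul_le_mul hdC hC0 hd.le hCs.le
      _ = Cstar ^ 2 := (sq Cstar).symm
  have hA : C * D * EE ≤ C * Cstar ^ 2 * EE := by gcongr
  set A := C * Cstar ^ 2 * EE with hAdef
  have hA0 : 0 ≤ A := by positivity
  set i₀ := faceMax t
  set v := K.points i₀ - x₀ with hv
  have hvR : ‖v‖ ≤ R := hR _ (points_mem_cell K i₀)
  have hR0 : 0 ≤ R := (norm_nonneg v).trans hvR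
  have b1 : -(2 * intK K (fun x => val u.1 x * val (dirD (x - K.points i₀) u.1) x)) ≤
      1 / 2 * U + 2 * (n + 1) * ((n + 1) * A) := by
    refine (radial_bound K i₀ u.1).trans (add_le_add le_rfl
      (mul_le_mul_of_nonneg_left ?_ (by positivity)))
    refine (Finset.sum_le_sum fun j _ => (HE j).1.trans hA).trans (le_of_eq ?_)
    rw [Finset.sum_const, Finset.card_univ, Fintype.card_fin, nsmul_eq_mul]
    push_cast; rfl
  have b2 : K.height i₀ * intF K i₀ (fun x => 2 * (val u.1 x * val (u - p i₀).1 x) -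
      val (u - p i₀).1 x ^ 2) ≤ 1 / 4 * U + 4 * CT * A := by
    have hu := continuous_valP u
    have he := continuous_valP (u - p i₀)
    have h1 : intF K i₀ (fun x => 2 * (val u.1 x * val (u - p i₀).1 x) -
        val (u - p i₀).1 x ^ 2) ≤ (4 * CT)⁻¹ * intF K i₀ (fun x => val u.1 x ^ 2) +
          4 * CT * intF K i₀ (fun x => val (u - p i₀).1 x ^ 2) := by
      rw [← intF_const_mul, ← intF_const_mul, ← intF_add K i₀ (by fun_prop) (by fun_prop),
        ← sub_nonneg, ← intF_sub K i₀ (by fun_prop) (by fun_prop)]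
      refine intF_nonneg K i₀ fun x _ => ?_
      have h2 : (4 * CT)⁻¹ * val u.1 x ^ 2 + 4 * CT * val (u - p i₀).1 x ^ 2 -
          (2 * (val u.1 x * val (u - p i₀).1 x) - val (u - p i₀).1 x ^ 2) =
          (4 * CT)⁻¹ * (val u.1 x - 4 * CT * val (u - p i₀).1 x) ^ 2 +
            val (u - p i₀).1 x ^ 2 := by
        field_simp; ring
      rw [h2]; positivity
    have h2 := HT i₀ K u
    have h3 := (HE i₀).2.trans hA
    calc _ ≤ K.height i₀ * ((4 * CT)⁻¹ * intF K i₀ (fun x => val u.1 x ^ 2) +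
          4 * CT * intF K i₀ (fun x => val (u - p i₀).1 x ^ 2)) :=
          mul_le_mul_of_nonneg_left h1 (K.height_pos i₀).le
      _ = (4 * CT)⁻¹ * (K.height i₀ * intF K i₀ (fun x => val u.1 x ^ 2)) +
          4 * CT * (K.height i₀ * intF K i₀ (fun x => val (u - p i₀).1 x ^ 2)) := by ring
      _ ≤ (4 * CT)⁻¹ * (CT * U) + 4 * CT * A := by gcongr
      _ = _ := by field_simp
  -- The constant part `v` is as large as the domain. For the gradient of `u` the energy bound would
  -- cost a factor `dConst ^ 2`, which has no uniform bound; the flux relation has replaced it by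
  -- `q`, whose norm is part of the energy.
  have b3 : 2 * cForm α K q (fun a => v a • u) ≤ 1 / 4 * U + 4 * (B * R ^ 2) * EE := by
    have h1 := sq_cForm_le hα hK q (fun a => v a • u)
    have h2 : intK K (fun x => vecVal (fun a => v a • u) x ⬝ᵥ vecVal (fun a => v a • u) x) =
        ‖v‖ ^ 2 * U := by
      rw [hU, ← intK_const_mul]
      congr 1; ext x
      rw [EuclideanSpace.norm_sq_eq, Finset.sum_mul]
      refine Finset.sum_congr rfl fun a _ => ?_
      simp only [vecVal, Submodule.coe_smul, val_smul, Real.norm_eq_abs, sq_abs]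
      ring
    rw [h2] at h1
    have h3 : cForm α K q (fun a => v a • u) ^ 2 ≤ B * R ^ 2 * EE * U := by
      refine h1.trans ?_
      calc B * cForm α K q q * (‖v‖ ^ 2 * U) ≤ B * EE * (R ^ 2 * U) := by gcongr
        _ = _ := by ring
    have h4 : (0 : ℝ) ≤ B * R ^ 2 * EE := by positivity
    refine le_of_sq_le_sq ?_ (by positivity)
    nlinarith [sq_nonneg (1 / 4 * U - 4 * (B * R ^ 2 * EE))]
  -- Here the jumps appear without the height as weight. Dividing by the height costs one power of
  -- the diameter up to `γ`, and the remaining `dConst ^ 2 * diamK` is bounded by `Cstar`.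
  have b4 : -∑ i, ((fun a => v a) ⬝ᵥ normal K i) * intF K i (fun x => val (u - p i).1 x ^ 2) ≤
      (n + 1) * (|R| * |γ| * C * |Cstar|) * EE := by
    have h1 : ∀ i, -(((fun a => v a) ⬝ᵥ normal K i) * intF K i (fun x => val (u - p i).1 x ^ 2)) ≤
        |R| * |γ| * C * |Cstar| * EE := by
      intro i
      have h0 : 0 ≤ intF K i (fun x => val (u - p i).1 x ^ 2) :=
        intF_nonneg K i fun x _ => sq_nonneg _
      have hh := K.height_pos i
      have hγ0 : 0 < γ := by
        by_contra hcon
        have := hγ i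
        nlinarith
      rw [abs_of_nonneg hR0, abs_of_pos hγ0, abs_of_pos hCs]
      have h2 : intF K i (fun x => val (u - p i).1 x ^ 2) ≤ γ * C * Cstar * EE := by
        refine le_of_mul_le_mul_left ?_ hh
        refine (HE i).2.trans ?_
        calc C * D * EE = C * EE * (dConst K t ^ 2 * diamK K) * diamK K := by rw [hD]; ring
          _ ≤ C * EE * Cstar * (γ * K.height i) := by
            gcongr
            exact hγ i
          _ = _ := by ring
      have h3 := (neg_le_abs _).trans ((abs_dot_normal_le K i v).trans hvR)
      calc _ = -((fun a => v a) ⬝ᵥ normal K i) * intF K i (fun x => val (u - p i).1 x ^ 2) := by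
            ring
        _ ≤ R * (γ * C * Cstar * EE) := mul_le_mul h3 h2 h0 hR0
        _ = _ := by ring
    rw [← Finset.sum_neg_distrib]
    refine (Finset.sum_le_sum fun i _ => h1 i).trans (le_of_eq ?_)
    rw [Finset.sum_const, Finset.card_univ, Fintype.card_fin, nsmul_eq_mul]
    push_cast; ring
  have key := hF.rellich i₀ x₀
  rw [← hU, ← hv] at key
  -- The bounds `b1`, `b2`, `b3` absorb `1/2 + 1/4 + 1/4` of `U`; dimension at least two leaves a
  -- full `U` on the left.
  have h2U : 2 * U ≤ n * U := mul_le_mul_of_nonneg_right (by exact_mod_cast hn) hU0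
  have e1 : (2 * (n + 1) * ((n + 1) * (C * Cstar ^ 2)) + 4 * CT * (C * Cstar ^ 2) +
      4 * (B * R ^ 2) + (n + 1) * (|R| * |γ| * C * |Cstar|) + 1) * EE =
      2 * (n + 1) * ((n + 1) * A) + 4 * CT * A + 4 * (B * R ^ 2) * EE +
        (n + 1) * (|R| * |γ| * C * |Cstar|) * EE + EE := by rw [hAdef]; ring
  rw [e1]
  linarith

end LocalPoincare

end

section

/-! ### Approximate eigenvectors of symmetric problems. -/

section Spectral

/-- A symmetric operator has an eigenvalue close to each approximate eigenvalue. -/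
lemma exists_eigenvector_of_approx {V : Type*} [NormedAddCommGroup V] [InnerProductSpace ℝ V]
    [FiniteDimensional ℝ V] {T : V →ₗ[ℝ] V} (hT : T.IsSymmetric) {η : V} (hη : η ≠ 0) {lam ε : ℝ}
    (hε : 0 ≤ ε) (h : ‖η - lam • T η‖ ≤ ε * ‖η‖) :
    ∃ (t : ℝ) (v : V), v ≠ 0 ∧ T v = t • v ∧ |1 - lam * t| ≤ ε := by
  set b := hT.eigenvectorBasis rfl with hb
  set t := hT.eigenvalues rfl with ht
  have hTb : ∀ i, T (b i) = t i • b i := fun i => hT.apply_eigenvectorBasis rfl i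
  -- If every factor `1 - lam * t i` exceeded `ε` in modulus, expansion in the eigenbasis would make
  -- the residual strictly longer than `ε ‖η‖`; a nonzero coefficient of `η` gives strictness.
  by_contra hcon
  push Not at hcon
  have h1 : ∀ i, ε < |1 - lam * t i| := fun i =>
    hcon (t i) (b i) (b.orthonormal.ne_zero i) (hTb i)
  have h2 : ∀ i, inner ℝ (b i) (η - lam • T η) = (1 - lam * t i) * inner ℝ (b i) η := by
    intro i
    rw [inner_sub_right, inner_smul_right, ← hT, hTb, inner_smul_left]
    simp; ring
  have h3 : ‖η - lam • T η‖ ^ 2 = ∑ i, (1 - lam * t i) ^ 2 * inner ℝ (b i) η ^ 2 := by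
    rw [← b.sum_sq_norm_inner_right]
    refine Finset.sum_congr rfl fun i _ => ?_
    rw [h2, Real.norm_eq_abs, sq_abs]; ring
  have h4 : ‖η‖ ^ 2 = ∑ i, inner ℝ (b i) η ^ 2 := by
    rw [← b.sum_sq_norm_inner_right]
    refine Finset.sum_congr rfl fun i _ => ?_
    rw [Real.norm_eq_abs, sq_abs]
  have h5 : ‖η - lam • T η‖ ^ 2 ≤ ε ^ 2 * ‖η‖ ^ 2 := by
    rw [← mul_pow]
    exact pow_le_pow_left₀ (norm_nonneg _) h 2
  have hlt : ∀ i, ε ^ 2 < (1 - lam * t i) ^ 2 := by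
    intro i
    rw [← sq_abs (1 - lam * t i)]
    exact pow_lt_pow_left₀ (h1 i) hε two_ne_zero
  rw [h3, h4, Finset.mul_sum] at h5
  obtain ⟨i, hi⟩ : ∃ i, inner ℝ (b i) η ≠ 0 := by
    by_contra hz
    push Not at hz
    have : ‖η‖ ^ 2 = 0 := by rw [h4]; simp [hz]
    exact hη (by simpa using this)
  refine absurd h5 (not_le.2 (Finset.sum_lt_sum
    (fun i _ => mul_le_mul_of_nonneg_right (hlt i).le (sq_nonneg _)) ⟨i, Finset.mem_univ _, ?_⟩))
  exact mul_lt_mul_of_pos_right (hlt i) (by positivity)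

/-- The generalized symmetric eigenproblem has an eigenvalue close to each approximate one. -/
lemma exists_generalized_eigenvector {V : Type*} [AddCommGroup V] [Module ℝ V]
    [FiniteDimensional ℝ V] (A M : V →ₗ[ℝ] V →ₗ[ℝ] ℝ) (hA : ∀ v w, A v w = A w v)
    (hA0 : ∀ v, 0 ≤ A v v) (hA1 : ∀ v, A v v = 0 → v = 0) (hM : ∀ v w, M v w = M w v) {η : V}
    (hη : η ≠ 0) {lam ε : ℝ} (hε : 0 ≤ ε)
    (h : ∀ μ, |A η μ - lam * M η μ| ≤ ε * Real.sqrt (A η η * A μ μ)) :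
    ∃ (t : ℝ) (v : V), v ≠ 0 ∧ (∀ w, M v w = t * A v w) ∧ |1 - lam * t| ≤ ε := by
  -- With `A` as inner product, `T = A⁻¹ M` is symmetric, and the hypothesis bounds the dual norm of
  -- the residual. Testing with `η - lam • T η` itself turns this into a bound of its norm.
  let core : InnerProductSpace.Core ℝ V :=
    { inner := fun v w => A v w
      conj_inner_symm := fun v w => by simpa using hA w v
      re_inner_nonneg := fun v => by simpa using hA0 v
      add_left := fun v w z => by simp
      smul_left := fun v w a => by simp
      definite := fun v hv => hA1 v hv }
  let : NormedAddCommGroup V := core.toNormedAddCommGroup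
  let : InnerProductSpace ℝ V := InnerProductSpace.ofCore core.toCore
  have hin : ∀ v w : V, inner ℝ v w = A v w := fun v w => rfl
  have hinj : Function.Injective A := by
    rw [← LinearMap.ker_eq_bot, LinearMap.ker_eq_bot']
    exact fun v hv => hA1 v (by rw [hv]; rfl)
  let e := LinearEquiv.ofInjectiveOfFinrankEq A hinj (Subspace.dual_finrank_eq).symm
  let T : V →ₗ[ℝ] V := e.symm.toLinearMap ∘ₗ M
  have hT : ∀ v w, A (T v) w = M v w := by
    intro v w
    have : e (T v) = M v := e.apply_symm_apply (M v)
    exact congrArg (fun f : V →ₗ[ℝ] ℝ => f w) this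
  have hsym : T.IsSymmetric := by
    intro v w
    rw [hin, hin, hT, hA, hT, hM]
  have hnorm : ‖η - lam • T η‖ ≤ ε * ‖η‖ := by
    set r := η - lam • T η with hr
    have h1 : A η r - lam * M η r = ‖r‖ ^ 2 := by
      rw [← real_inner_self_eq_norm_sq, hin, ← hT]
      have h3 : ∀ z, A r z = A η z - lam * A (T η) z := fun z => by rw [hr]; simp
      rw [h3]
    have h2 := h r
    rw [h1, ← hin, ← hin, real_inner_self_eq_norm_sq, real_inner_self_eq_norm_sq, ← mul_pow,
      Real.sqrt_sq (by positivity), abs_of_nonneg (by positivity)] at h2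
    rcases (norm_nonneg r).eq_or_lt with h0 | h0
    · rw [← h0]; positivity
    · refine le_of_mul_le_mul_right ?_ h0
      linarith [sq ‖r‖]
  obtain ⟨t, v, hv, hTv, ht⟩ := exists_eigenvector_of_approx hsym hη hε hnorm
  refine ⟨t, v, hv, fun w => ?_, ht⟩
  rw [← hT, hTv]; simp

end Spectral

end

section

variable {n : ℕ}

/-! ### Reciprocity of local solutions. -/

section Reciprocity

variable {Ω : Set (E n)} {α : E n → Matrix (Fin n) (Fin n) ℝ} {K : Affine.Simplex ℝ (E n) n} {k : ℕ}
  [NeZero n]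

/-- The pairing of two local solutions. -/
def localPairing (α : E n → Matrix (Fin n) (Fin n) ℝ) (K : Affine.Simplex ℝ (E n) n)
    (t : Fin (n + 1) → ℝ) (s s' : (Fin n → Poly n k) × Poly n k) (g g' : Fin (n + 1) → E n → ℝ) :
    ℝ :=
  cForm α K s.1 s'.1 +
    ∑ i, intF K i (fun x => t i * (val s.2.1 x - g i x) * (val s'.2.1 x - g' i x))

omit [NeZero n] in
lemma localPairing_comm (hα : IsCoefficient Ω α) (hK : interior (cell K) ⊆ Ω) (t : Fin (n + 1) → ℝ)
    (s s' : (Fin n → Poly n k) × Poly n k) (g g' : Fin (n + 1) → E n → ℝ) :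
    localPairing α K t s s' g g' = localPairing α K t s' s g' g := by
  rw [localPairing, localPairing, cForm_comm hα hK]
  congr 1
  refine Finset.sum_congr rfl fun i _ => ?_
  congr 1; ext x; ring

omit [NeZero n] in
lemma localPairing_eq (t : Fin (n + 1) → ℝ) (s s' : (Fin n → Poly n k) × Poly n k)
    {g g' : Fin (n + 1) → E n → ℝ} {p p' : Fin (n + 1) → Poly n k} (hg : IsTrace K g p)
    (hg' : IsTrace K g' p') :
    localPairing α K t s s' g g' = cForm α K s.1 s'.1 +
      ∑ i, t i * intF K i (fun x => val (s.2 - p i).1 x * val (s'.2 - p' i).1 x) := by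
  rw [localPairing]
  congr 1
  refine Finset.sum_congr rfl fun i _ => ?_
  rw [← intF_const_mul]
  refine intF_congr K i fun x hx => ?_
  rw [hg i x hx, hg' i x hx, Submodule.coe_sub, Submodule.coe_sub, val_sub, val_sub]; ring

omit [NeZero n] in
lemma localPairing_self (t : Fin (n + 1) → ℝ) (s : (Fin n → Poly n k) × Poly n k)
    {g : Fin (n + 1) → E n → ℝ} {p : Fin (n + 1) → Poly n k} (hg : IsTrace K g p) :
    localPairing α K t s s g g = energy α K t s.1 (fun i => s.2 - p i) := by
  rw [localPairing_eq t s s hg hg, energy]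
  simp only [sq]

/-- Reciprocity: the pairing of two local solutions in terms of the data. -/
lemma localPairing_eq_flux {t : Fin (n + 1) → ℝ} {s s' : (Fin n → Poly n k) × Poly n k}
    {g g' : Fin (n + 1) → E n → ℝ} {p p' : Fin (n + 1) → Poly n k} {f f' : E n → ℝ}
    (hg : IsTrace K g p) (hg' : IsTrace K g' p')
    (hs : IsLocalSolution α K t g f s) (hs' : IsLocalSolution α K t g' f' s') :
    localPairing α K t s s' g g' = intK K (fun x => f' x * val s.2.1 x) -
      ∑ i, intF K i (fun x => g i x *
        (vecVal s'.1 x ⬝ᵥ normal K i + t i * (val s'.2.1 x - g' i x))) := by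
  -- The flux of the second solution tests the first equation of the first one, and the potential of
  -- the first tests the second equation of the second; the common divergence term cancels.
  have e1 := hs.1 s'.1
  have e2 := hs'.2 s.2
  have e3 : ∀ i, intF K i (fun x => g i x *
        (vecVal s'.1 x ⬝ᵥ normal K i + t i * (val s'.2.1 x - g' i x))) =
      intF K i (fun x => g i x * (vecVal s'.1 x ⬝ᵥ normal K i)) +
        intF K i (fun x => t i * (val s'.2.1 x - g' i x) * val s.2.1 x) -
        intF K i (fun x => t i * (val s.2.1 x - g i x) * (val s'.2.1 x - g' i x)) := by
    intro i
    have c1 := continuous_valP s.2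
    have c2 := continuous_valP s'.2
    have c3 := continuous_valP (p i)
    have c4 := continuous_valP (p' i)
    have hr : Continuous fun x => vecVal s'.1 x ⬝ᵥ normal K i := by
      simp only [← val_normalPoly]; exact continuous_val _
    have h1 : intF K i (fun x => g i x * (vecVal s'.1 x ⬝ᵥ normal K i)) =
        intF K i (fun x => val (p i).1 x * (vecVal s'.1 x ⬝ᵥ normal K i)) :=
      intF_congr K i fun x hx => by rw [hg i x hx]
    have h2 : intF K i (fun x => t i * (val s'.2.1 x - g' i x) * val s.2.1 x) =
        intF K i (fun x => t i * (val s'.2.1 x - val (p' i).1 x) * val s.2.1 x) :=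
      intF_congr K i fun x hx => by rw [hg' i x hx]
    have h3 : intF K i (fun x => t i * (val s.2.1 x - g i x) * (val s'.2.1 x - g' i x)) =
        intF K i (fun x => t i * (val s.2.1 x - val (p i).1 x) *
          (val s'.2.1 x - val (p' i).1 x)) :=
      intF_congr K i fun x hx => by rw [hg i x hx, hg' i x hx]
    rw [h1, h2, h3, ← intF_add K i (by fun_prop) (by fun_prop),
      ← intF_sub K i (by fun_prop) (by fun_prop)]
    refine intF_congr K i fun x hx => ?_
    rw [hg i x hx, hg' i x hx]; ring
  simp only [e3, Finset.sum_add_distrib, Finset.sum_sub_distrib]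
  rw [localPairing]
  linarith

/-- The flux form of the second local equation. -/
lemma isLocalSolution_of_flux {t : Fin (n + 1) → ℝ} {q : Fin n → Poly n k} {u : Poly n k}
    {g : Fin (n + 1) → E n → ℝ} {p : Fin (n + 1) → Poly n k} {f : E n → ℝ} (hg : IsTrace K g p)
    (h1 : ∀ r : Fin n → Poly n k, cForm α K q r - intK K (fun x => val u.1 x * divVal r x) =
      -∑ i, intF K i (fun x => g i x * (vecVal r x ⬝ᵥ normal K i)))
    (h2 : ∀ w : Poly n k, -intK K (fun x => vecVal q x ⬝ᵥ gradVal w.1 x) +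
      ∑ i, intF K i (fun x => (vecVal q x ⬝ᵥ normal K i + t i * (val u.1 x - g i x)) *
        val w.1 x) = intK K (fun x => f x * val w.1 x)) :
    IsLocalSolution α K t g f (q, u) := by
  refine ⟨h1, fun w => ?_⟩
  rw [← h2 w]
  change intK K (fun x => val w.1 x * divVal q x) + _ = _
  rw [green]
  have e3 : ∀ i, intF K i (fun x => (vecVal q x ⬝ᵥ normal K i + t i * (val u.1 x - g i x)) *
        val w.1 x) = intF K i (fun x => val w.1 x * (vecVal q x ⬝ᵥ normal K i)) +
      intF K i (fun x => t i * (val u.1 x - g i x) * val w.1 x) := by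
    intro i
    have c1 := continuous_valP u
    have c2 := continuous_valP w
    have c3 := continuous_valP (p i)
    have hr : Continuous fun x => vecVal q x ⬝ᵥ normal K i := by
      simp only [← val_normalPoly]; exact continuous_val _
    have h2 : intF K i (fun x => t i * (val u.1 x - g i x) * val w.1 x) =
        intF K i (fun x => t i * (val u.1 x - val (p i).1 x) * val w.1 x) :=
      intF_congr K i fun x hx => by rw [hg i x hx]
    rw [h2, ← intF_add K i (by fun_prop) (by fun_prop)]
    refine intF_congr K i fun x hx => ?_
    rw [hg i x hx]; ring
  simp only [e3, Finset.sum_add_distrib]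
  have e4 : ∀ x, gradVal w.1 x ⬝ᵥ vecVal q x = vecVal q x ⬝ᵥ gradVal w.1 x :=
    fun x => dotProduct_comm _ _
  simp only [e4]
  ring

end Reciprocity

/-! ### Traces, the lifting operators and the condensed forms. -/

section Condensed

variable {Ω : Set (E n)} {α : E n → Matrix (Fin n) (Fin n) ℝ} {k : ℕ} {T : Mesh Ω}

lemma tauMax_pos [NeZero n] (τ : Penalty T) (j : Fin T.N) : 0 < tauMax (τ.val j) := by
  obtain ⟨i, hi⟩ := τ.exists_pos j
  exact hi.trans_le (le_tauMax _ i)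

lemma exists_isTrace (μ : Mh T k) (j : Fin T.N) :
    ∃ p : Fin (n + 1) → Poly n k, IsTrace (T.elem j) (tr μ j) p := by
  choose p hp using fun i => (μ.2 (T.faceOf j i)).1
  refine ⟨p, fun i x hx => ?_⟩
  rw [tr, hp]
  exact Set.indicator_of_mem (show x ∈ (T.faceOf j i).1 from hx) _

lemma tr_add (μ ν : Mh T k) (j : Fin T.N) : tr (μ + ν) j = tr μ j + tr ν j := rfl

lemma tr_smul (a : ℝ) (μ : Mh T k) (j : Fin T.N) : tr (a • μ) j = a • tr μ j := rfl

/-- A function on the mesh faces vanishes if all its traces do. -/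
lemma eq_zero_of_tr_eq_zero (μ : Mh T k)
    (h : ∀ j i, ∀ x ∈ face (T.elem j) i, tr μ j i x = 0) : μ = 0 := by
  refine Subtype.ext (funext fun F => funext fun x => ?_)
  obtain ⟨S, j, i, rfl⟩ := F
  by_cases hx : x ∈ face (T.elem j) i
  · exact h j i x hx
  · obtain ⟨p, hp⟩ := (μ.2 (T.faceOf j i)).1
    change μ.1 (T.faceOf j i) x = 0
    rw [hp]
    exact Set.indicator_of_notMem (show x ∉ (T.faceOf j i).1 from hx) _

instance finite_face : Finite T.Face :=
  Finite.of_surjective (fun p : Fin T.N × Fin (n + 1) => T.faceOf p.1 p.2) (by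
    rintro ⟨S, j, i, rfl⟩
    exact ⟨(j, i), rfl⟩)

instance finiteDimensional_Mh : FiniteDimensional ℝ (Mh T k) := by
  let L : (T.Face → Poly n k) →ₗ[ℝ] (T.Face → E n → ℝ) :=
    { toFun := fun p F => F.1.indicator (val (p F).1)
      map_add' := fun p p' => by
        ext F x
        by_cases hx : x ∈ F.1 <;> simp [hx, val_add]
      map_smul' := fun a p => by
        ext F x
        by_cases hx : x ∈ F.1 <;> simp [hx, val_smul] }
  refine Submodule.finiteDimensional_of_le (S₂ := LinearMap.range L) fun μ hμ => ?_
  choose p hp using fun F => (hμ F).1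
  exact ⟨p, funext fun F => (hp F).symm⟩

variable [NeZero n]

/-- Ties the operators, which are defined by choice, to the linear map `localSolve`, for any
polynomials representing the trace. Their linearity in `μ` follows. -/
lemma localSolution_trace (hα : IsCoefficient Ω α) (τ : Penalty T) (μ : Mh T k) (j : Fin T.N)
    {p : Fin (n + 1) → Poly n k} (hp : IsTrace (T.elem j) (tr μ j) p) :
    (opQ T τ α μ j, opU T τ α μ j) =
      localSolve hα (T.interior_subset j) k (τ.nonneg j) (tauMax_pos τ j) (p, 0) := by
  rw [← localSolution_eq hα (T.interior_subset j) (τ.nonneg j) (tauMax_pos τ j) hp 0,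
    show val (0 : Poly n k).1 = 0 from funext fun x => val_zero x]
  rfl

lemma isLocalSolution_ops (hα : IsCoefficient Ω α) (τ : Penalty T) (μ : Mh T k) (j : Fin T.N) :
    IsLocalSolution α (T.elem j) (τ.val j) (tr μ j) 0 (opQ T τ α μ j, opU T τ α μ j) := by
  obtain ⟨p, hp⟩ := exists_isTrace μ j
  rw [show (0 : E n → ℝ) = val (0 : Poly n k).1 from funext fun x => (val_zero x).symm,
    isLocalSolution_iff_eq hα (T.interior_subset j) (τ.nonneg j) (tauMax_pos τ j) hp]
  exact localSolution_trace hα τ μ j hp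

lemma ops_add (hα : IsCoefficient Ω α) (τ : Penalty T) (μ ν : Mh T k) (j : Fin T.N) :
    opQ T τ α (μ + ν) j = opQ T τ α μ j + opQ T τ α ν j ∧
      opU T τ α (μ + ν) j = opU T τ α μ j + opU T τ α ν j := by
  obtain ⟨p, hp⟩ := exists_isTrace μ j
  obtain ⟨p', hp'⟩ := exists_isTrace ν j
  have h := localSolution_trace hα τ (μ + ν) j (hp.add hp')
  rw [show ((p + p', 0) : (Fin (n + 1) → Poly n k) × Poly n k) = (p, 0) + (p', 0) by simp,
    map_add, ← localSolution_trace hα τ μ j hp, ← localSolution_trace hα τ ν j hp'] at h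
  exact Prod.ext_iff.1 h

lemma ops_smul (hα : IsCoefficient Ω α) (τ : Penalty T) (a : ℝ) (μ : Mh T k) (j : Fin T.N) :
    opQ T τ α (a • μ) j = a • opQ T τ α μ j ∧ opU T τ α (a • μ) j = a • opU T τ α μ j := by
  obtain ⟨p, hp⟩ := exists_isTrace μ j
  have h := localSolution_trace hα τ (a • μ) j (hp.smul a)
  rw [show ((a • p, 0) : (Fin (n + 1) → Poly n k) × Poly n k) = a • (p, 0) by simp,
    map_smul, ← localSolution_trace hα τ μ j hp] at h
  exact Prod.ext_iff.1 h

/-- The operator `𝒰` as a linear map. -/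
def opULin (hα : IsCoefficient Ω α) (τ : Penalty T) (k : ℕ) : Mh T k →ₗ[ℝ] Wh T k where
  toFun := opU T τ α
  map_add' μ ν := funext fun j => (ops_add hα τ μ ν j).2
  map_smul' a μ := funext fun j => (ops_smul hα τ a μ j).2

omit [NeZero n] in
/-- The `L²` inner product on `W_h`. -/
def massForm (T : Mesh Ω) (k : ℕ) : Wh T k →ₗ[ℝ] Wh T k →ₗ[ℝ] ℝ :=
  LinearMap.mk₂ ℝ (fun u w => ∑ j, cellInt (T.elem j) ((u j).1 * (w j).1))
    (fun u u' w => by simp [add_mul, Finset.sum_add_distrib])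
    (fun a u w => by simp [Finset.mul_sum])
    (fun u w w' => by simp [mul_add, Finset.sum_add_distrib])
    (fun a u w => by simp [Finset.mul_sum])

omit [NeZero n] in
lemma massForm_apply (u w : Wh T k) :
    massForm T k u w = ∑ j, intK (T.elem j) (fun x => val (u j).1 x * val (w j).1 x) := by
  simp only [massForm, LinearMap.mk₂_apply, cellInt_mul]

omit [NeZero n] in
lemma massForm_comm (u w : Wh T k) : massForm T k u w = massForm T k w u := by
  rw [massForm_apply, massForm_apply]
  simp only [mul_comm]

omit [NeZero n] in
lemma massForm_self (u : Wh T k) :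
    massForm T k u u = ∑ j, intK (T.elem j) (fun x => val (u j).1 x ^ 2) := by
  rw [massForm_apply]
  simp only [sq]

omit [NeZero n] in
lemma massForm_nonneg (u : Wh T k) : 0 ≤ massForm T k u u := by
  rw [massForm_self]
  exact Finset.sum_nonneg fun j _ => intK_nonneg _ fun x _ => sq_nonneg _

omit [NeZero n] in
lemma eq_zero_of_massForm_eq_zero {u : Wh T k} (h : massForm T k u u = 0) : u = 0 := by
  rw [massForm_self, Finset.sum_eq_zero_iff_of_nonneg
    fun j _ => intK_nonneg _ fun x _ => sq_nonneg _] at h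
  exact funext fun j => intK_sq_eq_zero (h j (Finset.mem_univ j))

lemma ah_eq_sum (τ : Penalty T) (η μ : Mh T k) :
    ah T τ α η μ = ∑ j, localPairing α (T.elem j) (τ.val j) (opQ T τ α η j, opU T τ α η j)
      (opQ T τ α μ j, opU T τ α μ j) (tr η j) (tr μ j) := by
  simp only [ah, localPairing, Finset.sum_add_distrib]

lemma ah_comm (hα : IsCoefficient Ω α) (τ : Penalty T) (η μ : Mh T k) :
    ah T τ α η μ = ah T τ α μ η := by
  rw [ah_eq_sum, ah_eq_sum]
  exact Finset.sum_congr rfl fun j _ => localPairing_comm hα (T.interior_subset j) _ _ _ _ _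

lemma ah_add_left (hα : IsCoefficient Ω α) (τ : Penalty T) (η η' μ : Mh T k) :
    ah T τ α (η + η') μ = ah T τ α η μ + ah T τ α η' μ := by
  rw [ah_eq_sum, ah_eq_sum, ah_eq_sum, ← Finset.sum_add_distrib]
  refine Finset.sum_congr rfl fun j _ => ?_
  obtain ⟨p, hp⟩ := exists_isTrace η j
  obtain ⟨p', hp'⟩ := exists_isTrace η' j
  obtain ⟨r, hr⟩ := exists_isTrace μ j
  rw [localPairing_eq _ _ _ hp hr, localPairing_eq _ _ _ hp' hr, tr_add,
    localPairing_eq _ _ _ (hp.add hp') hr, (ops_add hα τ η η' j).1, (ops_add hα τ η η' j).2]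
  simp only [← cBil_apply hα (T.interior_subset j), ← faceInt_mul, map_add, LinearMap.add_apply]
  rw [add_add_add_comm, ← Finset.sum_add_distrib]
  congr 1
  refine Finset.sum_congr rfl fun i _ => ?_
  rw [← mul_add, ← map_add, ← add_mul, Pi.add_apply, ← Submodule.coe_add, sub_add_sub_comm]

lemma ah_smul_left (hα : IsCoefficient Ω α) (τ : Penalty T) (a : ℝ) (η μ : Mh T k) :
    ah T τ α (a • η) μ = a * ah T τ α η μ := by
  rw [ah_eq_sum, ah_eq_sum, Finset.mul_sum]
  refine Finset.sum_congr rfl fun j _ => ?_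
  obtain ⟨p, hp⟩ := exists_isTrace η j
  obtain ⟨r, hr⟩ := exists_isTrace μ j
  rw [localPairing_eq _ _ _ hp hr, tr_smul,
    localPairing_eq _ _ _ (hp.smul a) hr, (ops_smul hα τ a η j).1, (ops_smul hα τ a η j).2]
  simp only [← cBil_apply hα (T.interior_subset j), ← faceInt_mul, map_smul, LinearMap.smul_apply]
  rw [mul_add, Finset.mul_sum, smul_eq_mul]
  congr 1
  refine Finset.sum_congr rfl fun i _ => ?_
  rw [Pi.smul_apply, show a • opU T τ α η j - a • p i = a • (opU T τ α η j - p i) from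
    (smul_sub _ _ _).symm, Submodule.coe_smul, smul_mul_assoc, map_smul, smul_eq_mul]
  ring

/-- The condensed form as a bilinear map. -/
def condensedForm (hα : IsCoefficient Ω α) (τ : Penalty T) (k : ℕ) :
    Mh T k →ₗ[ℝ] Mh T k →ₗ[ℝ] ℝ :=
  LinearMap.mk₂ ℝ (ah T τ α) (ah_add_left hα τ) (ah_smul_left hα τ)
    (fun η μ μ' => by rw [ah_comm hα, ah_add_left hα, ah_comm hα τ μ, ah_comm hα τ μ'])
    (fun a η μ => by rw [ah_comm hα, ah_smul_left hα, ah_comm hα τ μ]; rfl)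

lemma ah_self_eq_sum (τ : Penalty T) (μ : Mh T k) {p : Fin T.N → Fin (n + 1) → Poly n k}
    (hp : ∀ j, IsTrace (T.elem j) (tr μ j) (p j)) :
    ah T τ α μ μ = ∑ j, energy α (T.elem j) (τ.val j) (opQ T τ α μ j)
      (fun i => opU T τ α μ j - p j i) := by
  rw [ah_eq_sum]
  exact Finset.sum_congr rfl fun j _ => localPairing_self _ _ (hp j)

lemma ah_self_nonneg (hα : IsCoefficient Ω α) (τ : Penalty T) (μ : Mh T k) :
    0 ≤ ah T τ α μ μ := by
  choose p hp using exists_isTrace μ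
  rw [ah_self_eq_sum τ μ hp]
  refine Finset.sum_nonneg fun j _ => ?_
  have := energy_ge hα (T.interior_subset j) (τ.nonneg j) (opQ T τ α μ j)
    (fun i => opU T τ α μ j - p j i)
  exact this.1.trans this.2.1

/-- If the energies and the potential vanish, so does the trace. -/
lemma eq_zero_of_energy_eq_zero (hα : IsCoefficient Ω α) (τ : Penalty T) (η : Mh T k) (q : Vh T k)
    {p : Fin T.N → Fin (n + 1) → Poly n k} (hp : ∀ j, IsTrace (T.elem j) (tr η j) (p j))
    (hF : ∀ j, FluxRelation α (T.elem j) (q j) 0 (fun i => 0 - p j i))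
    (hE : ∀ j, energy α (T.elem j) (τ.val j) (q j) (fun i => 0 - p j i) = 0) : η = 0 := by
  obtain ⟨C, hC, H⟩ := exists_energy_bound hα k
  refine eq_zero_of_tr_eq_zero η fun j i x hx => ?_
  have h1 := (H _ _ (T.interior_subset j) (τ.nonneg j) (tauMax_pos τ j) _ _ _ (hF j) i).2
  rw [hE, mul_zero] at h1
  have h0 : ∀ x, 0 ≤ val (0 - p j i).1 x ^ 2 := fun x => sq_nonneg _
  have h2 : intF (T.elem j) i (fun x => val (0 - p j i).1 x ^ 2) = 0 :=
    le_antisymm (nonpos_of_mul_nonpos_right h1 ((T.elem j).height_pos i))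
      (intF_nonneg _ _ fun x _ => h0 x)
  have h3 := eq_zero_of_intF_eq_zero (T.elem j) i ((continuous_valP (0 - p j i)).pow 2)
    (fun x _ => h0 x) h2 x hx
  rw [hp j i x hx]
  have h4 : val (0 - p j i).1 x = 0 := pow_eq_zero_iff two_ne_zero |>.1 h3
  rw [Submodule.coe_sub, val_sub, Submodule.coe_zero, val_zero] at h4
  linarith

end Condensed

end

section

variable {n : ℕ} [NeZero n] {Ω : Set (E n)} {α : E n → Matrix (Fin n) (Fin n) ℝ} {k : ℕ}

/-! ### The discrete Poincaré inequality. -/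

section Poincare

lemma Mesh.ShapeRegular.diamK_le {T : Mesh Ω} {γ : ℝ} (hT : T.ShapeRegular γ) (j : Fin T.N)
    (i : Fin (n + 1)) : diamK (T.elem j) ≤ γ * (T.elem j).height i := by
  obtain ⟨x, ρ, hρ, hb, hd⟩ := hT j
  have h1 := diamK_pos (T.elem j)
  have hγ : 0 < γ := by
    by_contra hcon
    nlinarith
  exact hd.trans (mul_le_mul_of_nonneg_left (le_height _ i hρ hb) hγ.le)

lemma fluxRelation_ops (hα : IsCoefficient Ω α) {T : Mesh Ω} (τ : Penalty T) (μ : Mh T k)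
    (j : Fin T.N) {p : Fin (n + 1) → Poly n k} (hp : IsTrace (T.elem j) (tr μ j) p) :
    FluxRelation α (T.elem j) (opQ T τ α μ j) (opU T τ α μ j) (fun i => opU T τ α μ j - p i) :=
  fluxRelation_of_eq hp (isLocalSolution_ops hα τ μ j).1

/-- The discrete Poincaré inequality. -/
lemma exists_poincare (hn : 2 ≤ n) (hΩ : IsPolyhedralDomain Ω) (hα : IsCoefficient Ω α) (k : ℕ)
    (γ Cstar : ℝ) : ∃ C : ℝ, 0 < C ∧ ∀ (T : Mesh Ω) (τ : Penalty T), T.ShapeRegular γ →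
      PenaltyBound T τ Cstar → ∀ μ : Mh T k,
        massForm T k (opU T τ α μ) (opU T τ α μ) ≤ C * ah T τ α μ μ := by
  obtain ⟨x₀, hx₀⟩ := hΩ.isConnected.nonempty
  obtain ⟨C, hC, H⟩ := exists_local_poincare hn hα k (Metric.diam (closure Ω)) γ Cstar
  refine ⟨C, hC, fun T τ hT hτ μ => ?_⟩
  choose p hp using exists_isTrace μ
  have hR : ∀ j, ∀ x ∈ cell (T.elem j), ‖x - x₀‖ ≤ Metric.diam (closure Ω) := by
    intro j x hx
    rw [← dist_eq_norm]
    exact Metric.dist_le_diam_of_mem hΩ.isBounded.closure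
      (T.cover ▸ Set.mem_iUnion.2 ⟨j, hx⟩) (subset_closure hx₀)
  -- These are the fluxes of `μ² (x - x₀)` out of the elements. They cancel because `μ` is single
  -- valued and vanishes on the boundary.
  have hz : ∑ j, ∑ i, (T.elem j).height i * bary (T.elem j) i x₀ *
      intF (T.elem j) i (fun x => val (p j i).1 x ^ 2) = 0 := by
    rw [← T.sum_flux_eq_zero hΩ.isOpen x₀
      (fun F => ∫ x in F.1, μ.1 F x ^ 2 ∂(Measure.euclideanHausdorffMeasure (n - 1)))
      fun F hF => by simp [(μ.2 F).2 hF]]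
    refine Finset.sum_congr rfl fun j _ => Finset.sum_congr rfl fun i _ => ?_
    congr 1
    exact intF_congr _ i fun x hx => by rw [← hp j i x hx]; rfl
  rw [massForm_self, ah_self_eq_sum τ μ hp, Finset.mul_sum]
  calc _ ≤ ∑ j, (C * energy α (T.elem j) (τ.val j) (opQ T τ α μ j)
        (fun i => opU T τ α μ j - p j i) + ∑ i, (T.elem j).height i * bary (T.elem j) i x₀ *
          intF (T.elem j) i (fun x => val (p j i).1 x ^ 2)) :=
        Finset.sum_le_sum fun j _ => H _ _ (T.interior_subset j) (τ.nonneg j) (tauMax_pos τ j)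
          (hτ j).1 (hT.diamK_le j) x₀ (hR j) _ _ _ (fluxRelation_ops hα τ μ j (hp j))
    _ = _ := by rw [Finset.sum_add_distrib, hz, add_zero]

/-- The condensed form is definite. -/
lemma eq_zero_of_ah_eq_zero (hn : 2 ≤ n) (hΩ : IsPolyhedralDomain Ω) (hα : IsCoefficient Ω α)
    {T : Mesh Ω} {τ : Penalty T} {γ Cstar : ℝ} (hT : T.ShapeRegular γ)
    (hτ : PenaltyBound T τ Cstar) {μ : Mh T k} (h : ah T τ α μ μ = 0) : μ = 0 := by
  obtain ⟨C, hC, H⟩ := exists_poincare hn hΩ hα k γ Cstar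
  have h1 := H T τ hT hτ μ
  rw [h, mul_zero] at h1
  have h2 := eq_zero_of_massForm_eq_zero (le_antisymm h1 (massForm_nonneg _))
  choose p hp using exists_isTrace μ
  have h3 : ∀ j, opU T τ α μ j = 0 := fun j => congrFun h2 j
  have h4 := fun j => fluxRelation_ops hα τ μ j (hp j)
  rw [ah_self_eq_sum τ μ hp] at h
  simp only [h3] at h h4
  refine eq_zero_of_energy_eq_zero hα τ μ _ hp h4 fun j => ?_
  refine (Finset.sum_eq_zero_iff_of_nonneg fun j _ => ?_).1 h j (Finset.mem_univ j)
  have := energy_ge hα (T.interior_subset j) (τ.nonneg j) (opQ T τ α μ j)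
    (fun i => 0 - p j i)
  exact this.1.trans this.2.1

end Poincare

/-! ### Localisation of the HDG eigenvalue equations. -/

section Eigenpair

variable {T : Mesh Ω} {τ : Penalty T} {lam : ℝ} {q : Vh T k} {u : Wh T k} {η : Mh T k}

omit [NeZero n] in
lemma vecVal_zero (x : E n) : vecVal (0 : Fin n → Poly n k) x = 0 := by
  ext a; simp [vecVal]

omit [NeZero n] in
lemma gradVal_zero (x : E n) : gradVal 0 x = 0 := by
  ext a; simp [gradVal]

lemma qhat_dot_normal (τ : Penalty T) (q : Vh T k) (u : Wh T k) (η : Mh T k) (j : Fin T.N)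
    (i : Fin (n + 1)) (x : E n) : qhat τ q u η j i x ⬝ᵥ normal (T.elem j) i =
      vecVal (q j) x ⬝ᵥ normal (T.elem j) i + τ.val j i * (val (u j).1 x - tr η j i x) := by
  rw [qhat, add_dotProduct, smul_dotProduct, normal_dot_self, smul_eq_mul, mul_one]

/-- An HDG eigenfunction solves the local problems. -/
lemma isLocalSolution_of_eigenpair
    (h1 : ∀ r : Vh T k, ∑ j, cForm α (T.elem j) (q j) (r j)
        - ∑ j, intK (T.elem j) (fun x => val (u j).1 x * divVal (r j) x)
        + ∑ j, ∑ i, intF (T.elem j) i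
            (fun x => tr η j i x * (vecVal (r j) x ⬝ᵥ normal (T.elem j) i)) = 0)
    (h2 : ∀ w : Wh T k,
      -∑ j, intK (T.elem j) (fun x => vecVal (q j) x ⬝ᵥ gradVal (w j).1 x)
        + ∑ j, ∑ i, intF (T.elem j) i
            (fun x => (qhat τ q u η j i x ⬝ᵥ normal (T.elem j) i) * val (w j).1 x)
        = lam * ∑ j, intK (T.elem j) (fun x => val (u j).1 x * val (w j).1 x)) (j : Fin T.N) :
    IsLocalSolution α (T.elem j) (τ.val j) (tr η j) (val (lam • u j).1) (q j, u j) := by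
  obtain ⟨p, hp⟩ := exists_isTrace η j
  refine isLocalSolution_of_flux hp (fun r => ?_) (fun w => ?_)
  -- Test functions are discontinuous across elements, so those supported in one element are
  -- admissible.
  · have h := h1 (Pi.single j r)
    rw [Finset.sum_eq_single j, Finset.sum_eq_single j, Finset.sum_eq_single j] at h
    · simp only [Pi.single_eq_same] at h
      linarith
    all_goals first
      | (intro j' _ hj'
         simp [Pi.single_eq_of_ne hj', cForm, vecVal_zero, divVal, intK, intF])
      | simp
  · have h := h2 (Pi.single j w)
    rw [Finset.sum_eq_single j, Finset.sum_eq_single j, Finset.sum_eq_single j] at h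
    · simp only [Pi.single_eq_same, qhat_dot_normal, ← intK_const_mul] at h
      rw [h]
      congr 1; ext x
      rw [Submodule.coe_smul, val_smul]; ring
    all_goals first
      | (intro j' _ hj'
         simp [Pi.single_eq_of_ne hj', gradVal_zero, intK, intF])
      | simp

end Eigenpair

end

section

variable {n : ℕ} [NeZero n] {Ω : Set (E n)} {α : E n → Matrix (Fin n) (Fin n) ℝ} {k : ℕ}

/-! ### Residual estimate and the condensed eigenvalue. -/

section Main

/-- The constant of `exists_source_bound` does not involve the penalty bounds, hence one choice
serves every `Cstar`. -/
lemma exists_isLocalConstant (hα : IsCoefficient Ω α) (k : ℕ) (γ : ℝ) :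
    ∃ C₀ : ℝ, 0 < C₀ ∧ ∀ Cstar : ℝ, IsLocalConstant Ω α k γ Cstar C₀ := by
  obtain ⟨C, hC, H⟩ := exists_source_bound hα k
  refine ⟨C, hC, fun Cstar T τ _ _ j f hf => ?_⟩
  -- Solvability was shown for polynomial sources. For a general source nothing more is needed:
  -- without a solution the operator takes its default value zero and the bound is trivial.
  by_cases hex : ∃ s, IsLocalSolution (k := k) α (T.elem j) (τ.val j) 0 f s
  · have h : IsLocalSolution α (T.elem j) (τ.val j) 0 f
        (localSolution k α (T.elem j) (τ.val j) 0 f) := by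
      rw [localSolution, dif_pos hex]
      exact hex.choose_spec
    exact (H _ _ (T.interior_subset j) (τ.nonneg j) (tauMax_pos τ j) f hf _ h).2.2
  · have h : opUW T τ α k f j = 0 := by
      rw [opUW, localSolution, dif_neg hex]; rfl
    have h0 : normK (T.elem j) (val (opUW T τ α k f j).1) = 0 := by
      rw [h]; simp [normK, intK]
    rw [h0]
    have := diamK_pos (T.elem j)
    have : 0 ≤ normK (T.elem j) f := Real.sqrt_nonneg _
    positivity

variable {T : Mesh Ω} {τ : Penalty T} {lam : ℝ} {q : Vh T k} {u : Wh T k} {η : Mh T k}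

/-- The residual equation of an HDG eigenfunction in the condensed form. -/
lemma ah_eq_of_eigenpair (hα : IsCoefficient Ω α)
    (hloc : ∀ j, IsLocalSolution α (T.elem j) (τ.val j) (tr η j) (val (lam • u j).1) (q j, u j))
    (h3 : ∀ μ : Mh T k, ∑ j, ∑ i, intF (T.elem j) i
      (fun x => tr μ j i x * (qhat τ q u η j i x ⬝ᵥ normal (T.elem j) i)) = 0) (μ : Mh T k) :
    ah T τ α η μ = lam * massForm T k u (opU T τ α μ) := by
  have h4 : ∀ j, localPairing α (T.elem j) (τ.val j) (opQ T τ α η j, opU T τ α η j)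
      (opQ T τ α μ j, opU T τ α μ j) (tr η j) (tr μ j) =
      lam * intK (T.elem j) (fun x => val (u j).1 x * val (opU T τ α μ j).1 x) -
        ∑ i, intF (T.elem j) i
          (fun x => tr μ j i x * (qhat τ q u η j i x ⬝ᵥ normal (T.elem j) i)) := by
    intro j
    obtain ⟨p, hp⟩ := exists_isTrace η j
    obtain ⟨r, hr⟩ := exists_isTrace μ j
    -- Paired with the lifting of `μ`, the lifting of `η` and the eigenfunction give the same value,
    -- since only their common trace enters. Exchanging the roles in the second pairing brings in
    -- the source `lam • u` and the numerical flux.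
    have e1 := localPairing_eq_flux hp hr (isLocalSolution_ops hα τ η j)
      (isLocalSolution_ops hα τ μ j)
    have e2 := localPairing_eq_flux hp hr (hloc j) (isLocalSolution_ops hα τ μ j)
    have e3 := localPairing_eq_flux hr hp (isLocalSolution_ops hα τ μ j) (hloc j)
    have e4 : ∀ w : Poly n k, intK (T.elem j) (fun x => (0 : E n → ℝ) x * val w.1 x) = 0 :=
      fun w => by simp [intK]
    rw [e4] at e1 e2
    rw [e1, ← e2, localPairing_comm hα (T.interior_subset j), e3, ← intK_const_mul]
    simp only [qhat_dot_normal, Submodule.coe_smul, val_smul, mul_assoc]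
  rw [ah_eq_sum, Finset.sum_congr rfl fun j _ => h4 j, Finset.sum_sub_distrib, h3, sub_zero,
    massForm_apply, Finset.mul_sum]

/-- The energy of an HDG eigenfunction. -/
lemma sum_energy_of_eigenpair
    (hloc : ∀ j, IsLocalSolution α (T.elem j) (τ.val j) (tr η j) (val (lam • u j).1) (q j, u j))
    (h3 : ∀ μ : Mh T k, ∑ j, ∑ i, intF (T.elem j) i
      (fun x => tr μ j i x * (qhat τ q u η j i x ⬝ᵥ normal (T.elem j) i)) = 0)
    {p : Fin T.N → Fin (n + 1) → Poly n k} (hp : ∀ j, IsTrace (T.elem j) (tr η j) (p j)) :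
    ∑ j, energy α (T.elem j) (τ.val j) (q j) (fun i => u j - p j i) = lam * massForm T k u u := by
  have h4 : ∀ j, energy α (T.elem j) (τ.val j) (q j) (fun i => u j - p j i) =
      lam * intK (T.elem j) (fun x => val (u j).1 x * val (u j).1 x) -
        ∑ i, intF (T.elem j) i
          (fun x => tr η j i x * (qhat τ q u η j i x ⬝ᵥ normal (T.elem j) i)) := by
    intro j
    have e1 := localPairing_eq_flux (hp j) (hp j) (hloc j) (hloc j)
    rw [localPairing_self _ _ (hp j)] at e1
    rw [e1, ← intK_const_mul]
    simp only [qhat_dot_normal, Submodule.coe_smul, val_smul, mul_assoc]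
  rw [Finset.sum_congr rfl fun j _ => h4 j, Finset.sum_sub_distrib, h3, sub_zero,
    massForm_apply, Finset.mul_sum]

/-- HDG eigenvalues are nonnegative and their eigenfunctions have a nonzero potential. -/
lemma eigenpair_nonneg (hα : IsCoefficient Ω α)
    (hne : ¬ (q = 0 ∧ u = 0 ∧ η = 0))
    (hloc : ∀ j, IsLocalSolution α (T.elem j) (τ.val j) (tr η j) (val (lam • u j).1) (q j, u j))
    (h3 : ∀ μ : Mh T k, ∑ j, ∑ i, intF (T.elem j) i
      (fun x => tr μ j i x * (qhat τ q u η j i x ⬝ᵥ normal (T.elem j) i)) = 0) :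
    u ≠ 0 ∧ 0 ≤ lam := by
  choose p hp using exists_isTrace η
  have hE := sum_energy_of_eigenpair hloc h3 hp
  have h0 := fun j => energy_ge hα (T.interior_subset j) (τ.nonneg j) (q j) (fun i => u j - p j i)
  have h1 : ∀ j, 0 ≤ energy α (T.elem j) (τ.val j) (q j) (fun i => u j - p j i) :=
    fun j => (h0 j).1.trans (h0 j).2.1
  have hu : u ≠ 0 := by
    rintro rfl
    rw [map_zero, mul_zero, Finset.sum_eq_zero_iff_of_nonneg fun j _ => h1 j] at hE
    have h2 : q = 0 := funext fun j => eq_zero_of_cForm_eq_zero hα (T.interior_subset j)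
      (le_antisymm ((h0 j).2.1.trans (hE j (Finset.mem_univ j)).le) (h0 j).1)
    refine hne ⟨h2, rfl, eq_zero_of_energy_eq_zero hα τ η q hp (fun j => ?_)
      fun j => hE j (Finset.mem_univ j)⟩
    exact fluxRelation_of_eq (hp j) (hloc j).1
  refine ⟨hu, ?_⟩
  have h2 : 0 < massForm T k u u :=
    (massForm_nonneg u).lt_of_ne fun h => hu (eq_zero_of_massForm_eq_zero h.symm)
  by_contra hl
  have := mul_neg_of_neg_of_pos (not_le.1 hl) h2
  rw [← hE] at this
  exact absurd (Finset.sum_nonneg fun j _ => h1 j) (not_le.2 this)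

omit [NeZero n] in
lemma diamK_le_h (T : Mesh Ω) (j : Fin T.N) : diamK (T.elem j) ≤ T.h :=
  le_ciSup (f := fun j => diamK (T.elem j)) (Set.finite_range _).bddAbove j

/-- The distance of the potential to the lifting of its trace. -/
lemma massForm_sub_opU_le (hα : IsCoefficient Ω α) {γ Cstar C₀ : ℝ} (hC₀ : 0 < C₀)
    (hlc : IsLocalConstant Ω α k γ Cstar C₀) (hT : T.ShapeRegular γ)
    (hτ : PenaltyBound T τ Cstar) (hlam : 0 ≤ lam)
    (hloc : ∀ j, IsLocalSolution α (T.elem j) (τ.val j) (tr η j) (val (lam • u j).1) (q j, u j)) :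
    massForm T k (u - opU T τ α η) (u - opU T τ α η) ≤
      (C₀ * Cstar * T.h * lam) ^ 2 * massForm T k u u := by
  rw [massForm_self, massForm_self, Finset.mul_sum]
  refine Finset.sum_le_sum fun j _ => ?_
  obtain ⟨p, hp⟩ := exists_isTrace η j
  -- Both local solutions have trace `η`, so by linearity their difference has zero trace and source
  -- `lam • u`.
  have h1 : u j - opU T τ α η j = opUW T τ α k (val (lam • u j).1) j := by
    have e1 := localSolution_trace hα τ η j hp
    have e2 := (isLocalSolution_iff_eq hα (T.interior_subset j) (τ.nonneg j) (tauMax_pos τ j)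
      hp _ _).1 (hloc j)
    rw [opUW, localSolution_eq hα (T.interior_subset j) (τ.nonneg j) (tauMax_pos τ j) isTrace_zero,
      show ((0, lam • u j) : (Fin (n + 1) → Poly n k) × Poly n k) = (p, lam • u j) - (p, 0) by simp,
      map_sub, ← e1, ← e2]
    rfl
  have h2 := hlc T τ hT hτ j (val (lam • u j).1) (memLp_cell _ (continuous_valP _))
  have h3 : normK (T.elem j) (val (lam • u j).1) = lam * normK (T.elem j) (val (u j).1) := by
    rw [normK, normK, ← Real.sqrt_sq hlam, ← Real.sqrt_mul (sq_nonneg _), ← intK_const_mul,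
      Real.sqrt_sq hlam]
    congr 2; ext x
    rw [Submodule.coe_smul, val_smul, mul_pow]
  have h4 : ∀ w : Poly n k, intK (T.elem j) (fun x => val w.1 x ^ 2) =
      normK (T.elem j) (val w.1) ^ 2 := fun w =>
    (Real.sq_sqrt (intK_nonneg _ fun x _ => sq_nonneg _)).symm
  rw [Pi.sub_apply, h1, h4, h4, ← mul_pow]
  have h5 : 0 ≤ normK (T.elem j) (val (u j).1) := Real.sqrt_nonneg _
  have hd := diamK_pos (T.elem j)
  refine pow_le_pow_left₀ (Real.sqrt_nonneg _) (h2.trans ?_) 2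
  rw [h3]
  calc C₀ * dConst (T.elem j) (τ.val j) ^ 2 * diamK (T.elem j) ^ 2 *
        (lam * normK (T.elem j) (val (u j).1))
      = C₀ * (dConst (T.elem j) (τ.val j) ^ 2 * diamK (T.elem j)) * diamK (T.elem j) *
        lam * normK (T.elem j) (val (u j).1) := by ring
    _ ≤ C₀ * Cstar * T.h * lam * normK (T.elem j) (val (u j).1) := by
      have h6 := (hτ j).1
      have h7 := diamK_le_h T j
      have : 0 ≤ Cstar := le_trans (by positivity) h6
      gcongr

/-- Every HDG eigenvalue below the threshold is close to a condensed eigenvalue. -/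
lemma exists_condensedEigenvalue (hn : 2 ≤ n) (hΩ : IsPolyhedralDomain Ω)
    (hα : IsCoefficient Ω α) {γ Cstar C₀ C₃ : ℝ} (hCs : 0 < Cstar) (hC₀ : 0 < C₀)
    (hlc : IsLocalConstant Ω α k γ Cstar C₀) (hC₃ : C₃ < (C₀ * Cstar)⁻¹) :
    ∃ C : ℝ, 0 < C ∧ ∀ lamMax : ℝ, 0 < lamMax → ∃ h₀ : ℝ, 0 < h₀ ∧
      ∀ (T : Mesh Ω) (τ : Penalty T), T.ShapeRegular γ → PenaltyBound T τ Cstar → T.h ≤ h₀ →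
        ∀ lam : ℝ, IsHDGEigenvalue T τ α k lam → lam < C₃ / T.h → lam ≤ lamMax →
          ∃ lamt : ℝ, IsCondensedEigenvalue T τ α k lamt ∧
            |lam - lamt| / lam ≤ C * lam * lamt * T.h := by
  obtain ⟨CP, hCP, HP⟩ := exists_poincare hn hΩ hα k γ Cstar
  have hκ : 0 < 1 - C₀ * Cstar * C₃ := by
    have h1 : 0 < C₀ * Cstar := by positivity
    have := mul_lt_mul_of_pos_left hC₃ h1
    rw [mul_inv_cancel₀ h1.ne'] at this
    linarith
  set κ := 1 - C₀ * Cstar * C₃ with hκdef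
  -- `C₀ * Cstar` comes from the distance of `u` to `𝒰η`, `1 / κ` from replacing `‖u‖` by `‖𝒰η‖`,
  -- and `CP` from applying the Poincaré inequality once to each argument of the residual.
  set C := C₀ * Cstar * CP / κ with hCdef
  have hC : 0 < C := by positivity
  -- This threshold makes `C * lam ^ 2 * T.h` at most one half, which later forces `lam * t` to be
  -- positive.
  refine ⟨C, hC, fun Λ hΛ => ⟨1 / (2 * C * Λ ^ 2), by positivity,
    fun T τ hT hτ hh lam hlam hlt hle => ?_⟩⟩
  obtain ⟨q, u, η, hne, h1, h2, h3⟩ := hlam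
  have hloc := isLocalSolution_of_eigenpair h1 h2
  obtain ⟨hu, hl0⟩ := eigenpair_nonneg hα hne hloc h3
  -- The supremum over an empty mesh would be zero; the nonzero potential supplies an element.
  have hh0 : 0 < T.h := by
    obtain ⟨j, -⟩ : ∃ j, u j ≠ 0 := by
      by_contra hcon
      push Not at hcon
      exact hu (funext hcon)
    exact (diamK_pos (T.elem j)).trans_le (diamK_le_h T j)
  have hlh : lam * T.h ≤ C₃ := ((lt_div_iff₀ hh0).1 hlt).le
  set w := opU T τ α η with hw
  have hδ := massForm_sub_opU_le hα hC₀ hlc hT hτ hl0 hloc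
  rw [← hw] at hδ
  set θ := C₀ * Cstar * T.h * lam with hθ
  have hθ0 : 0 ≤ θ := by positivity
  have hθκ : θ ≤ 1 - κ := by
    rw [hθ, hκdef]
    have := mul_le_mul_of_nonneg_left hlh (by positivity : 0 ≤ C₀ * Cstar)
    linarith
  have hCS := fun a b : Wh T k => sq_bilin_le (massForm T k) massForm_comm massForm_nonneg a b
  have hCS' : ∀ a b : Wh T k, |massForm T k a b| ≤
      Real.sqrt (massForm T k a a) * Real.sqrt (massForm T k b b) := by
    intro a b
    rw [← Real.sqrt_mul (massForm_nonneg a)]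
    exact Real.abs_le_sqrt (hCS a b)
  set X := Real.sqrt (massForm T k u u) with hX
  have hmu : 0 < massForm T k u u :=
    (massForm_nonneg u).lt_of_ne fun h => hu (eq_zero_of_massForm_eq_zero h.symm)
  have hX0 : 0 < X := Real.sqrt_pos.2 hmu
  have hXX : X * X = massForm T k u u := Real.mul_self_sqrt hmu.le
  set Y := Real.sqrt (massForm T k w w) with hY
  have hZ : Real.sqrt (massForm T k (u - w) (u - w)) ≤ θ * X := by
    refine (Real.sqrt_le_sqrt hδ).trans (le_of_eq ?_)
    rw [Real.sqrt_mul (sq_nonneg _), Real.sqrt_sq hθ0]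
  have hXY : κ * X ≤ Y := by
    have e1 : massForm T k u u = massForm T k u w + massForm T k u (u - w) := by
      rw [← map_add, add_sub_cancel]
    have e2 := (le_abs_self _).trans (hCS' u w)
    have e3 := (le_abs_self _).trans (hCS' u (u - w))
    have e4 : X * X ≤ X * (Y + θ * X) := by
      rw [hXX, e1, mul_add]
      exact add_le_add e2 (e3.trans (mul_le_mul_of_nonneg_left hZ hX0.le))
    have e5 := le_of_mul_le_mul_left e4 hX0
    have e6 := mul_le_mul_of_nonneg_right hθκ hX0.le
    linarith
  have hη : η ≠ 0 := by
    rintro rfl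
    have e1 : w = 0 := (opULin hα τ k).map_zero
    have e2 : Y = 0 := by rw [hY, e1]; simp
    have := mul_pos hκ hX0
    linarith
  set ε := C * lam ^ 2 * T.h with hε
  have hε0 : 0 ≤ ε := by positivity
  have hres : ∀ μ : Mh T k, |condensedForm hα τ k η μ -
      lam * ((massForm T k).compl₁₂ (opULin hα τ k) (opULin hα τ k)) η μ| ≤
      ε * Real.sqrt (condensedForm hα τ k η η * condensedForm hα τ k μ μ) := by
    intro μ
    change |ah T τ α η μ - lam * massForm T k w (opU T τ α μ)| ≤
      ε * Real.sqrt (ah T τ α η η * ah T τ α μ μ)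
    rw [ah_eq_of_eigenpair hα hloc h3, ← mul_sub, ← LinearMap.sub_apply, ← map_sub, abs_mul,
      abs_of_nonneg hl0]
    have hP : ∀ ν : Mh T k, Real.sqrt (massForm T k (opU T τ α ν) (opU T τ α ν)) ≤
        Real.sqrt CP * Real.sqrt (ah T τ α ν ν) := by
      intro ν
      rw [← Real.sqrt_mul hCP.le]
      exact Real.sqrt_le_sqrt (HP T τ hT hτ ν)
    have hYP : Y ≤ Real.sqrt CP * Real.sqrt (ah T τ α η η) := hP η
    have hXκ : X ≤ Y / κ := by rw [le_div_iff₀ hκ]; linarith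
    calc lam * |massForm T k (u - w) (opU T τ α μ)|
        ≤ lam * (θ * (Real.sqrt CP * Real.sqrt (ah T τ α η η) / κ) *
          (Real.sqrt CP * Real.sqrt (ah T τ α μ μ))) := by
          refine mul_le_mul_of_nonneg_left ((hCS' _ _).trans ?_) hl0
          refine mul_le_mul (hZ.trans ?_) (hP μ) (Real.sqrt_nonneg _) (by positivity)
          refine mul_le_mul_of_nonneg_left (hXκ.trans ?_) hθ0
          gcongr
      _ = ε * (Real.sqrt (ah T τ α η η) * Real.sqrt (ah T τ α μ μ)) := by
          have := Real.mul_self_sqrt hCP.le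
          rw [hε, hCdef, hθ]
          field_simp
          linear_combination (Real.sqrt (ah T τ α η η) * Real.sqrt (ah T τ α μ μ) * lam ^ 2) * this
      _ = _ := by rw [Real.sqrt_mul (ah_self_nonneg hα τ η)]
  obtain ⟨t, v, hv, hMv, ht⟩ := exists_generalized_eigenvector (condensedForm hα τ k)
    ((massForm T k).compl₁₂ (opULin hα τ k) (opULin hα τ k)) (ah_comm hα τ)
    (ah_self_nonneg hα τ) (fun μ hμ => eq_zero_of_ah_eq_zero hn hΩ hα hT hτ hμ)
    (fun μ ν => massForm_comm _ _) hη hε0 hres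
  have hε1 : ε ≤ 1 / 2 := by
    have e1 : lam ^ 2 ≤ Λ ^ 2 := pow_le_pow_left₀ hl0 hle 2
    calc ε ≤ C * Λ ^ 2 * (1 / (2 * C * Λ ^ 2)) := by rw [hε]; gcongr
      _ = 1 / 2 := by field_simp
  have hlt1 : 1 / 2 ≤ lam * t := by
    have := (le_abs_self _).trans (ht.trans hε1)
    linarith
  have hlpos : 0 < lam := hl0.lt_of_ne fun h => by rw [← h] at hlt1; norm_num at hlt1
  have htpos : 0 < t := by
    by_contra hcon
    have := mul_nonpos_of_nonneg_of_nonpos hl0 (not_lt.1 hcon)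
    linarith
  -- The spectral step compares the mass form with `a_h`, so its eigenvalue is the reciprocal of the
  -- condensed one; dividing `|1 - lam * t|` by `lam * t` produces the relative error.
  refine ⟨t⁻¹, ⟨inv_pos.2 htpos, v, hv, fun μ => ?_⟩, ?_⟩
  · have h4 : massForm T k (opU T τ α v) (opU T τ α μ) = t * ah T τ α v μ := hMv μ
    rw [← massForm_apply, h4, inv_mul_cancel_left₀ htpos.ne']
  · have e1 : |lam - t⁻¹| / lam = |1 - lam * t| * t⁻¹ / lam := by
      rw [show lam - t⁻¹ = -(1 - lam * t) * t⁻¹ by field_simp; ring, abs_mul, abs_neg,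
        abs_of_pos (inv_pos.2 htpos)]
    rw [e1, div_le_iff₀ hlpos]
    calc |1 - lam * t| * t⁻¹ ≤ ε * t⁻¹ := mul_le_mul_of_nonneg_right ht (inv_pos.2 htpos).le
      _ = _ := by rw [hε]; ring

end Main

end

end HDG

end

theorem theorem5p4 (n : ℕ) [NeZero n] (hn : 2 ≤ n) (Ω : Set (HDG.E n))
    (hΩ : HDG.IsPolyhedralDomain Ω)
    (α : HDG.E n → Matrix (Fin n) (Fin n) ℝ) (hα : HDG.IsCoefficient Ω α)
    (k : ℕ) (γ : ℝ) :
    (∃ C₀ : ℝ, 0 < C₀ ∧ ∀ Cstar : ℝ, HDG.IsLocalConstant Ω α k γ Cstar C₀) ∧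
    ∀ Cstar C₀ C₃ : ℝ, 0 < Cstar → 0 < C₀ → HDG.IsLocalConstant Ω α k γ Cstar C₀ →
      0 < C₃ → C₃ < (C₀ * Cstar)⁻¹ →
      ∃ C : ℝ, 0 < C ∧ ∀ lamMax : ℝ, 0 < lamMax → ∃ h₀ : ℝ, 0 < h₀ ∧
        ∀ (T : HDG.Mesh Ω) (τ : HDG.Penalty T),
          T.ShapeRegular γ → HDG.PenaltyBound T τ Cstar → T.h ≤ h₀ →
          ∀ lam : ℝ, HDG.IsHDGEigenvalue T τ α k lam → lam < C₃ / T.h → lam ≤ lamMax →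
            ∃ lamt : ℝ, HDG.IsCondensedEigenvalue T τ α k lamt ∧
              |lam - lamt| / lam ≤ C * lam * lamt * T.h :=
  ⟨HDG.exists_isLocalConstant hα k γ, fun _ _ _ hCs hC₀ hlc _ hC₃ =>
    HDG.exists_condensedEigenvalue hn hΩ hα hCs hC₀ hlc hC₃⟩
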